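/- **Conventions.** A *finitary proper logic* $\mathcal L$ is given as follows. Sentences of a signature $S$ are finite strings of logical symbols and symbols of $S$, i.e. they consist of one of countably many shapes $s\in\omega$ (the string with place-holders instead of the symbols of $S$; the place-holders form a finite signature $t_s$) and an assignment of symbols of $S$ to the place-holders. For a structure $\mathfrak A$ of signature $t_s$, "$\mathfrak A\models_{\mathcal L}s$" is defined by a formula $\mathrm{sat}(\mathfrak A,s,p)$ of the language of set theory with a parameter $p\subseteq\omega$; a general sentence is evaluated in the reduct given by the assignment of symbols. Free variables are treated as new constant symbols, and each formula has finitely many. $\mathcal L$ is invariant under isomorphism, contains first-order logic, and is closed under negation, conjunction, existential quantification, relativization, and substitution of first-order definitions for symbols. Structures are sets with nonempty domain. The spectrum $\mathrm{WCS}(\mathcal L)$ is the class of cardinals $\kappa>\aleph_0$ such that every $\mathcal L$-theory in a signature with at most $\kappa$ symbols, all of whose subsets of size $<\kappa$ are satisfiable, is satisfiable; $\kappa$ is *weakly $\mathcal L$-compact* if $\kappa\in\mathrm{WCS}(\mathcal L)$. A transitive set $N$ (satisfying Zermelo set theory with choice, without power set) is *$\mathcal L$-truthful* if $p\in N$ and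 $N\models \mathrm{sat}(\mathfrak A,s,p)$ is equivalent to $\mathfrak A\models_{\mathcal L}s$ for all shapes $s$ and all structures $\mathfrak A\in N$ of signature $t_s$; a non-transitive $N$ is $\mathcal L$-truthful if its Mostowski collapse is. **Theorem 3.1.** Let $\mathcal L$ be a finitary proper logic such that $V_\theta$ is $\mathcal L$-truthful for all regular uncountable $\theta$, and such that well-foundedness of a binary relation is expressed by an $\mathcal L$-sentence. Let $\kappa$ be an infinite cardinal. (1) Consider the property $(*)$ for every regular $\theta\ge\kappa$ and every $M\prec V_\theta$ with $\kappa+1\subseteq M$ and $|M|=\kappa$ there are an $\mathcal L$-truthful set $N$ with $\kappa+1\subseteq N$ and an elementary embedding $j:\langle M,\in\rangle\to\langle N,\in\rangle$ such that $j(\kappa)>\min(\mathrm{On}^N\setminus\sup j''\kappa)$ (i.e. some ordinal $\delta<j(\kappa)$ of $N$ satisfies $j(\alpha)\le\delta$ for all $\alpha<\kappa$). If $\kappa$ is regular, then $\kappa\in\mathrm{WCS}(\mathcal L)$ if and only if $(*)$ holds. The implication from $(*)$ to $\kappa\in\mathrm{WCS}(\mathcal L)$ holds for every infinite $\kappa$.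 (2) Let $\mathcal L^*$ be obtained from $\mathcal L$ by closing the set of $\mathcal L$-formulas under conjunctions and disjunctions of sets of fewer than $\kappa$ formulas and under the first-order logical operations. Then $\kappa$ is weakly $\mathcal L^*$-compact if and only if $2^{<\kappa}=\kappa$ and for every regular $\theta\ge\kappa$ and every $M\prec V_\theta$ with $\kappa+1\subseteq M$ and $|M|=\kappa$ there are an $\mathcal L$-truthful set $N$ with $\kappa+1\subseteq N$ and an elementary embedding $j:\langle M,\in\rangle\to\langle N,\in\rangle$ with $j(\alpha)=\alpha$ for all $\alpha<\kappa$ and $j(\kappa)>\kappa$. -/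

import Mathlib

open FirstOrder Cardinal

universe u v w

namespace AbstractLogic

/-! ### The universe of sets and its submodels

The set-theoretic universe is `ZFSet.{u}`; its ordinals and cardinals are `Ordinal.{u}` and
`Cardinal.{u}`, and its cumulative hierarchy is `ZFSet.vonNeumann`. -/

inductive MemRel : ℕ → Type
  | mem : MemRel 2

/-- The first-order language of set theory: one binary relation symbol and nothing else. -/
def memLang : FirstOrder.Language.{0, 0} := ⟨fun _ => Empty, MemRel⟩

/-- The universe as a structure for the language of set theory. -/
instance memStructureUniv : memLang.Structure ZFSet.{u} where
  funMap := fun f _ => f.elim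
  RelMap
    | MemRel.mem => fun x => x 0 ∈ x 1

/-- A set, seen as a structure with the true membership relation. -/
instance memStructure (N : ZFSet.{u}) : memLang.Structure N where
  funMap := fun f _ => f.elim
  RelMap
    | MemRel.mem => fun x => (x 0 : ZFSet.{u}) ∈ (x 1 : ZFSet.{u})

/-- `HoldsIn N φ x`: the parameters `x i` are elements of `N`, and `⟨N, ∈⟩ ⊨ φ(x)`. -/
def HoldsIn (N : ZFSet.{u}) {n : ℕ} (φ : memLang.Formula (Fin n)) (x : Fin n → ZFSet.{u}) : Prop :=
  ∃ h : ∀ i, x i ∈ N, φ.Realize (fun i => (⟨x i, h i⟩ : N))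

/-- `M ≺ X` for sets `M`, `X` with the true membership relation. -/
def ElemSubmodel (M X : ZFSet.{u}) : Prop :=
  ∃ h : ∀ a ∈ M, a ∈ X, ∀ (n : ℕ) (φ : memLang.Formula (Fin n)) (x : Fin n → M),
    φ.Realize x ↔ φ.Realize (fun i => (⟨(x i).1, h _ (x i).2⟩ : X))

/-- The collapsing function of `⟨N, ∈⟩`, `x ↦ {collapse y : y ∈ x ∩ N}`. -/
noncomputable def collapse (N x : ZFSet.{u}) : ZFSet.{u} :=
  ZFSet.range (fun y : {y : x // y.1 ∈ N} => collapse N y.1.1)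
termination_by x
decreasing_by exact y.1.2

/-- The Mostowski collapse of `⟨N, ∈⟩`. -/
noncomputable def mostowski (N : ZFSet.{u}) : ZFSet.{u} :=
  ZFSet.range (fun y : N => collapse N y.1)

/-- The natural number `n` as a finite von Neumann ordinal. -/
noncomputable def natSet (n : ℕ) : ZFSet.{u} := (n : Ordinal.{u}).toZFSet

/-- A set of natural numbers as a subset of `ω`. -/
noncomputable def realSet (P : Set ℕ) : ZFSet.{u} := ZFSet.range (fun n : P => natSet.{u} n.1)

/-- The ordered tuple `(x₀, (x₁, … (xₙ₋₁, ∅)))`. -/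
noncomputable def tuple (l : List ZFSet.{u}) : ZFSet.{u} := l.foldr ZFSet.pair ∅

/-! ### Structures whose underlying set is an element of the universe -/

/-- A structure in the signature `S`: a nonempty set with an interpretation of the symbols. -/
structure Str (S : FirstOrder.Language.{v, w}) where
  carrier : ZFSet.{u}
  nonempty : carrier.Nonempty
  str : S.Structure carrier

namespace Str

variable {S : FirstOrder.Language.{v, w}}

def Dom (A : Str.{u} S) : Type (u + 1) := A.carrier

instance (A : Str.{u} S) : S.Structure A.Dom := A.str

instance (A : Str.{u} S) : Small.{u} A.Dom := ZFSet.small_coe A.carrier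

/-- The set denoted by an element of the structure. -/
def val {A : Str.{u} S} (a : A.Dom) : ZFSet.{u} := Subtype.val (p := fun x => x ∈ A.carrier) a

/-- The reduct of `A` along an interpretation of the symbols of `S'` as symbols of `S`. -/
def reduct {S' : FirstOrder.Language} (ρ : S' →ᴸ S) (A : Str.{u} S) : Str.{u} S' :=
  ⟨A.carrier, A.nonempty, @FirstOrder.Language.LHom.reduct S' S ρ A.carrier A.str⟩

/-- The expansion of `A` in which the new constant symbol `i` denotes `x i`. -/
def withConst {α : Type*} (A : Str.{u} S) (x : α → A.Dom) : Str.{u} (S[[α]]) :=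
  ⟨A.carrier, A.nonempty,
    @FirstOrder.Language.sumStructure S (FirstOrder.Language.constantsOn α) A.carrier A.str
      (FirstOrder.Language.constantsOn.structure x)⟩

noncomputable def relSet (A : Str.{u} S) {n : ℕ} (R : S.Relations n) : ZFSet.{u} :=
  ZFSet.range (fun x : {x : Fin n → A.Dom // FirstOrder.Language.Structure.RelMap R x} =>
    tuple (List.ofFn fun i => val (x.1 i)))

noncomputable def funSet (A : Str.{u} S) {n : ℕ} (f : S.Functions n) : ZFSet.{u} :=
  ZFSet.range (fun x : Fin n → A.Dom =>
    ZFSet.pair (tuple (List.ofFn fun i => val (x i))) (val (FirstOrder.Language.Structure.funMap f x)))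

end Str

/-- A finite signature, given by the list of the arities of its function symbols (constant symbols
being the function symbols of arity `0`) and the list of the arities of its relation symbols. -/
structure FinSig where
  funs : List ℕ
  rels : List ℕ

def FinSig.lang (t : FinSig) : FirstOrder.Language.{0, 0} :=
  ⟨fun n => {i : Fin t.funs.length // t.funs.get i = n},
    fun n => {i : Fin t.rels.length // t.rels.get i = n}⟩

/-- The set coding a structure in a finite signature: the tuple that consists of the underlying set,
the graphs of the functions, and the relations. -/
noncomputable def code {t : FinSig} (A : Str.{u} t.lang) : ZFSet.{u} :=
  tuple (A.carrier ::
    ((List.ofFn fun i : Fin t.funs.length =>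
        A.funSet (n := t.funs.get i) (show t.lang.Functions _ from ⟨i, rfl⟩)) ++
      (List.ofFn fun i : Fin t.rels.length =>
        A.relSet (n := t.rels.get i) (show t.lang.Relations _ from ⟨i, rfl⟩))))

/-! ### Satisfiability and weak compactness -/

/-- Sentences and their model relation, for all signatures. -/
structure ModelRelation where
  Sentence : FirstOrder.Language.{u, u} → Type u
  Sat : ∀ {S : FirstOrder.Language.{u, u}}, Str.{u} S → Sentence S → Prop

namespace ModelRelation

def Satisfiable (𝓛 : ModelRelation.{u}) {S : FirstOrder.Language.{u, u}} (T : Set (𝓛.Sentence S)) : Prop :=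
  ∃ A : Str.{u} S, ∀ φ ∈ T, 𝓛.Sat A φ

/-- Every subset of `T` of size `< κ` is satisfiable. -/
def LTSatisfiable (𝓛 : ModelRelation.{u}) {S : FirstOrder.Language.{u, u}} (κ : Cardinal.{u})
    (T : Set (𝓛.Sentence S)) : Prop :=
  ∀ T₀ ⊆ T, #T₀ < κ → 𝓛.Satisfiable T₀

/-- The weak compactness spectrum. -/
def WCS (𝓛 : ModelRelation.{u}) : Set Cardinal.{u} :=
  {κ | ℵ₀ < κ ∧ ∀ S : FirstOrder.Language.{u, u}, S.card ≤ κ → ∀ T : Set (𝓛.Sentence S),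
    𝓛.LTSatisfiable κ T → 𝓛.Satisfiable T}

end ModelRelation

/-! ### Finitary logics -/

/-- A finitary logic together with its set-theoretic definition.

Sentences are finite strings made from logical symbols and symbols of the signature. Such a string
is recorded as its shape (the string with the symbols of the signature replaced by place-holders),
which is coded by a natural number `s`, and the list of the symbols that fill the place-holders.
`sig s` is the finite signature of the place-holders of the shape `s`. The model relation is
given, for structures in the signatures of place-holders, by the formula `sat(A, s, p)` of the
language of set theory, where `p ⊆ ω` is the parameter `param`. -/
structure FinitaryLogic where
  sig : ℕ → FinSig
  param : Set ℕ
  sat : memLang.Formula (Fin 3)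

namespace FinitaryLogic

variable (L : FinitaryLogic)

/-- Sentences in the signature `S`: a shape whose place-holders are filled with symbols of `S`. -/
def Sentence (S : FirstOrder.Language.{v, w}) : Type (max v w) :=
  Σ s : ℕ, ((L.sig s).lang →ᴸ S)

/-- The model relation `A ⊨ φ`, evaluated in the universe. -/
def Sat {S : FirstOrder.Language.{v, w}} (A : Str.{u} S) (φ : L.Sentence S) : Prop :=
  L.sat.Realize ![code (A.reduct φ.2), natSet φ.1, realSet L.param]

def toModelRelation : ModelRelation.{u} where
  Sentence := fun S => L.Sentence S
  Sat := fun A φ => L.Sat A φ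

/-- Formulas with the `n` free variables `0, …, n - 1`; as usual in abstract logics, free variables
are new constant symbols. -/
def Formula (S : FirstOrder.Language.{v, w}) (n : ℕ) : Type (max v w) := L.Sentence (S[[Fin n]])

def Realize {S : FirstOrder.Language.{v, w}} {n : ℕ} (A : Str.{u} S) (φ : L.Formula S n)
    (x : Fin n → A.Dom) : Prop :=
  L.Sat (A.withConst x) φ

end FinitaryLogic

/-- First-order formulas of `S` that define a domain and, on it, the symbols of `S'`. -/
structure Interpretation (S S' : FirstOrder.Language.{u, u}) where
  dom : S.Formula (Fin 1)
  rel : ∀ n, S'.Relations n → S.Formula (Fin n)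
  fn : ∀ n, S'.Functions n → S.Formula (Fin (n + 1))

/-- `e` is an isomorphism of `B` onto the structure that the formulas of `I` define in `A`. -/
structure Interpretation.Defines {S S' : FirstOrder.Language.{u, u}} (I : Interpretation S S')
    (A : Str.{u} S) (B : Str.{u} S') (e : B.Dom → A.Dom) : Prop where
  injective : Function.Injective e
  dom_iff : ∀ a : A.Dom, I.dom.Realize ![a] ↔ ∃ b, e b = a
  rel_iff : ∀ (n : ℕ) (R : S'.Relations n) (x : Fin n → B.Dom),
    (I.rel n R).Realize (e ∘ x) ↔ FirstOrder.Language.Structure.RelMap R x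
  fn_iff : ∀ (n : ℕ) (f : S'.Functions n) (x : Fin n → B.Dom) (y : B.Dom),
    (I.fn n f).Realize (Fin.snoc (α := fun _ => A.Dom) (e ∘ x) (e y)) ↔
      FirstOrder.Language.Structure.funMap f x = y

namespace FinitaryLogic

variable (L : FinitaryLogic)

/-- Proper (regular) logics: closure under isomorphism, inclusion of first-order logic, closure
under negation, conjunction and existential quantification, and closure under relativization and
substitution of first-order definitions for the symbols of the signature. Invariance under reducts
and renaming of symbols is built into `FinitaryLogic.Sat`. -/
structure Proper : Prop where
  iso : ∀ (S : FirstOrder.Language.{u, u}) (A B : Str.{u} S), Nonempty (A.Dom ≃[S] B.Dom) →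
    ∀ φ : L.Sentence S, L.Sat A φ ↔ L.Sat B φ
  firstOrder : ∀ (S : FirstOrder.Language.{u, u}) (φ : S.Sentence), ∃ ψ : L.Sentence S,
    ∀ A : Str.{u} S, L.Sat A ψ ↔ A.Dom ⊨ φ
  neg : ∀ (S : FirstOrder.Language.{u, u}) (φ : L.Sentence S), ∃ ψ : L.Sentence S,
    ∀ A : Str.{u} S, L.Sat A ψ ↔ ¬ L.Sat A φ
  conj : ∀ (S : FirstOrder.Language.{u, u}) (φ₁ φ₂ : L.Sentence S), ∃ ψ : L.Sentence S,
    ∀ A : Str.{u} S, L.Sat A ψ ↔ L.Sat A φ₁ ∧ L.Sat A φ₂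
  exist : ∀ (S : FirstOrder.Language.{u, u}) (φ : L.Formula S 1), ∃ ψ : L.Sentence S,
    ∀ A : Str.{u} S, L.Sat A ψ ↔ ∃ a : A.Dom, L.Realize A φ ![a]
  subst : ∀ (S S' : FirstOrder.Language.{u, u}) (I : Interpretation S S') (φ : L.Sentence S'),
    ∃ ψ : L.Sentence S, ∀ (A : Str.{u} S) (B : Str.{u} S') (e : B.Dom → A.Dom),
      I.Defines A B e → (L.Sat A ψ ↔ L.Sat B φ)

/-- The transitive set `N` contains the parameter of `L` and computes the model relation of `L`
correctly for the structures that it contains. -/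
def TruthfulTransitive (N : ZFSet.{u}) : Prop :=
  realSet L.param ∈ N ∧
    ∀ (s : ℕ) (A : Str.{u} (L.sig s).lang), code A ∈ N →
      (HoldsIn N L.sat ![code A, natSet s, realSet L.param] ↔
        L.sat.Realize ![code A, natSet s, realSet L.param])

/-- `N` is `L`-truthful. A set `N` that is not transitive is identified with its Mostowski
collapse. The notion is applied only to sets `N` that are elementarily equivalent to some `V_θ`
with `θ` regular uncountable, so that `⟨N, ∈⟩` satisfies Zermelo set theory with choice. -/
def Truthful (N : ZFSet.{u}) : Prop := L.TruthfulTransitive (mostowski N)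

/-- Every `V_θ` with `θ` regular and uncountable is `L`-truthful. -/
def TruthfulRanks : Prop :=
  ∀ θ : Cardinal.{u}, θ.IsRegular → ℵ₀ < θ → L.Truthful (ZFSet.vonNeumann θ.ord)

/-- Well-foundedness of a binary relation is expressed by a sentence of `L`. -/
def ExpressesWellFounded : Prop :=
  ∃ φ : L.Sentence memLang, ∀ A : Str.{u} memLang,
    L.Sat A φ ↔ WellFounded fun a b : A.Dom =>
      FirstOrder.Language.Structure.RelMap (L := memLang) MemRel.mem ![a, b]

/-! ### The closure under conjunctions and disjunctions of size less than `κ` -/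

/-- Formulas with free variables among `0, …, n - 1` in the closure of the formulas of `L` under
first-order operations and conjunctions and disjunctions of fewer than `κ` formulas. The
families of fewer than `κ` formulas are indexed by the proper initial segments of `κ`. The variable
bound by a quantifier is the last one. -/
inductive InfFormula (S : FirstOrder.Language.{u, u}) (κ : Cardinal.{u}) : ℕ → Type u
  | base {n : ℕ} (φ : L.Formula S n) : InfFormula S κ n
  | neg {n : ℕ} (φ : InfFormula S κ n) : InfFormula S κ n
  | all {n : ℕ} (φ : InfFormula S κ (n + 1)) : InfFormula S κ n
  | ex {n : ℕ} (φ : InfFormula S κ (n + 1)) : InfFormula S κ n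
  | conj {n : ℕ} (μ : κ.ord.ToType) (φ : Set.Iio μ → InfFormula S κ n) : InfFormula S κ n
  | disj {n : ℕ} (μ : κ.ord.ToType) (φ : Set.Iio μ → InfFormula S κ n) : InfFormula S κ n

def InfFormula.Realize {L : FinitaryLogic} {S : FirstOrder.Language.{u, u}} {κ : Cardinal.{u}}
    (A : Str.{u} S) : ∀ {n : ℕ}, L.InfFormula S κ n → (Fin n → A.Dom) → Prop
  | _, .base φ, x => L.Realize A φ x
  | _, .neg φ, x => ¬ φ.Realize A x
  | _, .all φ, x => ∀ a : A.Dom, φ.Realize A (Fin.snoc (α := fun _ => A.Dom) x a)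
  | _, .ex φ, x => ∃ a : A.Dom, φ.Realize A (Fin.snoc (α := fun _ => A.Dom) x a)
  | _, .conj _ φ, x => ∀ i, (φ i).Realize A x
  | _, .disj _ φ, x => ∃ i, (φ i).Realize A x

/-- The `κ`-infinitary closure of `L`. -/
def infClosure (κ : Cardinal.{u}) : ModelRelation.{u} where
  Sentence := fun S => L.InfFormula S κ 0
  Sat := fun A φ => φ.Realize A ![]

/-! ### The embedding properties -/

/-- All ordinals `≤ κ` are elements of `N`. -/
def ContainsSucc (N : ZFSet.{u}) (κ : Cardinal.{u}) : Prop :=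
  ∀ α : Ordinal.{u}, α ≤ κ.ord → α.toZFSet ∈ N

/-- For all regular `θ ≥ κ` and all `M ≺ V_θ` with `κ + 1 ⊆ M` and `|M| = κ` there are `N` with
`κ + 1 ⊆ N` that is `L`-truthful and an elementary embedding `j` of `M` into `N` such that
`j(κ) > min (Onᴺ \ sup j''κ)`: some `δ ∈ N` that is an ordinal in the sense of `N`, being an
element of `j(κ)`, is at least as large as all `j(α)`, `α < κ`. -/
def EmbeddingProperty (κ : Cardinal.{u}) : Prop :=
  ∀ θ : Cardinal.{u}, θ.IsRegular → κ ≤ θ →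
    ∀ M : ZFSet.{u}, ElemSubmodel M (ZFSet.vonNeumann θ.ord) →
      ∀ hM : ContainsSucc M κ, #M = Cardinal.lift.{u + 1} κ →
        ∃ (N : ZFSet.{u}) (j : M ↪ₑ[memLang] N),
          ContainsSucc N κ ∧
          (∃ δ : N, (δ : ZFSet.{u}) ∈ (j ⟨κ.ord.toZFSet, hM _ le_rfl⟩ : ZFSet.{u}) ∧
            ∀ (α : Ordinal.{u}) (hα : α < κ.ord),
              (j ⟨α.toZFSet, hM α hα.le⟩ : ZFSet.{u}) ∈ (δ : ZFSet.{u}) ∨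
                j ⟨α.toZFSet, hM α hα.le⟩ = δ) ∧
          L.Truthful N

/-- The same with embeddings `j` that are the identity below `κ` and satisfy `j(κ) > κ`. -/
def CriticalEmbeddingProperty (κ : Cardinal.{u}) : Prop :=
  ∀ θ : Cardinal.{u}, θ.IsRegular → κ ≤ θ →
    ∀ M : ZFSet.{u}, ElemSubmodel M (ZFSet.vonNeumann θ.ord) →
      ∀ hM : ContainsSucc M κ, #M = Cardinal.lift.{u + 1} κ →
        ∃ (N : ZFSet.{u}) (j : M ↪ₑ[memLang] N),
          ContainsSucc N κ ∧
          (∀ (α : Ordinal.{u}) (hα : α < κ.ord),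
            (j ⟨α.toZFSet, hM α hα.le⟩ : ZFSet.{u}) = α.toZFSet) ∧
          κ.ord.toZFSet ∈ (j ⟨κ.ord.toZFSet, hM _ le_rfl⟩ : ZFSet.{u}) ∧
          L.Truthful N

end FinitaryLogic

end AbstractLogic

set_option linter.unusedVariables false

namespace AbstractLogic

/-! The engine is a Łoś principle for sequences of length `κ`. Given at most `κ` sequences `g i` of
sets, let `M ≺ V_θ` have size `κ` and contain their graphs, and let `j : M → N` be an embedding with
some `δ < j(κ)` above all `j(α)`, `α < κ`. The value of `j(g i)` at `δ` is a limit of the sequence: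
that a first-order property holds for all `α ≥ β` is a statement about `β` and the graphs, so `j`
carries it to `N`, where it applies to `δ ≥ j(β)` (`exists_limits_of_embedding`).

From embeddings to compactness: a theory of at most `κ` sentences is exhausted by an increasing
`κ`-sequence of subsets of size `< κ`, with models `A α`. The limits of the domains and of the
interpretations of the single symbols form a structure. Since `V_θ` and `N` both evaluate `L`
correctly, every sentence that holds eventually holds in the limit (`mem_WCS_of_embeddingProperty`).
Regularity of `κ` plays no role here.

From compactness to embeddings: for regular `κ`, the sentences that hold eventually along a
`κ`-sequence of structures form a theory whose subsets of size `< κ` are satisfied by late members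
of the sequence. This is applied to the expansions of `⟨V_θ, ∈⟩` by names for the elements of `M`
and one more constant that denotes `b < κ`. A model of the theory is well-founded and collapses to a
transitive `N`; the names give `j` and the extra constant gives `δ`. Truthfulness of `N` is
expressible shape by shape: a structure coded by an element is first-order interpretable in `⟨N,
∈⟩`, so closure under substitution turns its actual satisfaction relation into an `L`-formula about
the code (`Proper.exists_truthful_sentence`).

For the infinitary closure, the truth set of each formula is carried along as a further sequence.
The Tarski clauses pass to the limit, and infinite conjunctions acquire no new conjuncts because
their index sets are ordinals below `κ`, which `j` fixes (`Limits.mem_truth_iff`). Critical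
embeddings make `κ` regular, and together with `2 ^< κ = κ` this leaves at most `κ` formulas.
Conversely, infinitary sentences that list the members of each ordinal below `κ` force `j` to be the
identity there, and propositional theories yield `2 ^< κ = κ` and regularity. -/

/-- The membership symbol. -/
abbrev memRel : memLang.Relations 2 := MemRel.mem

/-! ### Definability over transitive sets closed under pairing -/

/-- Nonempty transitive sets closed under unordered pairs. -/
structure PairClosed (X : ZFSet.{u}) : Prop where
  trans : X.IsTransitive
  pair_mem : ∀ x ∈ X, ∀ y ∈ X, ({x, y} : ZFSet) ∈ X
  empty_mem : (∅ : ZFSet) ∈ X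

theorem PairClosed.fst_mem {X : ZFSet.{u}} (hX : PairClosed X) {x y : ZFSet.{u}}
    (h : x.pair y ∈ X) : x ∈ X :=
  hX.trans.mem_trans (show x ∈ ({x} : ZFSet) by simp)
    (hX.trans.mem_trans (show ({x} : ZFSet) ∈ x.pair y by simp [ZFSet.pair]) h)

theorem PairClosed.snd_mem {X : ZFSet.{u}} (hX : PairClosed X) {x y : ZFSet.{u}}
    (h : x.pair y ∈ X) : y ∈ X :=
  hX.trans.mem_trans (show y ∈ ({x, y} : ZFSet) by simp)
    (hX.trans.mem_trans (show ({x, y} : ZFSet) ∈ x.pair y by simp [ZFSet.pair]) h)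

/-- `P` is uniformly definable, by a first-order formula, in all pair-closed transitive sets. -/
def Dfn {α : Type w} (P : ZFSet.{u} → (α → ZFSet.{u}) → Prop) : Prop :=
  ∃ φ : memLang.Formula α, ∀ X : ZFSet.{u}, PairClosed X → ∀ v : α → X,
    φ.Realize v ↔ P X (fun i => v i)

/-- `g` is an operation under which all pair-closed transitive sets are closed, with uniformly
definable graph. -/
structure DfnTerm {α : Type w} (g : (α → ZFSet.{u}) → ZFSet.{u}) : Prop where
  mem : ∀ X : ZFSet.{u}, PairClosed X → ∀ v : α → ZFSet.{u}, (∀ i, v i ∈ X) → g v ∈ X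
  graph : Dfn fun _ (v : α ⊕ Unit → ZFSet.{u}) => v (Sum.inr ()) = g fun i => v (Sum.inl i)

section Closure

variable {α : Type w} {β : Type v} {P Q : ZFSet.{u} → (α → ZFSet.{u}) → Prop}
  {g h : (α → ZFSet.{u}) → ZFSet.{u}}

theorem Dfn.congr (hP : Dfn P)
    (h : ∀ X, PairClosed X → ∀ v : α → ZFSet.{u}, (∀ i, v i ∈ X) → (P X v ↔ Q X v)) : Dfn Q := by
  obtain ⟨φ, hφ⟩ := hP
  exact ⟨φ, fun X hX v => (hφ X hX v).trans (h X hX _ fun i => (v i).2)⟩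

theorem Dfn.not (hP : Dfn P) : Dfn fun X v => ¬ P X v := by
  obtain ⟨φ, hφ⟩ := hP
  exact ⟨φ.not, fun X hX v => by
    rw [FirstOrder.Language.Formula.realize_not, hφ X hX]⟩

theorem Dfn.imp (hP : Dfn P) (hQ : Dfn Q) : Dfn fun X v => P X v → Q X v := by
  obtain ⟨φ, hφ⟩ := hP
  obtain ⟨ψ, hψ⟩ := hQ
  exact ⟨φ.imp ψ, fun X hX v => by
    rw [FirstOrder.Language.Formula.realize_imp, hφ X hX, hψ X hX]⟩

theorem Dfn.and (hP : Dfn P) (hQ : Dfn Q) : Dfn fun X v => P X v ∧ Q X v :=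
  (hP.imp hQ.not).not.congr fun _ _ _ _ => by tauto

theorem Dfn.or (hP : Dfn P) (hQ : Dfn Q) : Dfn fun X v => P X v ∨ Q X v :=
  (hP.not.imp hQ).congr fun _ _ _ _ => by tauto

theorem Dfn.iff (hP : Dfn P) (hQ : Dfn Q) : Dfn fun X v => P X v ↔ Q X v :=
  ((hP.imp hQ).and (hQ.imp hP)).congr fun _ _ _ _ => by tauto

theorem Dfn.const (p : Prop) : Dfn fun (_ : ZFSet.{u}) (_ : α → ZFSet.{u}) => p := by
  by_cases hp : p
  · exact ⟨⊤, fun X _ v => by simp [hp]⟩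
  · exact ⟨⊥, fun X _ v => by simp [hp]⟩

theorem Dfn.forall_fin {γ : Type*} [Finite γ] {P : γ → ZFSet.{u} → (α → ZFSet.{u}) → Prop}
    (hP : ∀ c, Dfn (P c)) : Dfn fun X v => ∀ c, P c X v := by
  choose φ hφ using hP
  exact ⟨FirstOrder.Language.Formula.iInf φ, fun X hX v => by simp [← hφ _ X hX]⟩

theorem Dfn.comp (hP : Dfn P) (f : α → β) : Dfn fun X (v : β → ZFSet.{u}) => P X fun i => v (f i) := by
  obtain ⟨φ, hφ⟩ := hP
  exact ⟨φ.relabel f, fun X hX v => by rw [FirstOrder.Language.Formula.realize_relabel, hφ X hX]; rfl⟩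

theorem Dfn.ex_block [Finite β] {P : ZFSet.{u} → (α → ZFSet.{u}) → (β → ZFSet.{u}) → Prop}
    (hP : Dfn fun X (v : α ⊕ β → ZFSet.{u}) => P X (fun i => v (Sum.inl i)) fun i => v (Sum.inr i)) :
    Dfn fun X v => ∃ w : β → ZFSet.{u}, (∀ b, w b ∈ X) ∧ P X v w := by
  obtain ⟨φ, hφ⟩ := hP
  refine ⟨φ.iExs β, fun X hX v => ?_⟩
  rw [FirstOrder.Language.Formula.realize_iExs]
  constructor
  · rintro ⟨w, hw⟩
    rw [hφ X hX] at hw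
    exact ⟨fun b => w b, fun b => (w b).2, hw⟩
  · rintro ⟨w, hwX, hw⟩
    refine ⟨fun b => ⟨w b, hwX b⟩, ?_⟩
    rw [hφ X hX]
    exact hw

theorem Dfn.all_block [Finite β] {P : ZFSet.{u} → (α → ZFSet.{u}) → (β → ZFSet.{u}) → Prop}
    (hP : Dfn fun X (v : α ⊕ β → ZFSet.{u}) => P X (fun i => v (Sum.inl i)) fun i => v (Sum.inr i)) :
    Dfn fun X v => ∀ w : β → ZFSet.{u}, (∀ b, w b ∈ X) → P X v w :=
  (Dfn.ex_block (P := fun X v w => ¬ P X v w) hP.not).not.congr fun X hX v hv => by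
    push Not
    rfl

theorem Dfn.ex {P : ZFSet.{u} → (α → ZFSet.{u}) → ZFSet.{u} → Prop}
    (hP : Dfn fun X (v : α ⊕ Unit → ZFSet.{u}) => P X (fun i => v (Sum.inl i)) (v (Sum.inr ()))) :
    Dfn fun X v => ∃ y ∈ X, P X v y :=
  (Dfn.ex_block (P := fun X v w => P X v (w ())) hP).congr fun X hX v hv =>
    ⟨fun ⟨w, hw⟩ => ⟨w (), hw.1 (), hw.2⟩, fun ⟨y, hy⟩ => ⟨fun _ => y, fun _ => hy.1, hy.2⟩⟩

theorem DfnTerm.var (i : α) : DfnTerm fun v : α → ZFSet.{u} => v i where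
  mem := fun X _ v hv => hv i
  graph := ⟨(FirstOrder.Language.Term.var (Sum.inr ())).equal (FirstOrder.Language.Term.var (Sum.inl i)),
    fun X _ v => by
      rw [FirstOrder.Language.Formula.realize_equal]
      exact Subtype.ext_iff⟩

theorem DfnTerm.comp (hg : DfnTerm g) (f : α → β) :
    DfnTerm fun v : β → ZFSet.{u} => g fun i => v (f i) where
  mem := fun X hX v hv => hg.mem X hX _ fun i => hv _
  graph := hg.graph.comp (Sum.map f id)

/-- The values `g b v` are named by a finite block of existential quantifiers; closure of `X` under
the operations keeps the witnesses inside `X`. -/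
theorem Dfn.subst [Finite β] {P : ZFSet.{u} → (β → ZFSet.{u}) → Prop} (hP : Dfn P)
    {g : β → (α → ZFSet.{u}) → ZFSet.{u}} (hg : ∀ b, DfnTerm (g b)) :
    Dfn fun X v => P X fun b => g b v := by
  refine (Dfn.ex_block (β := β) (P := fun X v w => (∀ b, w b = g b v) ∧ P X w)
    ((Dfn.forall_fin fun b => ?_).and (hP.comp Sum.inr))).congr fun X hX v hv => ?_
  · exact (hg b).graph.comp (Sum.map id fun _ => b)
  · constructor
    · rintro ⟨w, -, hw, h⟩
      rwa [← funext hw]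
    · intro h
      exact ⟨fun b => g b v, fun b => (hg b).mem X hX v hv, fun _ => rfl, h⟩

theorem Dfn.mem (hg : DfnTerm g) (hh : DfnTerm h) : Dfn fun _ v => g v ∈ h v := by
  have : Dfn fun (_ : ZFSet.{u}) (v : Bool → ZFSet.{u}) => v true ∈ v false := by
    refine ⟨FirstOrder.Language.Relations.formula₂ (L := memLang) memRel
      (FirstOrder.Language.Term.var true) (FirstOrder.Language.Term.var false), fun X _ v => ?_⟩
    exact Iff.rfl
  exact this.subst (g := fun b => if b then g else h) (by rintro (_ | _) <;> simpa)

theorem Dfn.eq (hg : DfnTerm g) (hh : DfnTerm h) : Dfn fun _ v => g v = h v := by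
  have : Dfn fun (_ : ZFSet.{u}) (v : Bool → ZFSet.{u}) => v true = v false := by
    refine ⟨(FirstOrder.Language.Term.var true).equal (FirstOrder.Language.Term.var false),
      fun X _ v => ?_⟩
    rw [FirstOrder.Language.Formula.realize_equal]
    exact Subtype.ext_iff
  exact this.subst (g := fun b => if b then g else h) (by rintro (_ | _) <;> simpa)

/-- Since `X` is transitive, the members of `g v` all lie in `X`, so a quantifier bounded by `g v`
has the same range in `X` and in the universe. -/
theorem Dfn.ex_block_mem [Finite β] {P : ZFSet.{u} → (α → ZFSet.{u}) → (β → ZFSet.{u}) → Prop}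
    (hg : DfnTerm g)
    (hP : Dfn fun X (v : α ⊕ β → ZFSet.{u}) => P X (fun i => v (Sum.inl i)) fun i => v (Sum.inr i)) :
    Dfn fun X v => ∃ w : β → ZFSet.{u}, (∀ b, w b ∈ g v) ∧ P X v w := by
  refine (Dfn.ex_block (P := fun X v w => (∀ b, w b ∈ g v) ∧ P X v w) (Dfn.and
    (Dfn.forall_fin fun b => .mem (.var _) (hg.comp Sum.inl)) hP)).congr fun X hX v hv => ?_
  exact exists_congr fun w => ⟨fun h => h.2,
    fun h => ⟨fun b => hX.trans.mem_trans (h.1 b) (hg.mem X hX v hv), h⟩⟩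

theorem Dfn.all_block_mem [Finite β] {P : ZFSet.{u} → (α → ZFSet.{u}) → (β → ZFSet.{u}) → Prop}
    (hg : DfnTerm g)
    (hP : Dfn fun X (v : α ⊕ β → ZFSet.{u}) => P X (fun i => v (Sum.inl i)) fun i => v (Sum.inr i)) :
    Dfn fun X v => ∀ w : β → ZFSet.{u}, (∀ b, w b ∈ g v) → P X v w :=
  (Dfn.ex_block_mem (P := fun X v w => ¬ P X v w) hg hP.not).not.congr fun X hX v hv => by
    push Not
    rfl

theorem Dfn.ex_mem {P : ZFSet.{u} → (α → ZFSet.{u}) → ZFSet.{u} → Prop} (hg : DfnTerm g)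
    (hP : Dfn fun X (v : α ⊕ Unit → ZFSet.{u}) => P X (fun i => v (Sum.inl i)) (v (Sum.inr ()))) :
    Dfn fun X v => ∃ y ∈ g v, P X v y :=
  (Dfn.ex_block_mem (P := fun X v w => P X v (w ())) hg hP).congr fun X hX v hv =>
    ⟨fun ⟨w, hw⟩ => ⟨w (), hw.1 (), hw.2⟩, fun ⟨y, hy⟩ => ⟨fun _ => y, fun _ => hy.1, hy.2⟩⟩

theorem Dfn.all_mem {P : ZFSet.{u} → (α → ZFSet.{u}) → ZFSet.{u} → Prop} (hg : DfnTerm g)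
    (hP : Dfn fun X (v : α ⊕ Unit → ZFSet.{u}) => P X (fun i => v (Sum.inl i)) (v (Sum.inr ()))) :
    Dfn fun X v => ∀ y ∈ g v, P X v y :=
  (Dfn.ex_mem (P := fun X v w => ¬ P X v w) hg hP.not).not.congr fun X hX v hv => by
    push Not
    rfl

theorem DfnTerm.upair (hg : DfnTerm g) (hh : DfnTerm h) :
    DfnTerm fun v => ({g v, h v} : ZFSet.{u}) where
  mem := fun X hX v hv => hX.pair_mem _ (hg.mem X hX v hv) _ (hh.mem X hX v hv)
  graph := by
    have hg' := hg.comp (Sum.inl (β := Unit))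
    have hh' := hh.comp (Sum.inl (β := Unit))
    refine ((Dfn.mem hg' (.var (Sum.inr ()))).and ((Dfn.mem hh' (.var (Sum.inr ()))).and
      (Dfn.all_mem (P := fun X v y => y = g (fun i => v (Sum.inl i)) ∨ y = h (fun i => v (Sum.inl i)))
        (.var (Sum.inr ())) (.or (.eq (.var _) (hg'.comp _)) (.eq (.var _) (hh'.comp _)))))).congr ?_
    intro X hX v hv
    rw [ZFSet.ext_iff]
    constructor
    · rintro ⟨h1, h2, h3⟩ z
      rw [ZFSet.mem_pair]
      exact ⟨h3 z, by rintro (rfl | rfl) <;> assumption⟩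
    · intro h
      simp [h]

theorem DfnTerm.kpair (hg : DfnTerm g) (hh : DfnTerm h) : DfnTerm fun v => (g v).pair (h v) := by
  have : DfnTerm fun v => ({g v} : ZFSet.{u}) := by simpa using hg.upair hg
  exact this.upair (hg.upair hh)

theorem Dfn.eq_empty (hg : DfnTerm g) : Dfn fun _ v => g v = ∅ :=
  (Dfn.all_mem (P := fun _ _ _ => False) hg (Dfn.const _)).congr fun X hX v hv => by
    rw [ZFSet.eq_empty]

theorem Dfn.eq_insert_self (hg : DfnTerm g) (hh : DfnTerm h) :
    Dfn fun _ v => g v = insert (h v) (h v) := by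
  refine ((Dfn.mem hh hg).and ((Dfn.all_mem (P := fun X v y => y ∈ g v) hh
    (.mem (.var _) (hg.comp _))).and
    (Dfn.all_mem (P := fun X v y => y = h v ∨ y ∈ h v) hg
      (.or (.eq (.var _) (hh.comp _)) (.mem (.var _) (hh.comp _)))))).congr fun X hX v hv => ?_
  rw [ZFSet.ext_iff]
  simp only [ZFSet.mem_insert_iff]
  constructor
  · rintro ⟨h1, h2, h3⟩ z
    exact ⟨h3 z, by rintro (rfl | h); exacts [h1, h2 _ h]⟩
  · intro h
    simp +contextual [h]

/-- Evaluation of a formula with three free variables in the set itself. -/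
theorem Dfn.holdsIn (φ : memLang.Formula (Fin 3)) {g₀ g₁ g₂ : (α → ZFSet.{u}) → ZFSet.{u}}
    (h₀ : DfnTerm g₀) (h₁ : DfnTerm g₁) (h₂ : DfnTerm g₂) :
    Dfn fun X v => HoldsIn X φ ![g₀ v, g₁ v, g₂ v] := by
  have : Dfn fun (X : ZFSet.{u}) (v : Fin 3 → ZFSet.{u}) => HoldsIn X φ v :=
    ⟨φ, fun X hX v => ⟨fun h => ⟨fun i => (v i).2, h⟩, fun ⟨_, h⟩ => h⟩⟩
  refine (this.subst (g := ![g₀, g₁, g₂]) (Fin.forall_fin_succ.2 ⟨h₀, Fin.forall_fin_succ.2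
    ⟨h₁, Fin.forall_fin_succ.2 ⟨h₂, fun i => i.elim0⟩⟩⟩)).congr fun X hX v hv => ?_
  have : (fun b => (![g₀, g₁, g₂] : Fin 3 → _) b v) = ![g₀ v, g₁ v, g₂ v] := by
    funext i
    fin_cases i <;> rfl
  rw [this]

theorem DfnTerm.empty : DfnTerm fun _ : α → ZFSet.{u} => (∅ : ZFSet.{u}) where
  mem := fun X hX _ _ => hX.empty_mem
  graph := .eq_empty (.var _)

/-- The length of the list does not depend on `v`, so the induction runs over the list of
operations. -/
theorem DfnTerm.tuple {l : (α → ZFSet.{u}) → List ZFSet.{u}}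
    {l' : List ((α → ZFSet.{u}) → ZFSet.{u})} (hl : ∀ v, l v = l'.map fun g => g v)
    (hl' : ∀ g ∈ l', DfnTerm g) : DfnTerm fun v => AbstractLogic.tuple (l v) := by
  have : l = fun v => l'.map fun g => g v := funext hl
  subst this
  clear hl
  induction l' with
  | nil => exact .empty
  | cons g l ih => exact (hl' g (by simp)).kpair (ih fun g' hg' => hl' g' (by simp [hg']))

theorem DfnTerm.tuple_ofFn {n : ℕ} {g : Fin n → (α → ZFSet.{u}) → ZFSet.{u}}
    (hg : ∀ i, DfnTerm (g i)) : DfnTerm fun v => AbstractLogic.tuple (List.ofFn fun i => g i v) :=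
  .tuple (l' := List.ofFn g) (fun v => by rw [List.map_ofFn]; rfl) (by simpa [List.forall_mem_ofFn_iff])

end Closure

/-! ### Absoluteness of natural numbers and ordinals -/

theorem natSet_zero : natSet.{u} 0 = ∅ := by simp [natSet]

theorem natSet_succ (n : ℕ) : natSet.{u} (n + 1) = insert (natSet n) (natSet n) := by
  rw [natSet, Nat.cast_add, Nat.cast_one, Ordinal.toZFSet_add_one]; rfl

theorem natSet_injective : Function.Injective natSet.{u} := fun m n h => by
  simpa [natSet] using Ordinal.toZFSet_injective h

theorem mem_realSet {P : Set ℕ} {x : ZFSet.{u}} : x ∈ realSet P ↔ ∃ n ∈ P, natSet n = x := by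
  simp [realSet]

section

variable {α : Type w} {g : (α → ZFSet.{u}) → ZFSet.{u}}

theorem Dfn.eq_natSet (hg : DfnTerm g) (n : ℕ) : Dfn fun _ v => g v = natSet n := by
  induction n generalizing α with
  | zero => simpa only [natSet_zero] using Dfn.eq_empty hg
  | succ n ih =>
    refine (Dfn.ex_mem (P := fun X v y => y = natSet n ∧ g v = insert y y) hg
      ((ih (.var _)).and (.eq_insert_self (hg.comp _) (.var _)))).congr fun X hX v hv => ?_
    rw [natSet_succ]
    constructor
    · rintro ⟨y, -, rfl, h⟩
      exact h
    · intro h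
      exact ⟨_, by simp [h], rfl, h⟩

/-- The defining condition is to be zero or the successor of a member, with every member being zero
or the successor of a member. By `∈`-induction in the universe this characterizes the finite
ordinals, and `ω ∈ X` is not needed. -/
theorem Dfn.isNat (hg : DfnTerm g) : Dfn fun _ v => ∃ n, g v = natSet n := by
  refine (Dfn.and (P := fun X v => g v = ∅ ∨ ∃ z ∈ g v, g v = insert z z)
    (Q := fun X v => ∀ y ∈ g v, y = ∅ ∨ ∃ z ∈ g v, y = insert z z)
    (.or (.eq_empty hg) (.ex_mem hg (.eq_insert_self (hg.comp _) (.var _))))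
    (.all_mem hg (.or (.eq_empty (.var _)) (.ex_mem (hg.comp _)
      (.eq_insert_self (.var _) (.var _)))))).congr fun X hX v hv => ?_
  have key : ∀ n : ℕ, natSet.{u} n = ∅ ∨ ∃ m < n, natSet.{u} n = insert (natSet m) (natSet m) := by
    rintro (_ | n)
    · exact .inl natSet_zero
    · exact .inr ⟨n, by simp, natSet_succ n⟩
  constructor
  · rintro ⟨h1, h2⟩
    have h3 : ∀ y ∈ g v, ∃ n, y = natSet n := by
      intro y
      induction y using ZFSet.inductionOn with
      | h y ih =>
        intro hy
        rcases h2 y hy with rfl | ⟨z, hz, rfl⟩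
        · exact ⟨0, natSet_zero.symm⟩
        · obtain ⟨n, hn⟩ := ih z (by simp) hz
          exact ⟨n + 1, by rw [natSet_succ, hn]⟩
    rcases h1 with h | ⟨z, hz, h⟩
    · exact ⟨0, h.trans natSet_zero.symm⟩
    · obtain ⟨n, rfl⟩ := h3 z hz
      exact ⟨n + 1, h.trans (natSet_succ n).symm⟩
  · rintro ⟨n, hn⟩
    rw [hn]
    have hmem : ∀ m < n, natSet.{u} m ∈ natSet.{u} n := fun m hm => by
      simpa [natSet, Ordinal.toZFSet_mem_toZFSet_iff] using hm
    refine ⟨(key n).imp id fun ⟨m, hm, h⟩ => ⟨_, hmem m hm, h⟩, fun y hy => ?_⟩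
    obtain ⟨a, ha, rfl⟩ := Ordinal.mem_toZFSet_iff.1 hy
    obtain ⟨k, rfl⟩ := Ordinal.lt_omega0.1 (ha.trans (Ordinal.natCast_lt_omega0 n))
    exact (key k).imp id fun ⟨m, hm, h⟩ => ⟨_, hmem m (hm.trans (by exact_mod_cast ha)), h⟩

theorem Dfn.isOrdinal (hg : DfnTerm g) : Dfn fun _ v => (g v).IsOrdinal := by
  refine (Dfn.and (P := fun X v => ∀ y ∈ g v, ∀ z ∈ y, z ∈ g v)
    (Q := fun X v => ∀ w ∈ g v, ∀ y ∈ w, ∀ z ∈ y, z ∈ w)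
    (.all_mem hg (.all_mem (.var _) (.mem (.var _) ((hg.comp _).comp _))))
    (.all_mem hg (.all_mem (.var _) (.all_mem (.var _) (.mem (.var _) (.var _)))))).congr
      fun X hX v hv => ?_
  constructor
  · rintro ⟨h1, h2⟩
    exact ⟨fun y hy z hz => h1 y hy z hz, fun {x y z} hz hy hw => h2 z hw y hy x hz⟩
  · intro h
    exact ⟨fun y hy z hz => h.isTransitive y hy hz, fun w hw y hy z hz => h.mem_trans' hz hy hw⟩

end

/-- `N` with `w` satisfies all the uniformly definable properties that `V` with `v` has. -/
def Reflects {ι : Type w} (V : ZFSet.{u}) (v : ι → ZFSet.{u}) (N : ZFSet.{u})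
    (w : ι → ZFSet.{u}) : Prop :=
  ∀ P : ZFSet.{u} → (ι → ZFSet.{u}) → Prop, Dfn P → P V v → P N w

namespace Reflects

variable {ι : Type w} {V N : ZFSet.{u}} {v v' : ι → ZFSet.{u}}

/-- The set `P` has no definition, but each single number has one. That all elements are numbers,
and which numbers are elements, therefore transfers one number at a time, and this determines the
set. -/
theorem realSet_eq (h : Reflects V v N v') (hV : PairClosed V)
    {i : ι} {P : Set ℕ} (hi : v i = realSet P) : v' i = realSet P := by
  have hnat : ∀ y ∈ v' i, ∃ n, y = natSet n := by
    refine h (fun X v => ∀ y ∈ v i, ∃ n, y = natSet n) (.all_mem (.var i) (.isNat (.var _))) ?_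
    rw [hi]
    rintro y hy
    obtain ⟨n, -, rfl⟩ := mem_realSet.1 hy
    exact ⟨n, rfl⟩
  have hP : ∀ n ∈ P, natSet n ∈ v' i := by
    intro n hn
    obtain ⟨y, hy, rfl⟩ := h (fun X v => ∃ y ∈ v i, y = natSet n)
      (.ex_mem (.var i) (.eq_natSet (.var _) n)) ⟨_, by rw [hi, mem_realSet]; exact ⟨n, hn, rfl⟩, rfl⟩
    exact hy
  have hP' : ∀ n ∉ P, natSet n ∉ v' i := by
    intro n hn hmem
    refine h (fun X v => ¬ ∃ y ∈ v i, y = natSet n)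
      (Dfn.not (.ex_mem (.var i) (.eq_natSet (.var _) n))) ?_ ⟨_, hmem, rfl⟩
    rintro ⟨y, hy, rfl⟩
    rw [hi, mem_realSet] at hy
    obtain ⟨m, hm, h⟩ := hy
    exact hn (natSet_injective h ▸ hm)
  ext y
  rw [mem_realSet]
  constructor
  · intro hy
    obtain ⟨n, rfl⟩ := hnat y hy
    exact ⟨n, by_contra fun hn => hP' n hn hy, rfl⟩
  · rintro ⟨n, hn, rfl⟩
    exact hP n hn

end Reflects

/-! ### Sets coding structures -/

/-- A nonempty list gives a Kuratowski pair, which is a nonempty set, so the terminal `∅` separates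
lists of different lengths. -/
theorem tuple_injective : Function.Injective tuple.{u} := by
  intro l
  induction l with
  | nil =>
    rintro (_ | ⟨b, l'⟩) h
    · rfl
    · exact absurd (h ▸ (show ({b} : ZFSet) ∈ tuple (b :: l') by simp [tuple, ZFSet.pair]))
        (ZFSet.notMem_empty _)
  | cons a l ih =>
    rintro (_ | ⟨b, l'⟩) h
    · exact absurd (h ▸ (show ({a} : ZFSet) ∈ tuple (a :: l) by simp [tuple, ZFSet.pair]))
        (ZFSet.notMem_empty _)
    · obtain ⟨h1, h2⟩ := ZFSet.pair_inj.1 (show ZFSet.pair a (tuple l) = ZFSet.pair b (tuple l') from h)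
      rw [h1, ih h2]

theorem tuple_ofFn_injective {n : ℕ} :
    Function.Injective fun x : Fin n → ZFSet.{u} => tuple (List.ofFn x) :=
  tuple_injective.comp List.ofFn_injective

/-- `R` is an `n`-ary relation on `D`. -/
def IsRelOn (n : ℕ) (D R : ZFSet.{u}) : Prop :=
  ∀ z ∈ R, ∃ x : Fin n → ZFSet.{u}, (∀ i, x i ∈ D) ∧ z = tuple (List.ofFn x)

/-- `f` is the graph of an `n`-ary function on `D`. -/
def IsFunOn (n : ℕ) (D f : ZFSet.{u}) : Prop :=
  (∀ z ∈ f, ∃ x : Fin n → ZFSet.{u}, (∀ i, x i ∈ D) ∧ ∃ y ∈ D, z = (tuple (List.ofFn x)).pair y) ∧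
  ∀ x : Fin n → ZFSet.{u}, (∀ i, x i ∈ D) → ∃ y ∈ D, (tuple (List.ofFn x)).pair y ∈ f ∧
    ∀ y' ∈ D, (tuple (List.ofFn x)).pair y' ∈ f → y' = y

section

variable {α : Type w} {g h : (α → ZFSet.{u}) → ZFSet.{u}}

theorem Dfn.isRelOn (n : ℕ) (hg : DfnTerm g) (hh : DfnTerm h) : Dfn fun _ v => IsRelOn n (g v) (h v) :=
  .all_mem hh (.ex_block_mem (hg.comp _) (.eq (.var _) (.tuple_ofFn fun i => .var _)))

theorem Dfn.isFunOn (n : ℕ) (hg : DfnTerm g) (hh : DfnTerm h) : Dfn fun _ v => IsFunOn n (g v) (h v) :=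
  .and
    (.all_mem hh (.ex_block_mem (hg.comp _) (.ex_mem ((hg.comp _).comp _)
      (.eq (.var _) (.kpair (.tuple_ofFn fun i => .var _) (.var _))))))
    (.all_block_mem hg (.ex_mem (hg.comp _) (.and
      (.mem (.kpair (.tuple_ofFn fun i => .var _) (.var _)) ((hh.comp _).comp _))
      (.all_mem ((hg.comp _).comp _) (.imp
        (.mem (.kpair (.tuple_ofFn fun i => .var _) (.var _)) (((hh.comp _).comp _).comp _))
        (.eq (.var _) (.var _)))))))

end

namespace Str

variable {S : FirstOrder.Language.{v, w}}

theorem val_injective {A : Str.{u} S} : Function.Injective (val (A := A)) := Subtype.val_injective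

theorem val_mem {A : Str.{u} S} (a : A.Dom) : val a ∈ A.carrier := Subtype.property a

theorem exists_val_eq {A : Str.{u} S} {x : ZFSet.{u}} (hx : x ∈ A.carrier) : ∃ a : A.Dom, val a = x :=
  ⟨⟨x, hx⟩, rfl⟩

theorem exists_val_comp_eq {A : Str.{u} S} {ι : Type*} {x : ι → ZFSet.{u}}
    (hx : ∀ i, x i ∈ A.carrier) : ∃ a : ι → A.Dom, (fun i => val (a i)) = x :=
  ⟨fun i => ⟨x i, hx i⟩, rfl⟩

theorem tuple_mem_relSet {A : Str.{u} S} {n : ℕ} {R : S.Relations n} {x : Fin n → A.Dom} :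
    tuple (List.ofFn fun i => val (x i)) ∈ A.relSet R ↔ FirstOrder.Language.Structure.RelMap R x := by
  simp only [relSet, ZFSet.mem_range, Subtype.exists, exists_prop]
  constructor
  · rintro ⟨y, hy, h⟩
    have : y = x := funext fun i => val_injective (congrFun (tuple_ofFn_injective h) i)
    exact this ▸ hy
  · intro h
    exact ⟨x, h, rfl⟩

theorem pair_mem_funSet {A : Str.{u} S} {n : ℕ} {f : S.Functions n} {x : Fin n → A.Dom} {y : A.Dom} :
    (tuple (List.ofFn fun i => val (x i))).pair (val y) ∈ A.funSet f ↔
      FirstOrder.Language.Structure.funMap f x = y := by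
  simp only [funSet, ZFSet.mem_range, ZFSet.pair_inj]
  constructor
  · rintro ⟨z, h, h'⟩
    have : z = x := funext fun i => val_injective (congrFun (tuple_ofFn_injective h) i)
    exact val_injective (this ▸ h')
  · rintro rfl
    exact ⟨x, rfl, rfl⟩

theorem isRelOn_relSet (A : Str.{u} S) {n : ℕ} (R : S.Relations n) : IsRelOn n A.carrier (A.relSet R) := by
  intro z hz
  obtain ⟨x, rfl⟩ := ZFSet.mem_range.1 hz
  exact ⟨_, fun i => val_mem (x.1 i), rfl⟩

theorem isFunOn_funSet (A : Str.{u} S) {n : ℕ} (f : S.Functions n) : IsFunOn n A.carrier (A.funSet f) := by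
  constructor
  · intro z hz
    obtain ⟨x, rfl⟩ := ZFSet.mem_range.1 hz
    exact ⟨_, fun i => val_mem (x i), _, val_mem _, rfl⟩
  · intro x hx
    obtain ⟨a, rfl⟩ := exists_val_comp_eq hx
    refine ⟨_, val_mem (FirstOrder.Language.Structure.funMap f a), pair_mem_funSet.2 rfl, ?_⟩
    intro y hy h
    obtain ⟨b, rfl⟩ := exists_val_eq hy
    rw [pair_mem_funSet.1 h]

/-- The structure on `D` whose functions and relations are given by sets. -/
noncomputable def ofSets (D : ZFSet.{u}) (hD : D.Nonempty) (F : ∀ n, S.Functions n → ZFSet.{u})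
    (R : ∀ n, S.Relations n → ZFSet.{u}) (hF : ∀ n f, IsFunOn n D (F n f)) : Str.{u} S where
  carrier := D
  nonempty := hD
  str :=
    { funMap := fun {n} f x =>
        ⟨((hF n f).2 (fun i => x i) fun i => (x i).2).choose,
          ((hF n f).2 (fun i => x i) fun i => (x i).2).choose_spec.1⟩
      RelMap := fun {n} r x => tuple (List.ofFn fun i => (x i : ZFSet.{u})) ∈ R n r }

section

variable {D : ZFSet.{u}} {hD : D.Nonempty} {F : ∀ n, S.Functions n → ZFSet.{u}}
  {R : ∀ n, S.Relations n → ZFSet.{u}} {hF : ∀ n f, IsFunOn n D (F n f)}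

theorem relSet_ofSets (hR : ∀ n r, IsRelOn n D (R n r)) {n : ℕ} (r : S.Relations n) :
    (ofSets D hD F R hF).relSet r = R n r := by
  ext z
  constructor
  · intro hz
    obtain ⟨x, rfl⟩ := ZFSet.mem_range.1 hz
    exact x.2
  · intro hz
    obtain ⟨x, hx, rfl⟩ := hR n r z hz
    obtain ⟨a, rfl⟩ := exists_val_comp_eq (A := ofSets D hD F R hF) hx
    exact tuple_mem_relSet.2 hz

theorem funSet_ofSets {n : ℕ} (f : S.Functions n) : (ofSets D hD F R hF).funSet f = F n f := by
  ext z
  constructor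
  · intro hz
    obtain ⟨x, rfl⟩ := ZFSet.mem_range.1 hz
    exact ((hF n f).2 (fun i => val (x i)) fun i => val_mem (x i)).choose_spec.2.1
  · intro hz
    obtain ⟨x, hx, y, hy, rfl⟩ := (hF n f).1 z hz
    obtain ⟨a, rfl⟩ := exists_val_comp_eq (A := ofSets D hD F R hF) hx
    obtain ⟨b, rfl⟩ := exists_val_eq (A := ofSets D hD F R hF) hy
    rw [pair_mem_funSet]
    exact val_injective (((hF n f).2 (fun i => val (a i)) fun i => val_mem (a i)).choose_spec.2.2
      _ (val_mem b) hz).symm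

end

end Str

/-- The set coding the domain `D`, the functions `F` and the relations `R`. -/
noncomputable def codeOf {k l : ℕ} (D : ZFSet.{u}) (F : Fin k → ZFSet.{u}) (R : Fin l → ZFSet.{u}) :
    ZFSet.{u} :=
  tuple (D :: (List.ofFn F ++ List.ofFn R))

theorem codeOf_inj {k l : ℕ} {D D' : ZFSet.{u}} {F F' : Fin k → ZFSet.{u}} {R R' : Fin l → ZFSet.{u}}
    (h : codeOf D F R = codeOf D' F' R') : D = D' ∧ F = F' ∧ R = R' := by
  have h := tuple_injective h
  rw [List.cons.injEq] at h
  obtain ⟨h1, h2⟩ := h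
  obtain ⟨h2, h3⟩ := List.append_inj h2 (by simp)
  exact ⟨h1, List.ofFn_injective h2, List.ofFn_injective h3⟩

theorem DfnTerm.codeOf {α : Type w} {k l : ℕ} {D : (α → ZFSet.{u}) → ZFSet.{u}}
    {F : Fin k → (α → ZFSet.{u}) → ZFSet.{u}} {R : Fin l → (α → ZFSet.{u}) → ZFSet.{u}}
    (hD : DfnTerm D) (hF : ∀ i, DfnTerm (F i)) (hR : ∀ i, DfnTerm (R i)) :
    DfnTerm fun v => AbstractLogic.codeOf (D v) (fun i => F i v) (fun i => R i v) :=
  .tuple (l' := D :: (List.ofFn F ++ List.ofFn R))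
    (fun v => by simp [List.map_ofFn, Function.comp_def])
    (by
      intro g hg
      simp only [List.mem_cons, List.mem_append, List.mem_ofFn] at hg
      rcases hg with rfl | ⟨i, rfl⟩ | ⟨i, rfl⟩
      exacts [hD, hF i, hR i])

theorem mem_of_tuple_mem {X : ZFSet.{u}} (hX : PairClosed X) {l : List ZFSet.{u}} (h : tuple l ∈ X) :
    ∀ x ∈ l, x ∈ X := by
  induction l with
  | nil => simp
  | cons a l ih =>
    have h : ZFSet.pair a (tuple l) ∈ X := h
    simp only [List.mem_cons, forall_eq_or_imp]
    exact ⟨hX.fst_mem h, ih (hX.snd_mem h)⟩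

/-- The function symbols of the signature of place-holders. -/
def FinSig.fun' (t : FinSig) (i : Fin t.funs.length) : t.lang.Functions (t.funs.get i) := ⟨i, rfl⟩

/-- The relation symbols of the signature of place-holders. -/
def FinSig.rel' (t : FinSig) (i : Fin t.rels.length) : t.lang.Relations (t.rels.get i) := ⟨i, rfl⟩

theorem code_eq {t : FinSig} (A : Str.{u} t.lang) :
    code A = codeOf A.carrier (fun i => A.funSet (t.fun' i)) (fun i => A.relSet (t.rel' i)) := rfl

section

variable {α : Type w} {g : (α → ZFSet.{u}) → ZFSet.{u}}

/-- Quantification over the components of a code. -/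
theorem Dfn.ex_codeOf {k l : ℕ} (hg : DfnTerm g)
    {P : ZFSet.{u} → (α → ZFSet.{u}) → ZFSet.{u} → (Fin k → ZFSet.{u}) → (Fin l → ZFSet.{u}) → Prop}
    (hP : Dfn fun X (v : α ⊕ (Unit ⊕ Fin k ⊕ Fin l) → ZFSet.{u}) => P X (fun i => v (Sum.inl i))
      (v (Sum.inr (Sum.inl ()))) (fun i => v (Sum.inr (Sum.inr (Sum.inl i))))
      (fun i => v (Sum.inr (Sum.inr (Sum.inr i))))) :
    Dfn fun X v => ∃ D F R, g v = AbstractLogic.codeOf D F R ∧ P X v D F R := by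
  refine (Dfn.ex_block (β := Unit ⊕ Fin k ⊕ Fin l) (P := fun X v w =>
    g v = AbstractLogic.codeOf (w (Sum.inl ())) (fun i => w (Sum.inr (Sum.inl i)))
      (fun i => w (Sum.inr (Sum.inr i))) ∧
    P X v (w (Sum.inl ())) (fun i => w (Sum.inr (Sum.inl i)))
      (fun i => w (Sum.inr (Sum.inr i)))) (.and (.eq (hg.comp _) (.codeOf (.var _)
        (fun i => .var _) fun i => .var _)) hP)).congr fun X hX v hv => ?_
  constructor
  · rintro ⟨w, -, h⟩
    exact ⟨_, _, _, h⟩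
  · rintro ⟨D, F, R, h, h'⟩
    refine ⟨Sum.elim (fun _ => D) (Sum.elim F R), ?_, h, h'⟩
    have := mem_of_tuple_mem hX (show tuple (D :: (List.ofFn F ++ List.ofFn R)) ∈ X by
      have := hg.mem X hX v hv
      rwa [h] at this)
    simp only [List.mem_cons, List.mem_append, List.mem_ofFn] at this
    rintro (_ | i | i)
    · exact this _ (.inl rfl)
    · exact this _ (.inr (.inl ⟨i, rfl⟩))
    · exact this _ (.inr (.inr ⟨i, rfl⟩))

/-- Being a code unfolds to finitely many bounded conditions on the components, which is what makes
it definable. The clause `d = d` merely puts nonemptiness into the form of a bounded existential. -/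
theorem exists_code_eq_iff {t : FinSig} {x : ZFSet.{u}} : (∃ A : Str.{u} t.lang, code A = x) ↔
    ∃ (D : ZFSet.{u}) (F : Fin t.funs.length → ZFSet.{u}) (R : Fin t.rels.length → ZFSet.{u}),
      x = codeOf D F R ∧ (∃ d ∈ D, d = d) ∧ (∀ i, IsFunOn (t.funs.get i) D (F i)) ∧
        ∀ i, IsRelOn (t.rels.get i) D (R i) := by
  constructor
  · rintro ⟨A, rfl⟩
    refine ⟨_, _, _, code_eq A, ?_, fun i => A.isFunOn_funSet _, fun i => A.isRelOn_relSet _⟩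
    obtain ⟨d, hd⟩ := A.nonempty
    exact ⟨d, hd, rfl⟩
  · rintro ⟨D, F, R, rfl, ⟨d, hd, -⟩, hF, hR⟩
    refine ⟨Str.ofSets (S := t.lang) D ⟨d, hd⟩ (fun n f => F f.1) (fun n r => R r.1) (by
      rintro n ⟨i, rfl⟩
      exact hF i), ?_⟩
    rw [code_eq]
    congr 1
    · funext i
      exact Str.funSet_ofSets _
    · funext i
      exact Str.relSet_ofSets (by
        rintro n ⟨i, rfl⟩
        exact hR i) _

theorem Dfn.isCode (t : FinSig) (hg : DfnTerm g) : Dfn fun _ v => ∃ A : Str.{u} t.lang, code A = g v :=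
  (Dfn.ex_codeOf (k := t.funs.length) (l := t.rels.length) hg
    (P := fun X v D F R => (∃ d ∈ D, d = d) ∧ (∀ i, IsFunOn (t.funs.get i) D (F i)) ∧
        ∀ i, IsRelOn (t.rels.get i) D (R i))
    (.and (.ex_mem (.var _) (.eq (.var _) (.var _))) (.and
      (.forall_fin fun i => .isFunOn _ (.var _) (.var _))
      (.forall_fin fun i => .isRelOn _ (.var _) (.var _))))).congr fun X hX v hv =>
        exists_code_eq_iff.symm

end

/-! ### Extensional structures and the Mostowski collapse -/

/-- The membership relation of a structure for the language of set theory. -/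
def E {X : Type v} [memLang.Structure X] (a b : X) : Prop :=
  FirstOrder.Language.Structure.RelMap memRel ![a, b]

theorem e_iff {N : ZFSet.{u}} {a b : N} : E a b ↔ (a : ZFSet.{u}) ∈ (b : ZFSet.{u}) := Iff.rfl

/-- Extensionality, pairing and the existence of the empty set. -/
def PairAxioms (X : Type v) [memLang.Structure X] : Prop :=
  (∀ x y : X, (∀ z, E z x ↔ E z y) → x = y) ∧ (∀ x y : X, ∃ z, ∀ w, E w z ↔ w = x ∨ w = y) ∧
    ∃ z : X, ∀ w, ¬ E w z

-- A single sentence transfers along elementary embeddings and also belongs to every logic that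
-- includes first-order logic; both uses occur.
open FirstOrder.Language in
theorem exists_pairAxioms_sentence : ∃ σ : memLang.Sentence, ∀ (X : Type v) [memLang.Structure X],
    X ⊨ σ ↔ PairAxioms X := by
  refine ⟨(∀' ∀' ((∀' ((memRel.boundedFormula₂ (&2) (&0)) ⇔ (memRel.boundedFormula₂ (&2) (&1)))) ⟹
      (&0 =' &1))) ⊓
    ((∀' ∀' ∃' ∀' ((memRel.boundedFormula₂ (&3) (&2)) ⇔ ((&3 =' &0) ⊔ (&3 =' &1)))) ⊓
    (∃' ∀' ∼(memRel.boundedFormula₂ (&1) (&0)))), fun X _ => ?_⟩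
  simp only [Sentence.Realize, Formula.Realize, BoundedFormula.realize_inf, BoundedFormula.realize_all,
    BoundedFormula.realize_imp, BoundedFormula.realize_iff, BoundedFormula.realize_rel₂,
    BoundedFormula.realize_bdEqual, BoundedFormula.realize_ex, BoundedFormula.realize_sup,
    BoundedFormula.realize_not, PairAxioms, E]
  exact Iff.rfl

theorem PairClosed.pairAxioms {X : ZFSet.{u}} (hX : PairClosed X) : PairAxioms X := by
  refine ⟨fun x y h => Subtype.ext (ZFSet.ext fun z => ?_), fun x y => ?_, ?_⟩
  · constructor
    · intro hz
      exact (h ⟨z, hX.trans.mem_trans hz x.2⟩).1 hz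
    · intro hz
      exact (h ⟨z, hX.trans.mem_trans hz y.2⟩).2 hz
  · refine ⟨⟨_, hX.pair_mem x x.2 y y.2⟩, fun w => ?_⟩
    rw [e_iff, ZFSet.mem_pair, Subtype.ext_iff, Subtype.ext_iff]
  · exact ⟨⟨_, hX.empty_mem⟩, fun w => ZFSet.notMem_empty _⟩

/-- By transitivity the internal pairs and the internal empty set have no elements outside `X`, so
they are the real ones. -/
theorem PairAxioms.pairClosed {X : ZFSet.{u}} (h : PairAxioms X) (hX : X.IsTransitive) :
    PairClosed X where
  trans := hX
  pair_mem := fun x hx y hy => by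
    obtain ⟨z, hz⟩ := h.2.1 ⟨x, hx⟩ ⟨y, hy⟩
    have : (z : ZFSet.{u}) = {x, y} := by
      ext w
      rw [ZFSet.mem_pair]
      constructor
      · intro hw
        simpa [Subtype.ext_iff] using (hz ⟨w, hX.mem_trans hw z.2⟩).1 hw
      · rintro (rfl | rfl)
        · exact (hz ⟨w, hx⟩).2 (.inl rfl)
        · exact (hz ⟨w, hy⟩).2 (.inr rfl)
    exact this ▸ z.2
  empty_mem := by
    obtain ⟨z, hz⟩ := h.2.2
    have : (z : ZFSet.{u}) = ∅ := by
      rw [ZFSet.eq_empty]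
      exact fun w hw => hz ⟨w, hX.mem_trans hw z.2⟩ hw
    exact this ▸ z.2

section

variable {X : Type v} [Small.{u} X] [memLang.Structure X]

/-- The collapsing function of a well-founded structure for the language of set theory. -/
noncomputable def wfCollapse (hwf : WellFounded (E (X := X))) : X → ZFSet.{u} :=
  hwf.fix fun x ih => ZFSet.range fun y : {y // E y x} => ih y.1 y.2

theorem mem_wfCollapse (hwf : WellFounded (E (X := X))) {x : X} {z : ZFSet.{u}} :
    z ∈ wfCollapse hwf x ↔ ∃ y, E y x ∧ wfCollapse hwf y = z := by
  rw [wfCollapse, WellFounded.fix_eq]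
  simp

theorem wfCollapse_injective (hwf : WellFounded (E (X := X)))
    (hext : ∀ x y : X, (∀ z, E z x ↔ E z y) → x = y) : Function.Injective (wfCollapse.{u} hwf) := by
  intro x
  induction x using hwf.induction with
  | h x ih =>
    intro y hxy
    refine hext x y fun z => ⟨fun hz => ?_, fun hz => ?_⟩
    · obtain ⟨z', hz', h⟩ := (mem_wfCollapse hwf).1 (hxy ▸ (mem_wfCollapse hwf).2 ⟨z, hz, rfl⟩)
      rwa [ih z hz h.symm]
    · obtain ⟨z', hz', h⟩ := (mem_wfCollapse hwf).1 (hxy ▸ (mem_wfCollapse hwf).2 ⟨z, hz, rfl⟩)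
      rwa [← ih z' hz' h]

/-- The transitive set onto which a well-founded structure collapses. -/
noncomputable def wfRange (hwf : WellFounded (E (X := X))) : ZFSet.{u} := ZFSet.range (wfCollapse.{u} hwf)

theorem isTransitive_wfRange (hwf : WellFounded (E (X := X))) : (wfRange.{u} hwf).IsTransitive := by
  intro y hy z hz
  obtain ⟨x, rfl⟩ := ZFSet.mem_range.1 hy
  obtain ⟨x', -, rfl⟩ := (mem_wfCollapse hwf).1 hz
  exact ZFSet.mem_range_self _

/-- The collapsing isomorphism. -/
noncomputable def wfEquiv (hwf : WellFounded (E (X := X)))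
    (hext : ∀ x y : X, (∀ z, E z x ↔ E z y) → x = y) : X ≃[memLang] wfRange.{u} hwf where
  toEquiv := Equiv.ofBijective (fun x => ⟨wfCollapse hwf x, ZFSet.mem_range_self _⟩)
    ⟨fun x y h => wfCollapse_injective hwf hext (congrArg Subtype.val h), by
      rintro ⟨y, hy⟩
      obtain ⟨x, rfl⟩ := ZFSet.mem_range.1 hy
      exact ⟨x, rfl⟩⟩
  map_fun' := fun f => f.elim
  map_rel' := by
    rintro _ ⟨⟩ x
    have : x = ![x 0, x 1] := by
      funext i
      fin_cases i <;> rfl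
    have h : wfCollapse.{u} hwf (x 0) ∈ wfCollapse hwf (x 1) ↔ E (x 0) (x 1) := by
      rw [mem_wfCollapse]
      constructor
      · rintro ⟨y, hy, h⟩
        rwa [← wfCollapse_injective hwf hext h]
      · exact fun h => ⟨_, h, rfl⟩
    conv_rhs => rw [this]
    exact h

end

theorem wellFounded_e (N : ZFSet.{u}) : WellFounded (E (X := N)) :=
  InvImage.wf (Subtype.val : N → ZFSet.{u}) ZFSet.mem_wf

theorem wfCollapse_eq_collapse {N : ZFSet.{u}} (x : N) :
    wfCollapse (wellFounded_e N) x = collapse N x := by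
  induction x using (wellFounded_e N).induction with
  | h x ih =>
    ext z
    rw [mem_wfCollapse, collapse, ZFSet.mem_range]
    constructor
    · rintro ⟨y, hy, rfl⟩
      exact ⟨⟨⟨y, hy⟩, y.2⟩, (ih y hy).symm⟩
    · rintro ⟨⟨⟨y, hy⟩, hyN⟩, rfl⟩
      exact ⟨⟨y, hyN⟩, hy, ih ⟨y, hyN⟩ hy⟩

theorem wfRange_eq_mostowski (N : ZFSet.{u}) : wfRange (wellFounded_e N) = mostowski N := by
  rw [wfRange, mostowski]
  congr 1
  funext x
  exact wfCollapse_eq_collapse x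

/-- Needed for targets that are not transitive but contain all ordinals up to `κ`: collapsing does
not move these ordinals. -/
theorem wfCollapse_eq_self {N : ZFSet.{u}} (x : N) (hx : (x : ZFSet.{u}).IsOrdinal)
    (h : ∀ y ∈ (x : ZFSet.{u}), y ∈ N) : wfCollapse (wellFounded_e N) x = x := by
  induction x using (wellFounded_e N).induction with
  | h x ih =>
    have ih' : ∀ y : N, (y : ZFSet.{u}) ∈ (x : ZFSet.{u}) → wfCollapse (wellFounded_e N) y = y :=
      fun y hy => ih y hy (hx.mem hy) fun z hz => h z (hx.mem_trans hz hy)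
    ext z
    rw [mem_wfCollapse]
    constructor
    · rintro ⟨y, hy, rfl⟩
      rw [ih' y hy]
      exact hy
    · intro hz
      exact ⟨⟨z, h z hz⟩, hz, ih' ⟨z, _⟩ hz⟩

theorem collapse_of_isTransitive {N : ZFSet.{u}} (hN : N.IsTransitive) (x : ZFSet.{u}) (hx : x ∈ N) :
    collapse N x = x := by
  induction x using ZFSet.inductionOn with
  | h x ih =>
    ext z
    rw [collapse, ZFSet.mem_range]
    constructor
    · rintro ⟨⟨⟨y, hy⟩, hyN⟩, rfl⟩
      rw [ih y hy hyN]
      exact hy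
    · intro hz
      exact ⟨⟨⟨z, hz⟩, hN.mem_trans hz hx⟩, ih z hz (hN.mem_trans hz hx)⟩

theorem mostowski_of_isTransitive {N : ZFSet.{u}} (hN : N.IsTransitive) : mostowski N = N := by
  ext z
  rw [mostowski, ZFSet.mem_range]
  constructor
  · rintro ⟨y, rfl⟩
    rw [collapse_of_isTransitive hN _ y.2]
    exact y.2
  · exact fun hz => ⟨⟨z, hz⟩, collapse_of_isTransitive hN _ hz⟩

/-! ### Elementary submodels of ranks -/

theorem ElemSubmodel.exists_embedding {M X : ZFSet.{u}} (h : ElemSubmodel M X) :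
    ∃ e : M ↪ₑ[memLang] X, ∀ x : M, (e x : ZFSet.{u}) = x := by
  obtain ⟨hsub, h⟩ := h
  exact ⟨⟨fun x => ⟨x, hsub _ x.2⟩, fun n φ x => (h n φ x).symm⟩, fun x => rfl⟩

theorem pairClosed_vonNeumann {o : Ordinal.{u}} (ho : Order.IsSuccLimit o) :
    PairClosed (ZFSet.vonNeumann o) where
  trans := ZFSet.isTransitive_vonNeumann o
  pair_mem := fun x hx y hy => by
    rw [ZFSet.mem_vonNeumann] at hx hy ⊢
    rw [ZFSet.rank_pair]
    exact max_lt (ho.succ_lt hx) (ho.succ_lt hy)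
  empty_mem := by
    rw [ZFSet.mem_vonNeumann, ZFSet.rank_empty]
    exact ho.bot_lt

theorem pairClosed_vonNeumann_ord {θ : Cardinal.{u}} (hθ : ℵ₀ ≤ θ) :
    PairClosed (ZFSet.vonNeumann θ.ord) :=
  pairClosed_vonNeumann (Cardinal.isSuccLimit_ord hθ)

theorem toZFSet_mem_vonNeumann {a o : Ordinal.{u}} : a.toZFSet ∈ ZFSet.vonNeumann o ↔ a < o := by
  rw [ZFSet.mem_vonNeumann, Ordinal.rank_toZFSet]

/-- Uniform definability lets one formula express `P` in both `V` and `N`, so elementarity applies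
through `M`. -/
theorem reflects_of_elementary {M V N : ZFSet.{u}} (hV : PairClosed V) (hN : PairClosed N)
    (hM : ElemSubmodel M V) (j : M ↪ₑ[memLang] N) {ι : Type w} (v : ι → M) :
    Reflects V (fun i => v i) N (fun i => j (v i)) := by
  obtain ⟨e, he⟩ := hM.exists_embedding
  rintro P ⟨φ, hφ⟩ h
  have : (fun i => (v i : ZFSet.{u})) = fun i => ((e ∘ v) i : ZFSet.{u}) := funext fun i => (he _).symm
  rw [this, ← hφ V hV, e.map_formula, ← j.map_formula, hφ N hN] at h
  exact h

theorem card_le_card_vonNeumann {κ θ : Cardinal.{u}} (h : κ < θ) :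
    Cardinal.lift.{u + 1} κ ≤ #(ZFSet.vonNeumann θ.ord) := by
  rw [ZFSet.cardinalMk_coe_sort, Cardinal.lift_le]
  have := Ordinal.card_le_card_vonNeumann θ.ord
  rw [Cardinal.card_ord] at this
  exact h.le.trans this

theorem card_language_memLang : memLang.card ≤ ℵ₀ := by
  have h1 : IsEmpty (Σ n, memLang.Functions n) := ⟨fun x => x.2.elim⟩
  have h2 : Subsingleton (Σ n, memLang.Relations n) := ⟨by
    rintro ⟨_, ⟨⟩⟩ ⟨_, ⟨⟩⟩
    rfl⟩
  have : Countable ((Σ n, memLang.Functions n) ⊕ (Σ n, memLang.Relations n)) := inferInstance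
  exact Cardinal.mk_le_aleph0

/-- Downward Löwenheim–Skolem, with the ordinals up to `κ` and the sets `c i` put into the
generating set; `κ < θ` places these ordinals in `V_θ`. -/
theorem exists_elemSubmodel {κ θ : Cardinal.{u}} (hκ : ℵ₀ ≤ κ) (h : κ < θ) {ι : Type u}
    (hι : #ι ≤ κ) (c : ι → ZFSet.{u}) (hc : ∀ i, c i ∈ ZFSet.vonNeumann θ.ord) :
    ∃ M, ElemSubmodel M (ZFSet.vonNeumann θ.ord) ∧ FinitaryLogic.ContainsSucc M κ ∧ #M = Cardinal.lift.{u + 1} κ ∧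
      ∀ i, c i ∈ M := by
  let V := ZFSet.vonNeumann θ.ord
  let o : (κ.ord + 1).ToType → V := fun a =>
    ⟨(Ordinal.ToType.mk.symm a : Ordinal.{u}).toZFSet, toZFSet_mem_vonNeumann.2
      ((Order.lt_add_one_iff.1 (Ordinal.ToType.mk.symm a).2).trans_lt (Cardinal.ord_lt_ord.2 h))⟩
  let s : ι ⊕ (κ.ord + 1).ToType → V := Sum.elim (fun i => ⟨c i, hc i⟩) o
  have hs : Cardinal.lift.{u} #(Set.range s) ≤ Cardinal.lift.{u + 1} κ := by
    have h1 : #(ι ⊕ (κ.ord + 1).ToType) ≤ κ := by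
      rw [Cardinal.mk_sum, Cardinal.lift_id, Cardinal.lift_id, Cardinal.mk_toType]
      refine Cardinal.add_le_of_le hκ hι ?_
      rw [Ordinal.card_add_one, Cardinal.card_ord, Cardinal.add_one_eq hκ]
    have h2 := Cardinal.mk_range_le_lift (f := s)
    exact h2.trans (Cardinal.lift_le.2 h1)
  obtain ⟨S, hS, hcard⟩ := FirstOrder.Language.exists_elementarySubstructure_card_eq memLang
    (M := V) (Set.range s) κ hκ hs
    ((Cardinal.lift_le.2 card_language_memLang).trans (by simpa using hκ))
    ((card_le_card_vonNeumann h).trans (Cardinal.lift_id'.{u, u + 1} _).ge)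
  -- The elementary substructure is a collection of elements of `V_θ`; separation makes it a set.
  let M : ZFSet.{u} := V.sep fun x => ∃ h : x ∈ V, (⟨x, h⟩ : V) ∈ S
  have hM : ∀ x : V, (x : ZFSet.{u}) ∈ M ↔ x ∈ S := fun x => by
    simp only [M, ZFSet.mem_sep]
    exact ⟨fun ⟨_, _, h⟩ => h, fun h => ⟨x.2, x.2, h⟩⟩
  have hMV : ∀ a ∈ M, a ∈ V := fun a ha => (ZFSet.mem_sep.1 ha).1
  have hsM : ∀ a, (s a : ZFSet.{u}) ∈ M := fun a => (hM _).2 (hS ⟨a, rfl⟩)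
  let f : M → S := fun x => ⟨⟨x, hMV x x.2⟩, (hM ⟨x, hMV x x.2⟩).1 x.2⟩
  have hf : Function.Bijective f := by
    constructor
    · intro x y hxy
      exact Subtype.ext (congrArg (fun z : S => ((z : V) : ZFSet.{u})) hxy)
    · intro y
      exact ⟨⟨y.1, (hM y).2 y.2⟩, rfl⟩
  let e : M ≃[memLang] S :=
    { toEquiv := Equiv.ofBijective f hf
      map_fun' := fun g => g.elim
      map_rel' := by
        rintro _ ⟨⟩ x
        exact Iff.rfl }
  refine ⟨M, ⟨hMV, fun n φ x => ?_⟩, fun α hα => ?_, ?_, fun i => hsM (.inl i)⟩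
  · rw [← FirstOrder.Language.StrongHomClass.realize_formula e φ, ← S.subtype.map_formula φ]
    exact Iff.rfl
  · have := hsM (.inr (Ordinal.ToType.mk ⟨α, Order.lt_add_one_iff.2 hα⟩))
    simpa [s, o] using this
  · have h1 : #M = #S := Cardinal.mk_congr e.toEquiv
    exact h1.trans ((Cardinal.lift_id'.{u, u + 1} _).symm.trans hcard)

/-! ### Limits of sequences of sets along an elementary embedding -/

open FirstOrder.Language in
/-- A uniformly definable property depends on finitely many variables only. -/
theorem Dfn.exists_finset {α : Type w} {P : ZFSet.{u} → (α → ZFSet.{u}) → Prop} (hP : Dfn P) :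
    ∃ (s : Finset α) (P' : ZFSet.{u} → (s → ZFSet.{u}) → Prop), Dfn P' ∧
      ∀ X, PairClosed X → ∀ v : α → ZFSet.{u}, (∀ i, v i ∈ X) → (P X v ↔ P' X fun i => v i) := by
  classical
  obtain ⟨φ, hφ⟩ := hP
  let φ' : memLang.Formula φ.freeVarFinset := φ.restrictFreeVar id
  refine ⟨φ.freeVarFinset, fun X v => ∃ h : ∀ i, v i ∈ X, φ'.Realize fun i => (⟨v i, h i⟩ : X),
    ⟨φ', fun X hX v => ?_⟩, fun X hX v hv => ?_⟩
  · exact ⟨fun h => ⟨fun i => (v i).2, h⟩, fun ⟨_, h⟩ => h⟩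
  · have h1 := hφ X hX fun i => ⟨v i, hv i⟩
    rw [← h1]
    have h2 : φ'.Realize (fun i => (⟨v i, hv i⟩ : X)) ↔ φ.Realize fun i => (⟨v i, hv i⟩ : X) :=
      BoundedFormula.realize_restrictFreeVar (fun i => (⟨v i, hv i⟩ : X)) (by simp)
    rw [← h2]
    exact ⟨fun h => ⟨fun i => hv i, h⟩, fun ⟨_, h⟩ => h⟩

/-- The graph of a sequence of sets of length `κ`. -/
noncomputable def seqGraph (κ : Cardinal.{u}) (g : Ordinal.{u} → ZFSet.{u}) : ZFSet.{u} :=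
  ZFSet.range fun a : Set.Iio κ.ord => (a.1.toZFSet).pair (g a.1)

theorem pair_mem_seqGraph {κ : Cardinal.{u}} {g : Ordinal.{u} → ZFSet.{u}} {α : Ordinal.{u}}
    {y : ZFSet.{u}} : α.toZFSet.pair y ∈ seqGraph κ g ↔ α < κ.ord ∧ y = g α := by
  simp only [seqGraph, ZFSet.mem_range, ZFSet.pair_inj, Subtype.exists, Set.mem_Iio, exists_prop]
  constructor
  · rintro ⟨a, ha, h, rfl⟩
    rw [Ordinal.toZFSet_injective h] at ha ⊢
    exact ⟨ha, rfl⟩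
  · rintro ⟨h, rfl⟩
    exact ⟨α, h, rfl, rfl⟩

/-- The sets `lim i` have in `N` all the uniformly definable properties that the `α`-th members of
the sequences `g i` have in `V` for all large `α < κ`. -/
structure Limits {ι : Type w} (κ : Cardinal.{u}) (V : ZFSet.{u}) (g : ι → Ordinal.{u} → ZFSet.{u})
    (N : ZFSet.{u}) (lim : ι → ZFSet.{u}) : Prop where
  mem : ∀ i, lim i ∈ N
  los : ∀ P : ZFSet.{u} → (ι → ZFSet.{u}) → Prop, Dfn P → ∀ β < κ.ord,
    (∀ α, β ≤ α → α < κ.ord → P V fun i => g i α) → P N lim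

/-- The target `N` need not be transitive, but it inherits extensionality from `V` through `M`, so
its collapse is an isomorphism; pairing and the empty set are inherited as well. -/
theorem exists_mostowski_equiv {M V N : ZFSet.{u}} (hV : PairClosed V) (hM : ElemSubmodel M V)
    (j : M ↪ₑ[memLang] N) : ∃ π : N ≃[memLang] mostowski N, PairClosed (mostowski N) ∧
      ∀ x, (π x : ZFSet.{u}) = wfCollapse (wellFounded_e N) x := by
  obtain ⟨σ, hσ⟩ := exists_pairAxioms_sentence.{u + 1}
  obtain ⟨e, -⟩ := hM.exists_embedding
  have hN : PairAxioms N := by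
    rw [← hσ, ← j.map_sentence, e.map_sentence, hσ]
    exact hV.pairAxioms
  have : ∃ π : N ≃[memLang] wfRange.{u} (wellFounded_e N), PairClosed (wfRange.{u} (wellFounded_e N)) ∧
      ∀ x, (π x : ZFSet.{u}) = wfCollapse (wellFounded_e N) x := by
    let π := wfEquiv.{u} (wellFounded_e N) hN.1
    refine ⟨π, PairAxioms.pairClosed ?_ (isTransitive_wfRange _), fun x => rfl⟩
    rw [← hσ, ← π.toElementaryEmbedding.map_sentence, hσ]
    exact hN
  rwa [wfRange_eq_mostowski] at this

/-- The limit of `g i` is the value of the function `j(g i)` at `δ`. It exists because `δ ∈ j(κ)`,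
and it has all eventual properties because `δ ≥ j(β)` for every `β < κ`. -/
theorem exists_limits_of_embedding {κ : Cardinal.{u}} {M V N : ZFSet.{u}} (hV : PairClosed V)
    (hN : PairClosed N) (hM : ElemSubmodel M V) (hκ : FinitaryLogic.ContainsSucc M κ)
    (j : M ↪ₑ[memLang] N) {δ : ZFSet.{u}}
    (hδ : δ ∈ (j ⟨κ.ord.toZFSet, hκ _ le_rfl⟩ : ZFSet.{u}))
    (hjδ : ∀ (α : Ordinal.{u}) (hα : α < κ.ord),
      (j ⟨α.toZFSet, hκ α hα.le⟩ : ZFSet.{u}) ∈ δ ∨ j ⟨α.toZFSet, hκ α hα.le⟩ = δ)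
    {ι : Type w} (g : ι → Ordinal.{u} → ZFSet.{u}) (hg : ∀ i, seqGraph κ (g i) ∈ M) :
    ∃ lim, Limits κ V g N lim ∧
      ∀ i (c : M), (∀ α < κ.ord, g i α = c) → lim i = j c := by
  have hδN : δ ∈ N := hN.trans.mem_trans hδ (j _).2
  have hMV : ∀ x ∈ M, x ∈ V := hM.1
  have hgV : ∀ i, ∀ α < κ.ord, g i α ∈ V := fun i α hα =>
    hV.snd_mem (hV.trans.mem_trans (pair_mem_seqGraph.2 ⟨hα, rfl⟩) (hMV _ (hg i)))
  have hex : ∀ i, ∃ y ∈ N, δ.pair y ∈ (j ⟨_, hg i⟩ : ZFSet.{u}) := by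
    intro i
    refine reflects_of_elementary hV hN hM j
      (fun b : Bool => if b then ⟨κ.ord.toZFSet, hκ _ le_rfl⟩ else ⟨_, hg i⟩)
      (fun X v => ∀ a ∈ v true, ∃ y ∈ X, a.pair y ∈ v false)
      (.all_mem (.var _) (.ex (.mem (.kpair (.var _) (.var _)) (.var _)))) ?_ δ (by simpa using hδ)
    intro a ha
    simp only [if_true] at ha
    obtain ⟨α, hα, rfl⟩ := Ordinal.mem_toZFSet_iff.1 ha
    exact ⟨g i α, hgV i α hα, by simpa using pair_mem_seqGraph.2 ⟨hα, rfl⟩⟩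
  choose lim hlimN hlim using hex
  -- The Łoś principle is proved with elements of `M` as additional parameters; this also yields
  -- that a sequence with constant value `c ∈ M` has limit `j c`.
  have key : ∀ P : ZFSet.{u} → (ι ⊕ M → ZFSet.{u}) → Prop, Dfn P → ∀ β < κ.ord,
      (∀ α, β ≤ α → α < κ.ord → P V (Sum.elim (fun i => g i α) fun m => m)) →
      P N (Sum.elim lim fun m => j m) := by
    intro P hP β hβ h
    -- The family of sequences may be infinite, but a formula mentions finitely many of them, so the
    -- transferred statement has a finite block of quantifiers.
    obtain ⟨s, P', hP', hPP'⟩ := hP.exists_finset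
    rw [hPP' N hN _ (by rintro (i | m); exacts [hlimN i, (j m).2])]
    -- The value of a function at `a` is not one of the basic operations, so the statement speaks
    -- about all `y` that are paired with `a` in the graphs.
    have hrefl := reflects_of_elementary hV hN hM j
      (Sum.elim (fun b : Bool => if b then ⟨κ.ord.toZFSet, hκ _ le_rfl⟩ else ⟨β.toZFSet, hκ _ hβ.le⟩)
        (fun x : s => x.1.elim (fun i => ⟨_, hg i⟩) fun m => m))
      (fun X v => ∀ a ∈ v (.inl true), (v (.inl false) ∈ a ∨ v (.inl false) = a) →
        ∀ y : s → ZFSet.{u}, (∀ x, y x ∈ X) →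
          (∀ x : s, (x.1.isLeft → a.pair (y x) ∈ v (.inr x)) ∧ (x.1.isRight → y x = v (.inr x))) →
          P' X y)
      (.all_mem (.var _) (.imp (.or (.mem (.var _) (.var _)) (.eq (.var _) (.var _)))
        (.all_block (.imp (.forall_fin fun x => .and (.imp (.const _)
          (.mem (.kpair (.var _) (.var _)) (.var _))) (.imp (.const _) (.eq (.var _) (.var _))))
          (hP'.comp Sum.inr))))) ?_ δ (by simpa using hδ) (by simpa [Subtype.ext_iff] using hjδ β hβ)
    · refine hrefl (fun x => Sum.elim lim (fun m => (j m : ZFSet.{u})) x.1) ?_ ?_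
      · rintro ⟨i | m, hx⟩
        exacts [hlimN i, (j m).2]
      · rintro ⟨i | m, hx⟩
        · simpa using hlim i
        · simp
    · intro a ha hβa y hy hya
      simp only [Sum.elim_inl, if_true] at ha
      obtain ⟨α, hα, rfl⟩ := Ordinal.mem_toZFSet_iff.1 ha
      have hle : β ≤ α := by
        rcases hβa with h | h
        · exact (Ordinal.toZFSet_mem_toZFSet_iff.1 (by simpa using h)).le
        · exact (Ordinal.toZFSet_injective (by simpa using h)).le
      have := (hPP' V hV _ (by rintro (i | m); exacts [hgV i α hα, hMV _ m.2])).1 (h α hle hα)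
      convert this with x
      obtain ⟨x | x, hx⟩ := x
      · have := (hya ⟨.inl x, hx⟩).1 rfl
        exact (pair_mem_seqGraph.1 (by simpa using this)).2
      · exact (hya ⟨.inr x, hx⟩).2 rfl
  refine ⟨lim, ⟨hlimN, fun P hP β hβ h => key (fun X v => P X fun i => v (.inl i)) (hP.comp _) β hβ h⟩,
    fun i c hc => ?_⟩
  by_cases h0 : 0 < κ.ord
  · exact key (fun X v => v (.inl i) = v (.inr c)) (.eq (.var _) (.var _)) 0 h0 fun α _ hα => hc α hα
  -- For `κ = 0` the set `j(κ)` is empty and cannot contain `δ`.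
  · exfalso
    have h0 : κ.ord = 0 := by simpa using h0
    have := reflects_of_elementary hV hN hM j (fun _ : Unit => ⟨κ.ord.toZFSet, hκ _ le_rfl⟩)
      (fun X v => v () = ∅) (.eq_empty (.var _)) (by simp [h0])
    simp only at this
    rw [this] at hδ
    exact ZFSet.notMem_empty _ hδ

/-- A regular cardinal above `κ` whose rank contains the given sets. -/
theorem exists_regular_rank {κ : Cardinal.{u}} (hκ : ℵ₀ ≤ κ) {ι : Type u} (c : ι → ZFSet.{u}) :
    ∃ θ : Cardinal.{u}, θ.IsRegular ∧ κ < θ ∧ ∀ i, c i ∈ ZFSet.vonNeumann θ.ord := by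
  let r := (ZFSet.range c).rank
  refine ⟨Order.succ (max κ r.card), Cardinal.isRegular_succ (le_max_of_le_left hκ),
    Order.lt_succ_iff.2 (le_max_left _ _), fun i => ?_⟩
  rw [ZFSet.mem_vonNeumann]
  refine (ZFSet.rank_lt_of_mem (ZFSet.mem_range_self (f := c) i)).trans ?_
  rw [Cardinal.lt_ord]
  exact Order.lt_succ_iff.2 (le_max_right _ _)

/-! ### Limits of sequences from the embedding properties -/

namespace FinitaryLogic

variable {L : FinitaryLogic} {κ : Cardinal.{u}} {ι : Type u}

/-- Take `θ` so large that `V_θ` contains the graphs, and `M` of size `κ` containing all of them;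
the target of the embedding is then replaced by its Mostowski collapse, to which truthfulness
refers. -/
theorem EmbeddingProperty.exists_limits (hE : L.EmbeddingProperty κ) (hκ : ℵ₀ ≤ κ) (hι : #ι ≤ κ)
    (g : ι → Ordinal.{u} → ZFSet.{u}) : ∃ θ : Cardinal.{u}, θ.IsRegular ∧ κ < θ ∧
      (∀ i, ∀ α < κ.ord, g i α ∈ ZFSet.vonNeumann θ.ord) ∧ ∃ N lim, PairClosed N ∧
        L.TruthfulTransitive N ∧ Limits κ (ZFSet.vonNeumann θ.ord) g N lim := by
  obtain ⟨θ, hθ, hκθ, hc⟩ := exists_regular_rank hκ fun i => seqGraph κ (g i)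
  obtain ⟨M, hM, hMκ, hMcard, hcM⟩ := exists_elemSubmodel hκ hκθ hι _ hc
  have hV : PairClosed (ZFSet.vonNeumann θ.ord) := pairClosed_vonNeumann_ord (hκ.trans hκθ.le)
  refine ⟨θ, hθ, hκθ, fun i α hα => hV.snd_mem (hV.trans.mem_trans
    (pair_mem_seqGraph.2 ⟨hα, rfl⟩) (hc i)), ?_⟩
  obtain ⟨N, j, hNκ, ⟨δ, hδ, hjδ⟩, hN⟩ := hE θ hθ hκθ.le M hM hMκ hMcard
  obtain ⟨π, hN', hπ⟩ := exists_mostowski_equiv hV hM j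
  have hmem : ∀ x y : N, (x : ZFSet.{u}) ∈ (y : ZFSet.{u}) → (π x : ZFSet.{u}) ∈ (π y : ZFSet.{u}) := by
    intro x y h
    rw [hπ, hπ, mem_wfCollapse]
    exact ⟨x, h, rfl⟩
  obtain ⟨lim, hlim, -⟩ := exists_limits_of_embedding hV hN' hM hMκ (π.toElementaryEmbedding.comp j)
    (δ := π δ) (hmem _ _ hδ) (fun α hα => (hjδ α hα).imp (hmem _ _) fun h => congrArg (fun x : N => (π x : ZFSet.{u})) h) g hcM
  exact ⟨_, lim, hN', hN, hlim⟩

/-- In addition to the general limit construction, constant sequences of ordinals below `κ` keep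
their values: `j` fixes these ordinals, and so does the collapse, because `κ + 1 ⊆ N`. The index `δ`
is `κ` itself. -/
theorem CriticalEmbeddingProperty.exists_limits (hE : L.CriticalEmbeddingProperty κ) (hκ : ℵ₀ ≤ κ)
    (hι : #ι ≤ κ) (g : ι → Ordinal.{u} → ZFSet.{u}) : ∃ θ : Cardinal.{u}, θ.IsRegular ∧ κ < θ ∧
      (∀ i, ∀ α < κ.ord, g i α ∈ ZFSet.vonNeumann θ.ord) ∧ ∃ N lim, PairClosed N ∧
        L.TruthfulTransitive N ∧ Limits κ (ZFSet.vonNeumann θ.ord) g N lim ∧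
        ∀ i, ∀ γ < κ.ord, (∀ α < κ.ord, g i α = γ.toZFSet) → lim i = γ.toZFSet := by
  obtain ⟨θ, hθ, hκθ, hc⟩ := exists_regular_rank hκ fun i => seqGraph κ (g i)
  obtain ⟨M, hM, hMκ, hMcard, hcM⟩ := exists_elemSubmodel hκ hκθ hι _ hc
  have hV : PairClosed (ZFSet.vonNeumann θ.ord) := pairClosed_vonNeumann_ord (hκ.trans hκθ.le)
  refine ⟨θ, hθ, hκθ, fun i α hα => hV.snd_mem (hV.trans.mem_trans
    (pair_mem_seqGraph.2 ⟨hα, rfl⟩) (hc i)), ?_⟩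
  obtain ⟨N, j, hNκ, hj, hδ, hN⟩ := hE θ hθ hκθ.le M hM hMκ hMcard
  obtain ⟨π, hN', hπ⟩ := exists_mostowski_equiv hV hM j
  have hmem : ∀ x y : N, (x : ZFSet.{u}) ∈ (y : ZFSet.{u}) → (π x : ZFSet.{u}) ∈ (π y : ZFSet.{u}) := by
    intro x y h
    rw [hπ, hπ, mem_wfCollapse]
    exact ⟨x, h, rfl⟩
  have hπκ : ∀ (α : Ordinal.{u}) (hα : α ≤ κ.ord), (π ⟨α.toZFSet, hNκ α hα⟩ : ZFSet.{u}) = α.toZFSet := by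
    intro α hα
    rw [hπ, wfCollapse_eq_self _ (ZFSet.isOrdinal_toZFSet _)]
    intro y hy
    obtain ⟨β, hβ, rfl⟩ := Ordinal.mem_toZFSet_iff.1 hy
    exact hNκ β (hβ.le.trans hα)
  have hjN : ∀ (α : Ordinal.{u}) (hα : α < κ.ord),
      j ⟨α.toZFSet, hMκ α hα.le⟩ = ⟨α.toZFSet, hNκ α hα.le⟩ := fun α hα => Subtype.ext (hj α hα)
  obtain ⟨lim, hlim, hconst⟩ := exists_limits_of_embedding hV hN' hM hMκ
    (π.toElementaryEmbedding.comp j) (δ := π ⟨κ.ord.toZFSet, hNκ _ le_rfl⟩) (hmem _ _ hδ)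
    (fun α hα => .inl (hmem _ _ (by
      rw [hj α hα]
      exact Ordinal.toZFSet_mem_toZFSet_iff.2 hα))) g hcM
  refine ⟨_, lim, hN', hN, hlim, fun i γ hγ h => (hconst i ⟨γ.toZFSet, hMκ γ hγ.le⟩ h).trans ?_⟩
  change (π (j ⟨γ.toZFSet, hMκ γ hγ.le⟩) : ZFSet.{u}) = γ.toZFSet
  rw [hjN γ hγ]
  exact hπκ γ hγ.le

theorem CriticalEmbeddingProperty.embeddingProperty (hE : L.CriticalEmbeddingProperty κ) :
    L.EmbeddingProperty κ := by
  intro θ hθ hκθ M hM hMκ hMcard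
  obtain ⟨N, j, hNκ, hj, hδ, hN⟩ := hE θ hθ hκθ M hM hMκ hMcard
  refine ⟨N, j, hNκ, ⟨⟨_, hNκ _ le_rfl⟩, hδ, fun α hα => .inl ?_⟩, hN⟩
  rw [hj α hα]
  exact Ordinal.toZFSet_mem_toZFSet_iff.2 hα

/-- For `κ = ω` the limit of the sequence of natural numbers would be a real natural number, since
being one is absolute for the transitive `N`, and would yet exceed every natural number. -/
theorem EmbeddingProperty.aleph0_lt (hE : L.EmbeddingProperty κ) (hκ : ℵ₀ ≤ κ) : ℵ₀ < κ := by
  refine hκ.lt_of_ne ?_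
  rintro rfl
  obtain ⟨θ, -, -, -, N, lim, -, -, hlim⟩ := hE.exists_limits hκ (ι := ULift (Option ℕ)) (by simp)
    (fun i α => i.down.elim α.toZFSet fun n => natSet n)
  obtain ⟨n, hn⟩ := hlim.los (fun X v => ∃ n, v ⟨none⟩ = natSet n) (.isNat (.var _)) 0 (by simp)
    fun α _ hα => by
      obtain ⟨n, rfl⟩ := Ordinal.lt_omega0.1 (by simpa using hα)
      exact ⟨n, rfl⟩
  have h := hlim.los (fun X v => v ⟨some n⟩ ∈ v ⟨none⟩) (.mem (.var _) (.var _)) (n + 1 : ℕ)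
    (by simpa using Ordinal.natCast_lt_omega0 (n + 1)) fun α hα _ => by
      refine Ordinal.toZFSet_mem_toZFSet_iff.2 (lt_of_lt_of_le ?_ hα)
      exact_mod_cast Nat.lt_succ_self n
  have h' : lim ⟨some n⟩ = natSet n := hlim.los (fun X v => v ⟨some n⟩ = natSet n)
    (.eq_natSet (.var _) n) 0 (by simp) fun _ _ _ => rfl
  rw [h', hn] at h
  exact ZFSet.mem_irrefl _ h

end FinitaryLogic

/-! ### Structures represented by families of sets -/

/-- Indices for the components of a structure in the signature `S`, for the natural numbers, and for
the parameter of the logic. -/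
structure StrIndex (S : FirstOrder.Language.{u, u}) (ι : Type w) where
  dom : ι
  fn : ∀ n, S.Functions n → ι
  rel : ∀ n, S.Relations n → ι
  num : ℕ → ι
  par : ι

/-- The element of `ι` denoted by a new constant symbol. -/
def newConst {α : Type*} : ∀ {m : ℕ}, (FirstOrder.Language.constantsOn α).Functions m → α
  | 0, c => c
  | _ + 1, c => c.elim

theorem funSet_withConst_inl {S : FirstOrder.Language.{v, w}} {α : Type*} (A : Str.{u} S)
    (x : α → A.Dom) {m : ℕ} (f : S.Functions m) : (A.withConst x).funSet (Sum.inl f) = A.funSet f := rfl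

theorem relSet_withConst_inl {S : FirstOrder.Language.{v, w}} {α : Type*} (A : Str.{u} S)
    (x : α → A.Dom) {m : ℕ} (R : S.Relations m) : (A.withConst x).relSet (Sum.inl R) = A.relSet R := rfl

/-- The graph of a constant is a singleton; writing it as an unordered pair makes it an instance of
a basic definable operation. -/
theorem funSet_withConst_inr {S : FirstOrder.Language.{v, w}} {α : Type*} (A : Str.{u} S)
    (x : α → A.Dom) {m : ℕ} (c : (FirstOrder.Language.constantsOn α).Functions m) :
    (A.withConst x).funSet (Sum.inr c) =
      {(∅ : ZFSet.{u}).pair (Str.val (x (newConst c))), (∅ : ZFSet.{u}).pair (Str.val (x (newConst c)))} := by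
  cases m with
  | succ m => exact c.elim
  | zero =>
    ext z
    simp only [Str.funSet, ZFSet.mem_range, ZFSet.mem_pair, or_self]
    constructor
    · rintro ⟨y, rfl⟩
      rfl
    · rintro rfl
      exact ⟨Fin.elim0, rfl⟩

namespace StrIndex

variable {S : FirstOrder.Language.{u, u}} {ι : Type w} (c : StrIndex S ι)

/-- `v` gives the components of the structure `A`. -/
structure Represents (L : FinitaryLogic) (v : ι → ZFSet.{u}) (A : Str.{u} S) : Prop where
  dom : v c.dom = A.carrier
  fn : ∀ n (f : S.Functions n), v (c.fn n f) = A.funSet f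
  rel : ∀ n (R : S.Relations n), v (c.rel n R) = A.relSet R
  num : ∀ n, v (c.num n) = natSet n
  par : v c.par = realSet L.param

/-- The interpretation of a function symbol of the expansion by `n` constants. -/
noncomputable def funTerm {n m : ℕ} (v : ι → ZFSet.{u}) (x : Fin n → ZFSet.{u}) :
    (S[[Fin n]]).Functions m → ZFSet.{u} :=
  Sum.elim (fun f => v (c.fn m f))
    fun d => {(∅ : ZFSet.{u}).pair (x (newConst d)), (∅ : ZFSet.{u}).pair (x (newConst d))}

/-- The interpretation of a relation symbol of the expansion by `n` constants. -/
noncomputable def relTerm {n m : ℕ} (v : ι → ZFSet.{u}) : (S[[Fin n]]).Relations m → ZFSet.{u} :=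
  Sum.elim (fun R => v (c.rel m R)) fun R => isEmptyElim R

/-- The code of the structure in which the formula `φ` is to be evaluated. -/
noncomputable def codeTerm {L : FinitaryLogic} {n : ℕ} (φ : L.Formula S n) (v : ι → ZFSet.{u})
    (x : Fin n → ZFSet.{u}) : ZFSet.{u} :=
  codeOf (v c.dom) (fun i => c.funTerm v x (φ.2.onFunction ((L.sig φ.1).fun' i)))
    (fun i => c.relTerm (n := n) v (φ.2.onRelation ((L.sig φ.1).rel' i)))

/-- A formula uses finitely many symbols, so the code of the relevant reduct is obtained from
finitely many components by iterated pairing, even if the signature is infinite. -/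
theorem dfnTerm_codeTerm {L : FinitaryLogic} {n : ℕ} (φ : L.Formula S n) :
    DfnTerm fun v : ι ⊕ Fin n → ZFSet.{u} =>
      c.codeTerm φ (fun i => v (Sum.inl i)) fun i => v (Sum.inr i) := by
  refine .codeOf (.var _) (fun i => ?_) fun i => ?_
  · rcases φ.2.onFunction ((L.sig φ.1).fun' i) with f | d
    · exact .var _
    · exact .upair (.kpair .empty (.var _)) (.kpair .empty (.var _))
  · rcases φ.2.onRelation ((L.sig φ.1).rel' i) with R | R
    · exact .var _
    · exact isEmptyElim R

/-- The formula `φ` holds according to the set `X`. -/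
def HoldsAt {L : FinitaryLogic} {n : ℕ} (φ : L.Formula S n) (X : ZFSet.{u}) (v : ι → ZFSet.{u})
    (x : Fin n → ZFSet.{u}) : Prop :=
  HoldsIn X L.sat ![c.codeTerm φ v x, v (c.num φ.1), v c.par]

theorem dfn_holdsAt {L : FinitaryLogic} {n : ℕ} (φ : L.Formula S n) :
    Dfn fun X (v : ι ⊕ Fin n → ZFSet.{u}) =>
      c.HoldsAt φ X (fun i => v (Sum.inl i)) fun i => v (Sum.inr i) :=
  .holdsIn _ (c.dfnTerm_codeTerm φ) (.var _) (.var _)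

variable {c} {L : FinitaryLogic} {v : ι → ZFSet.{u}} {A : Str.{u} S}

theorem Represents.codeTerm_eq (h : c.Represents L v A) {n : ℕ} (φ : L.Formula S n) (x : Fin n → A.Dom) :
    c.codeTerm φ v (fun i => Str.val (x i)) = code ((A.withConst x).reduct φ.2) := by
  rw [code_eq, codeTerm]
  have h1 : ∀ {m : ℕ} (f : (S[[Fin n]]).Functions m),
      c.funTerm v (fun i => Str.val (x i)) f = (A.withConst x).funSet f := by
    rintro m (f | d)
    · exact (h.fn m f).trans (funSet_withConst_inl A x f).symm
    · exact (funSet_withConst_inr A x d).symm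
  have h2 : ∀ {m : ℕ} (R : (S[[Fin n]]).Relations m),
      c.relTerm (n := n) v R = (A.withConst x).relSet R := by
    rintro m (R | R)
    · exact (h.rel m R).trans (relSet_withConst_inl A x R).symm
    · exact isEmptyElim R
  simp only [h1, h2, h.dom]
  rfl

/-- The components lie in `X`, hence so does the code of the structure in which `φ` is evaluated;
truthfulness of `X` then identifies internal with actual satisfaction. -/
theorem Represents.holdsAt_iff (h : c.Represents L v A) {X : ZFSet.{u}} (hX : PairClosed X)
    (hv : ∀ i, v i ∈ X) (hL : L.TruthfulTransitive X) {n : ℕ} (φ : L.Formula S n) (x : Fin n → A.Dom) :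
    c.HoldsAt φ X v (fun i => Str.val (x i)) ↔ L.Realize A φ x := by
  have hmem := (c.dfnTerm_codeTerm φ).mem X hX (Sum.elim v fun i => Str.val (x i)) (by
    rintro (i | i)
    · exact hv i
    · exact hX.trans.mem_trans (Str.val_mem (x i)) (h.dom ▸ hv c.dom))
  simp only [Sum.elim_inl, Sum.elim_inr] at hmem
  rw [h.codeTerm_eq] at hmem
  rw [HoldsAt, h.codeTerm_eq, h.num, h.par, hL.2 _ _ hmem]
  rfl

variable {κ : Cardinal.{u}} {V N : ZFSet.{u}} {g : ι → Ordinal.{u} → ZFSet.{u}} {lim : ι → ZFSet.{u}}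
  {A : Ordinal.{u} → Str.{u} S}

/-- The limit of a sequence of structures. -/
theorem exists_limit_structure (h0 : 0 < κ.ord) (hV : PairClosed V) (hlim : Limits κ V g N lim)
    (hA : ∀ α < κ.ord, c.Represents L (fun i => g i α) (A α)) :
    ∃ B : Str.{u} S, c.Represents L lim B := by
  have hrefl : ∀ P : ZFSet.{u} → (ι → ZFSet.{u}) → Prop, Dfn P →
      (∀ α < κ.ord, P V fun i => g i α) → P N lim := fun P hP h =>
    hlim.los P hP 0 h0 fun α _ hα => h α hα
  have hD : (lim c.dom).Nonempty := by
    obtain ⟨d, hd, -⟩ := hrefl (fun X v => ∃ d ∈ v c.dom, d = d) (.ex_mem (.var _) (.eq (.var _) (.var _)))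
      fun α hα => by
        obtain ⟨d, hd⟩ := (A α).nonempty
        have := (hA α hα).dom
        simp only at this ⊢
        rw [this]
        exact ⟨d, hd, trivial⟩
    exact ⟨d, hd⟩
  have hF : ∀ n f, IsFunOn n (lim c.dom) (lim (c.fn n f)) := fun n f =>
    hrefl (fun X v => IsFunOn n (v c.dom) (v (c.fn n f))) (.isFunOn n (.var _) (.var _)) fun α hα => by
      simp only
      rw [(hA α hα).dom, (hA α hα).fn]
      exact Str.isFunOn_funSet _ _
  have hR : ∀ n f, IsRelOn n (lim c.dom) (lim (c.rel n f)) := fun n f =>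
    hrefl (fun X v => IsRelOn n (v c.dom) (v (c.rel n f))) (.isRelOn n (.var _) (.var _)) fun α hα => by
      simp only
      rw [(hA α hα).dom, (hA α hα).rel]
      exact Str.isRelOn_relSet _ _
  refine ⟨Str.ofSets (lim c.dom) hD (fun n f => lim (c.fn n f)) (fun n R => lim (c.rel n R)) hF,
    rfl, fun n f => ?_, fun n R => ?_, fun n => ?_, ?_⟩
  · exact (Str.funSet_ofSets (F := fun n f => lim (c.fn n f)) f).symm
  · exact (Str.relSet_ofSets (R := fun n R => lim (c.rel n R)) hR R).symm
  · exact hrefl (fun X v => v (c.num n) = natSet n) (.eq_natSet (.var _) n) fun α hα => (hA α hα).num n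
  -- The sequence with constant value the parameter passes all definable properties of the parameter
  -- to its limit, and these determine a subset of `ω`.
  · have : Reflects V (fun _ : Unit => realSet L.param) N (fun _ => lim c.par) := by
      intro P hP h
      refine hrefl (fun X v => P X fun _ => v c.par) (hP.comp fun _ => c.par) fun α hα => ?_
      simp only
      rwa [(hA α hα).par]
    exact this.realSet_eq hV (i := ()) rfl

end StrIndex

namespace FinitaryLogic

variable {L : FinitaryLogic}

/-- A sentence, seen as a formula with `n` free variables. -/
def Sentence.toFormula {S : FirstOrder.Language.{v, w}} (φ : L.Sentence S) (n : ℕ) : L.Formula S n :=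
  ⟨φ.1, (S.lhomWithConstants (Fin n)).comp φ.2⟩

theorem truthfulTransitive_vonNeumann (hranks : TruthfulRanks.{u} L) {θ : Cardinal.{u}}
    (hθ : θ.IsRegular) (h : ℵ₀ < θ) : L.TruthfulTransitive (ZFSet.vonNeumann θ.ord) := by
  have := hranks θ hθ h
  rwa [Truthful, mostowski_of_isTransitive (ZFSet.isTransitive_vonNeumann _)] at this

end FinitaryLogic

/-- The components of a sequence of structures, as sequences of sets. -/
abbrev BaseIndex (S : FirstOrder.Language.{u, u}) : Type u :=
  Option ((Σ n, S.Functions n) ⊕ (Σ n, S.Relations n)) ⊕ Option (ULift.{u} ℕ)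

noncomputable def baseSeq (L : FinitaryLogic) {S : FirstOrder.Language.{u, u}} (A : Ordinal.{u} → Str.{u} S) :
    BaseIndex S → Ordinal.{u} → ZFSet.{u}
  | .inl none, α => (A α).carrier
  | .inl (some (.inl f)), α => (A α).funSet f.2
  | .inl (some (.inr R)), α => (A α).relSet R.2
  | .inr (some n), _ => natSet n.down
  | .inr none, _ => realSet L.param

/-- The indices of the components of the structures. -/
def baseIndex (S : FirstOrder.Language.{u, u}) : StrIndex S (BaseIndex S) where
  dom := .inl none
  fn := fun n f => .inl (some (.inl ⟨n, f⟩))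
  rel := fun n R => .inl (some (.inr ⟨n, R⟩))
  num := fun n => .inr (some ⟨n⟩)
  par := .inr none

theorem represents_baseSeq (L : FinitaryLogic) {S : FirstOrder.Language.{u, u}}
    (A : Ordinal.{u} → Str.{u} S) (α : Ordinal.{u}) :
    (baseIndex S).Represents L (fun i => baseSeq L A i α) (A α) :=
  ⟨rfl, fun _ _ => rfl, fun _ _ => rfl, fun _ => rfl, rfl⟩

theorem mk_baseIndex_le {S : FirstOrder.Language.{u, u}} {κ : Cardinal.{u}} (hκ : ℵ₀ ≤ κ)
    (hS : S.card ≤ κ) : #(BaseIndex S) ≤ κ := by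
  have h1 : #((Σ n, S.Functions n) ⊕ (Σ n, S.Relations n)) ≤ κ := hS
  rw [Cardinal.mk_sum, Cardinal.lift_id, Cardinal.lift_id, Cardinal.mk_option]
  refine Cardinal.add_le_of_le hκ (Cardinal.add_le_of_le hκ h1 (Cardinal.one_le_aleph0.trans hκ)) ?_
  simpa using hκ

/-- A set of size at most `κ` is the union of an increasing `κ`-sequence of sets of size `< κ`. -/
theorem exists_rank_function {Φ : Type u} {κ : Cardinal.{u}} (hκ : ℵ₀ ≤ κ) (hΦ : #Φ ≤ κ) :
    ∃ r : Φ → Ordinal.{u}, (∀ φ, r φ < κ.ord) ∧ ∀ α < κ.ord, #{φ | r φ ≤ α} < κ := by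
  obtain ⟨e⟩ : #Φ ≤ #κ.ord.ToType := by rwa [Cardinal.mk_ord_toType]
  refine ⟨fun φ => (Ordinal.ToType.mk.symm (e φ) : Ordinal.{u}), fun φ => (Ordinal.ToType.mk.symm (e φ)).2,
    fun α hα => ?_⟩
  -- The rank is the position in an injection into `κ`. The elements of rank at most `α` embed into
  -- `α + 1`, which has fewer than `κ` elements because `κ.ord` is a limit ordinal.
  have hα' : α + 1 < κ.ord := (Cardinal.isSuccLimit_ord hκ).add_one_lt hα
  rw [← Cardinal.lift_lt.{u, u + 1}]
  refine lt_of_le_of_lt (b := #(Set.Iio (α + 1))) ?_ ?_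
  · have := Cardinal.mk_le_of_injective (α := ULift.{u + 1} {φ | (Ordinal.ToType.mk.symm (e φ) : Ordinal.{u}) ≤ α})
      (β := Set.Iio (α + 1)) (f := fun φ => ⟨Ordinal.ToType.mk.symm (e φ.down), Set.mem_Iio.2 (Order.lt_add_one_iff.2 φ.down.2)⟩) (by
        rintro ⟨φ⟩ ⟨ψ⟩ h
        simp only [Subtype.mk.injEq] at h
        have := e.injective (Ordinal.ToType.mk.symm.injective (Subtype.ext h))
        exact congrArg ULift.up (Subtype.ext this))
    rwa [Cardinal.mk_uLift] at this
  · rw [Cardinal.mk_Iio_ordinal, Cardinal.lift_lt]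
    exact Cardinal.lt_ord.1 hα'

/-! ### The embedding property implies weak compactness -/

namespace FinitaryLogic

/-- A sentence is determined by its shape and the two finite lists of symbols that fill the
place-holders. -/
theorem mk_sentence_le (L : FinitaryLogic) {S : FirstOrder.Language.{u, u}} {κ : Cardinal.{u}} (hκ : ℵ₀ ≤ κ)
    (hS : S.card ≤ κ) : #(L.Sentence S) ≤ κ := by
  have hlist : ∀ Φ : Type u, #Φ ≤ κ → #(List Φ) ≤ κ := fun Φ h =>
    (Cardinal.mk_list_le_max Φ).trans (max_le hκ h)
  have hS' : #(Σ n, S.Functions n) + #(Σ n, S.Relations n) ≤ κ := by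
    rw [Cardinal.add_def]
    exact hS
  let code : L.Sentence S → ULift.{u} ℕ × List (Σ n, S.Functions n) × List (Σ n, S.Relations n) :=
    fun φ => (⟨φ.1⟩, List.ofFn fun i => ⟨_, φ.2.onFunction ((L.sig φ.1).fun' i)⟩,
      List.ofFn fun i => ⟨_, φ.2.onRelation ((L.sig φ.1).rel' i)⟩)
  have hcode : Function.Injective code := by
    rintro ⟨s, ρ⟩ ⟨s', ρ'⟩ h
    simp only [code, Prod.mk.injEq, ULift.up.injEq] at h
    obtain ⟨rfl, h1, h2⟩ := h
    have h1 := List.ofFn_injective h1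
    have h2 := List.ofFn_injective h2
    congr 1
    refine FirstOrder.Language.LHom.funext ?_ ?_
    · funext n f
      obtain ⟨i, rfl⟩ := f
      exact eq_of_heq (Sigma.mk.inj (congrFun h1 i)).2
    · funext n f
      obtain ⟨i, rfl⟩ := f
      exact eq_of_heq (Sigma.mk.inj (congrFun h2 i)).2
  refine (Cardinal.mk_le_of_injective hcode).trans ?_
  rw [Cardinal.mk_prod, Cardinal.mk_prod, Cardinal.lift_id, Cardinal.lift_id, Cardinal.lift_id,
    Cardinal.lift_id]
  refine Cardinal.mul_le_of_le hκ (by simpa using hκ) (Cardinal.mul_le_of_le hκ ?_ ?_)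
  · exact hlist _ (le_self_add.trans hS')
  · exact hlist _ ((self_le_add_left _ _).trans hS')

/-- A theory whose small subsets have models has a model if sequences of structures have limits. -/
theorem mem_WCS_of_embeddingProperty {L : FinitaryLogic} (hranks : TruthfulRanks.{u} L) {κ : Cardinal.{u}}
    (hκ : ℵ₀ ≤ κ) (hE : L.EmbeddingProperty κ) : κ ∈ L.toModelRelation.WCS := by
  refine ⟨hE.aleph0_lt hκ, fun S hS T hT => ?_⟩
  have hT' : #(T : Type u) ≤ κ := (Cardinal.mk_set_le _).trans (L.mk_sentence_le hκ hS)
  obtain ⟨r, hrκ, hr⟩ := exists_rank_function hκ hT'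
  have hA : ∀ α : Ordinal.{u}, ∃ A : Str.{u} S, α < κ.ord → ∀ φ : T, r φ ≤ α → L.Sat A φ.1 := by
    intro α
    by_cases hα : α < κ.ord
    · obtain ⟨A, hA⟩ := hT (Subtype.val '' {φ : T | r φ ≤ α}) (by rintro _ ⟨φ, -, rfl⟩; exact φ.2)
        (Cardinal.mk_image_le.trans_lt (hr α hα))
      exact ⟨A, fun _ φ hφ => hA _ ⟨φ, hφ, rfl⟩⟩
    -- Indices from `κ` on are irrelevant; a model of the empty theory serves as default value.
    · obtain ⟨A, -⟩ := hT ∅ (Set.empty_subset _) (by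
        rw [Cardinal.mk_eq_zero]
        exact Cardinal.aleph0_pos.trans_le hκ)
      exact ⟨A, fun h => absurd h hα⟩
  choose A hA using hA
  obtain ⟨θ, hθ, hκθ, hgV, N, lim, hN, hNL, hlim⟩ := hE.exists_limits hκ (mk_baseIndex_le hκ hS) (baseSeq L A)
  have hV := pairClosed_vonNeumann_ord (hκ.trans hκθ.le)
  have hVL := truthfulTransitive_vonNeumann hranks hθ (hκ.trans_lt hκθ)
  have h0 : 0 < κ.ord := (Cardinal.isSuccLimit_ord hκ).bot_lt
  obtain ⟨B, hB⟩ := (baseIndex S).exists_limit_structure h0 hV hlim fun α _ => represents_baseSeq L A α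
  refine ⟨B, fun φ hφ => ?_⟩
  -- The sentence `φ` holds in `A α` from its rank on; truthfulness of `V_θ` makes this a definable
  -- property of the components that holds eventually.
  have := hlim.los (fun X v => (baseIndex S).HoldsAt (φ.toFormula 0) X v Fin.elim0)
    ((((baseIndex S).dfn_holdsAt (φ.toFormula 0)).comp (Sum.elim id Fin.elim0)).congr
      fun X hX v hv => by
        have : (fun i : Fin 0 => v (Sum.elim id Fin.elim0 (Sum.inr i : BaseIndex S ⊕ Fin 0))) = Fin.elim0 :=
          funext fun i => i.elim0
        rw [this]
        rfl) (r ⟨φ, hφ⟩) (hrκ _) fun α hα hακ => by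
      have := ((represents_baseSeq L A α).holdsAt_iff hV (fun i => hgV i α hακ) hVL (φ.toFormula 0)
        Fin.elim0).2 (hA α hακ ⟨φ, hφ⟩ hα)
      convert this using 1
  have h2 := (hB.holdsAt_iff hN hlim.mem hNL (φ.toFormula 0) Fin.elim0).1 (by convert this using 1)
  exact h2

end FinitaryLogic

/-! ### Cardinal arithmetic -/

/-- The ordinal of a member of the canonical type of an ordinal. -/
noncomputable def toTypeVal {o : Ordinal.{u}} (a : o.ToType) : Ordinal.{u} := (Ordinal.ToType.mk.symm a).1

theorem toTypeVal_lt {o : Ordinal.{u}} (a : o.ToType) : toTypeVal a < o := (Ordinal.ToType.mk.symm a).2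

theorem toTypeVal_lt_iff {o : Ordinal.{u}} {a b : o.ToType} : toTypeVal a < toTypeVal b ↔ a < b :=
  (Ordinal.ToType.mk (o := o)).symm.lt_iff_lt

theorem toTypeVal_le_iff {o : Ordinal.{u}} {a b : o.ToType} : toTypeVal a ≤ toTypeVal b ↔ a ≤ b :=
  (Ordinal.ToType.mk (o := o)).symm.le_iff_le

theorem exists_toTypeVal_eq {o α : Ordinal.{u}} (h : α < o) : ∃ a : o.ToType, toTypeVal a = α :=
  ⟨Ordinal.ToType.mk ⟨α, h⟩, by simp [toTypeVal]⟩

theorem mk_Iio_toType_lt {κ : Cardinal.{u}} (a : κ.ord.ToType) : #(Set.Iio a) < κ := by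
  simpa using Cardinal.mk_Iio_lt a (by simp)

theorem exists_forall_lt_of_isRegular {κ : Cardinal.{u}} (hκ : κ.IsRegular) {ι : Type u} (hι : #ι < κ)
    (f : ι → κ.ord.ToType) : ∃ b, ∀ i, f i < b := by
  by_contra! h
  have h1 : IsCofinal (Set.range f) := fun b => by
    obtain ⟨i, hi⟩ := h b
    exact ⟨_, ⟨i, rfl⟩, hi⟩
  have h2 := (Order.cof_le h1).trans Cardinal.mk_range_le
  rw [Ordinal.cof_toType, hκ.cof_ord] at h2
  exact absurd hι h2.not_gt

theorem exists_cofinal_of_not_isRegular {κ : Cardinal.{u}} (hκ : ℵ₀ ≤ κ) (h : ¬ κ.IsRegular) :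
    ∃ (γ : Ordinal.{u}) (f : γ.ToType → κ.ord.ToType), γ < κ.ord ∧ ∀ a, ∃ i, a ≤ f i := by
  obtain ⟨s, hs, hcard⟩ := Order.exists_cof_eq κ.ord.ToType
  have hcof := ((Cardinal.isRegular_or_isSingular hκ).resolve_left h).cof_ord_lt
  rw [Ordinal.cof_toType] at hcard
  obtain ⟨e⟩ : Nonempty ((#s).ord.ToType ≃ s) := Cardinal.eq.1 (Cardinal.mk_ord_toType _)
  refine ⟨(#s).ord, fun i => e i, Cardinal.ord_lt_ord.2 (hcard ▸ hcof), fun a => ?_⟩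
  obtain ⟨b, hb, hab⟩ := hs a
  exact ⟨e.symm ⟨b, hb⟩, by simpa using hab⟩

/-- By regularity every function from `μ` to `κ` is bounded, so there are at most the sum over `b <
κ` of `|b| ^ μ ≤ 2 ^ (|b| * μ) ≤ 2 ^< κ = κ` of them. -/
theorem power_le_of_powerlt_eq {κ μ : Cardinal.{u}} (hκ : κ.IsRegular) (hκ' : ℵ₀ < κ)
    (h : 2 ^< κ = κ) (hμ : μ < κ) : κ ^ μ ≤ κ := by
  induction μ using Cardinal.inductionOn with
  | mk ι =>
    let F : (Σ b : κ.ord.ToType, ι → Set.Iio b) → ι → κ.ord.ToType := fun x i => x.2 i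
    have hF : Function.Surjective F := fun f => by
      obtain ⟨b, hb⟩ := exists_forall_lt_of_isRegular hκ hμ f
      exact ⟨⟨b, fun i => ⟨f i, hb i⟩⟩, rfl⟩
    have h1 := Cardinal.mk_le_of_surjective hF
    have h2 : #(ι → κ.ord.ToType) = κ ^ #ι := by rw [← Cardinal.power_def, Cardinal.mk_ord_toType]
    rw [h2, Cardinal.mk_sigma] at h1
    refine h1.trans ((Cardinal.sum_le_sum _ (fun _ => κ) fun b => ?_).trans ?_)
    · rw [← Cardinal.power_def]
      have hb : #(Set.Iio b) < κ := mk_Iio_toType_lt b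
      refine (Cardinal.power_le_power_right (Cardinal.cantor _).le).trans ?_
      rw [← Cardinal.power_mul]
      exact (Cardinal.le_powerlt 2 (Cardinal.mul_lt_of_lt hκ.1 hb hμ)).trans h.le
    · rw [Cardinal.sum_const, Cardinal.lift_id, Cardinal.lift_id, Cardinal.mk_ord_toType,
        Cardinal.mul_eq_self hκ.1]

/-! ### The number of infinitary formulas -/

namespace FinitaryLogic

variable {L : FinitaryLogic} {S : FirstOrder.Language.{u, u}} {κ : Cardinal.{u}}

/-- The constructors of infinitary formulas with their non-recursive arguments. -/
inductive InfLabel (L : FinitaryLogic) (S : FirstOrder.Language.{u, u}) (κ : Cardinal.{u}) : Type u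
  | base (n : ℕ) (φ : L.Formula S n)
  | neg (n : ℕ)
  | all (n : ℕ)
  | ex (n : ℕ)
  | conj (n : ℕ) (μ : κ.ord.ToType)
  | disj (n : ℕ) (μ : κ.ord.ToType)

/-- The recursive arguments of the constructors of infinitary formulas. -/
def InfLabel.Arity : L.InfLabel S κ → Type u
  | .base _ _ => PEmpty
  | .neg _ => PUnit
  | .all _ => PUnit
  | .ex _ => PUnit
  | .conj _ μ => Set.Iio μ
  | .disj _ μ => Set.Iio μ

/-- The construction tree of an infinitary formula. -/
def InfFormula.tree : ∀ {n : ℕ}, L.InfFormula S κ n → WType (InfLabel.Arity (L := L) (S := S) (κ := κ))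
  | n, .base φ => ⟨.base n φ, fun i => nomatch i⟩
  | n, .neg φ => ⟨.neg n, fun _ => φ.tree⟩
  | n, .all φ => ⟨.all n, fun _ => φ.tree⟩
  | n, .ex φ => ⟨.ex n, fun _ => φ.tree⟩
  | n, .conj μ φ => ⟨.conj n μ, fun i => (φ i).tree⟩
  | n, .disj μ φ => ⟨.disj n μ, fun i => (φ i).tree⟩

/-- Coding formulas as well-founded trees gives access to the cardinality bound for W-types; the
labels keep all non-recursive data, so nothing is lost. -/
theorem InfFormula.tree_injective {n : ℕ} : Function.Injective (InfFormula.tree (L := L) (S := S) (κ := κ) (n := n)) := by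
  intro φ
  induction φ with
  | base φ =>
    intro ψ h
    cases ψ <;> simp_all [tree]
  | neg φ ih =>
    intro ψ h
    cases ψ with
    | neg ψ =>
      simp only [tree, WType.mk.injEq, heq_eq_eq, true_and] at h
      rw [ih (congrFun h ⟨⟩)]
    | _ => simp [tree] at h
  | all φ ih =>
    intro ψ h
    cases ψ with
    | all ψ =>
      simp only [tree, WType.mk.injEq, heq_eq_eq, true_and] at h
      rw [ih (congrFun h ⟨⟩)]
    | _ => simp [tree] at h
  | ex φ ih =>
    intro ψ h
    cases ψ with
    | ex ψ =>
      simp only [tree, WType.mk.injEq, heq_eq_eq, true_and] at h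
      rw [ih (congrFun h ⟨⟩)]
    | _ => simp [tree] at h
  | conj μ φ ih =>
    intro ψ h
    cases ψ with
    | conj μ' ψ =>
      simp only [tree, WType.mk.injEq, InfLabel.conj.injEq, true_and] at h
      obtain ⟨rfl, h⟩ := h
      congr 1
      exact funext fun i => ih i (congrFun (eq_of_heq h) i)
    | _ => simp [tree] at h
  | disj μ φ ih =>
    intro ψ h
    cases ψ with
    | disj μ' ψ =>
      simp only [tree, WType.mk.injEq, InfLabel.disj.injEq, true_and] at h
      obtain ⟨rfl, h⟩ := h
      congr 1
      exact funext fun i => ih i (congrFun (eq_of_heq h) i)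
    | _ => simp [tree] at h

theorem mk_infLabel_le (hκ : ℵ₀ ≤ κ) (hS : S.card ≤ κ) : #(L.InfLabel S κ) ≤ κ := by
  let f : L.InfLabel S κ → (Σ n : ULift.{u} ℕ, L.Formula S n.down) ⊕ (ULift.{u} (ℕ × Fin 3)) ⊕
      (ULift.{u} (ℕ × Bool) × κ.ord.ToType) := fun
    | .base n φ => .inl ⟨⟨n⟩, φ⟩
    | .neg n => .inr (.inl ⟨n, 0⟩)
    | .all n => .inr (.inl ⟨n, 1⟩)
    | .ex n => .inr (.inl ⟨n, 2⟩)
    | .conj n μ => .inr (.inr (⟨n, true⟩, μ))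
    | .disj n μ => .inr (.inr (⟨n, false⟩, μ))
  have hf : Function.Injective f := by
    intro a b h
    cases a <;> cases b <;> simp_all [f]
  have hform : ∀ n : ℕ, #(L.Formula S n) ≤ κ := fun n => by
    refine L.mk_sentence_le hκ ?_
    rw [FirstOrder.Language.card_withConstants]
    simp only [Cardinal.mk_fin, Cardinal.lift_natCast]
    exact Cardinal.add_le_of_le hκ ((Cardinal.lift_id'.{0, u} _).trans_le hS) ((Cardinal.natCast_lt_aleph0 (n := n)).le.trans hκ)
  refine (Cardinal.mk_le_of_injective hf).trans ?_
  rw [Cardinal.mk_sum, Cardinal.mk_sum, Cardinal.mk_prod]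
  simp only [Cardinal.lift_id]
  refine Cardinal.add_le_of_le hκ ?_ (Cardinal.add_le_of_le hκ ?_ (Cardinal.mul_le_of_le hκ ?_ ?_))
  · rw [Cardinal.mk_sigma]
    refine (Cardinal.sum_le_sum _ (fun _ => κ) fun n : ULift.{u} ℕ => hform n.down).trans ?_
    rw [Cardinal.sum_const]
    exact Cardinal.mul_le_of_le hκ (by simpa using hκ) (by simp)
  · exact (Cardinal.mk_le_aleph0).trans hκ
  · exact (Cardinal.mk_le_aleph0).trans hκ
  · rw [Cardinal.mk_ord_toType]

/-- The bound on the trees reduces to a sum over labels of `κ ^ arity`: there are at most `κ`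
labels, and each arity is less than `κ`. -/
theorem mk_infFormula_le (hκ : κ.IsRegular) (hκ' : ℵ₀ < κ) (h : 2 ^< κ = κ) (hS : S.card ≤ κ) (n : ℕ) :
    #(L.InfFormula S κ n) ≤ κ := by
  refine (Cardinal.mk_le_of_injective InfFormula.tree_injective).trans (WType.cardinalMk_le_of_le ?_)
  have h1 : (1 : Cardinal.{u}) < κ := Cardinal.one_lt_aleph0.trans hκ'
  refine (Cardinal.sum_le_sum _ (fun _ => κ) fun a => power_le_of_powerlt_eq hκ hκ' h ?_).trans ?_
  · rcases a with ⟨n, φ⟩ | n | n | n | ⟨n, μ⟩ | ⟨n, μ⟩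
    · exact (Cardinal.mk_pempty).trans_lt (zero_lt_one.trans h1)
    · exact (Cardinal.mk_punit).trans_lt h1
    · exact (Cardinal.mk_punit).trans_lt h1
    · exact (Cardinal.mk_punit).trans_lt h1
    · exact mk_Iio_toType_lt μ
    · exact mk_Iio_toType_lt μ
  · rw [Cardinal.sum_const]
    simp only [Cardinal.lift_id]
    exact Cardinal.mul_le_of_le hκ.1 (mk_infLabel_le hκ.1 hS) le_rfl

end FinitaryLogic

/-! ### Critical embeddings: regularity and infinitary truth in limits -/

namespace FinitaryLogic

variable {L : FinitaryLogic} {S : FirstOrder.Language.{u, u}} {κ : Cardinal.{u}}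

/-- If `f : γ → κ` is cofinal with `γ < κ`, choose `idx α < γ` with `α ≤ f (idx α)`. The limit of
`idx` is a member of `γ`, which is fixed, hence some actual `i < γ`. Then the limit of the sequence
of all `α` does not exceed `f i`, although it lies above every ordinal less than `κ`. -/
theorem CriticalEmbeddingProperty.isRegular (hE : L.CriticalEmbeddingProperty κ) (hκ : ℵ₀ ≤ κ) :
    κ.IsRegular := by
  by_contra hreg
  obtain ⟨γ, f, hγ, hf⟩ := exists_cofinal_of_not_isRegular hκ hreg
  choose h hh using hf
  have hh' : ∀ α : Ordinal.{u}, ∃ i : γ.ToType, α < κ.ord → α ≤ toTypeVal (f i) := by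
    intro α
    by_cases hα : α < κ.ord
    · obtain ⟨a, rfl⟩ := exists_toTypeVal_eq hα
      exact ⟨h a, fun _ => toTypeVal_le_iff.2 (hh a)⟩
    · obtain ⟨a, -⟩ := exists_toTypeVal_eq (Cardinal.isSuccLimit_ord hκ).bot_lt
      exact ⟨h a, fun h => absurd h hα⟩
  choose idx hidx using hh'
  let g : ULift.{u} Bool ⊕ κ.ord.ToType → Ordinal.{u} → ZFSet.{u} :=
    Sum.elim (fun b α => if b.down then α.toZFSet else (toTypeVal (idx α)).toZFSet)
      fun a _ => (toTypeVal a).toZFSet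
  have hcard : #(ULift.{u} Bool ⊕ κ.ord.ToType) ≤ κ := by
    rw [Cardinal.mk_sum, Cardinal.lift_id, Cardinal.lift_id, Cardinal.mk_ord_toType]
    exact Cardinal.add_le_of_le hκ (Cardinal.mk_le_aleph0.trans hκ) le_rfl
  obtain ⟨θ, -, -, -, N, lim, -, -, hlim, hconst⟩ := hE.exists_limits hκ hcard g
  have hlimc : ∀ a : κ.ord.ToType, lim (.inr a) = (toTypeVal a).toZFSet := fun a =>
    hconst _ _ (toTypeVal_lt a) fun _ _ => rfl
  have h0 : 0 < κ.ord := (Cardinal.isSuccLimit_ord hκ).bot_lt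
  obtain ⟨c, hc⟩ := exists_toTypeVal_eq hγ
  have h1 := hlim.los (fun X v => v (.inl ⟨false⟩) ∈ v (.inr c)) (.mem (.var _) (.var _)) 0 h0
    fun α _ hα => by
      simp only [g, Sum.elim_inl, Sum.elim_inr, hc]
      exact Ordinal.toZFSet_mem_toZFSet_iff.2 (toTypeVal_lt _)
  simp only [hlimc, hc] at h1
  obtain ⟨β, hβ, hβ'⟩ := Ordinal.mem_toZFSet_iff.1 h1
  obtain ⟨i, rfl⟩ := exists_toTypeVal_eq hβ
  obtain ⟨c', hc'⟩ := exists_toTypeVal_eq (hβ.trans hγ)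
  -- The step from the limit of `idx` to a bound on the limit of `α` is itself a definable property
  -- of the sequences, with `i` and `f i` entering as constant sequences.
  have h2 := hlim.los (fun X v => v (.inl ⟨false⟩) = v (.inr c') → ¬ v (.inr (f i)) ∈ v (.inl ⟨true⟩))
    (.imp (.eq (.var _) (.var _)) (.not (.mem (.var _) (.var _)))) 0 h0 fun α _ hα => by
      simp only [g, Sum.elim_inl, Sum.elim_inr, hc', Bool.false_eq_true, if_false, if_true]
      intro h
      have h := Ordinal.toZFSet_injective h
      have : idx α = i := (le_antisymm (toTypeVal_le_iff.1 h.le) (toTypeVal_le_iff.1 h.ge))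
      rw [Ordinal.toZFSet_mem_toZFSet_iff, not_lt, ← this]
      exact hidx α hα
  refine h2 (by rw [← hβ', hlimc, hc']) ?_
  refine hlim.los (fun X v => v (.inr (f i)) ∈ v (.inl ⟨true⟩)) (.mem (.var _) (.var _))
    (toTypeVal (f i) + 1) ((Cardinal.isSuccLimit_ord hκ).add_one_lt (toTypeVal_lt _)) fun α hα _ => ?_
  exact Ordinal.toZFSet_mem_toZFSet_iff.2 (Order.add_one_le_iff.1 hα)

/-- The set of tuples that satisfy an infinitary formula. -/
noncomputable def InfFormula.truthSet (A : Str.{u} S) {n : ℕ} (φ : L.InfFormula S κ n) : ZFSet.{u} :=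
  ZFSet.range fun x : {x : Fin n → A.Dom // φ.Realize A x} => tuple (List.ofFn fun i => Str.val (x.1 i))

/-- The pairs of a tuple and the index of a conjunct or disjunct that it satisfies. -/
noncomputable def InfFormula.partTruthSet (A : Str.{u} S) {n : ℕ} : L.InfFormula S κ n → ZFSet.{u}
  | .conj μ φ => ZFSet.range fun x : {x : (Fin n → A.Dom) × Set.Iio μ // (φ x.2).Realize A x.1} =>
      (tuple (List.ofFn fun i => Str.val (x.1.1 i))).pair (toTypeVal x.1.2.1).toZFSet
  | .disj μ φ => ZFSet.range fun x : {x : (Fin n → A.Dom) × Set.Iio μ // (φ x.2).Realize A x.1} =>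
      (tuple (List.ofFn fun i => Str.val (x.1.1 i))).pair (toTypeVal x.1.2.1).toZFSet
  | _ => ∅

theorem InfFormula.mem_truthSet {A : Str.{u} S} {n : ℕ} {φ : L.InfFormula S κ n} {x : Fin n → A.Dom} :
    tuple (List.ofFn fun i => Str.val (x i)) ∈ φ.truthSet A ↔ φ.Realize A x := by
  simp only [truthSet, ZFSet.mem_range, Subtype.exists, exists_prop]
  constructor
  · rintro ⟨y, hy, h⟩
    have : y = x := funext fun i => Str.val_injective (congrFun (tuple_ofFn_injective h) i)
    exact this ▸ hy
  · intro h
    exact ⟨x, h, rfl⟩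

theorem pair_mem_partTruth {A : Str.{u} S} {n : ℕ} {μ : κ.ord.ToType} {φ : Set.Iio μ → L.InfFormula S κ n}
    {x : Fin n → A.Dom} {i : Set.Iio μ} : (tuple (List.ofFn fun i => Str.val (x i))).pair (toTypeVal i.1).toZFSet ∈
      (ZFSet.range fun x : {x : (Fin n → A.Dom) × Set.Iio μ // (φ x.2).Realize A x.1} =>
        (tuple (List.ofFn fun i => Str.val (x.1.1 i))).pair (toTypeVal x.1.2.1).toZFSet) ↔
      (φ i).Realize A x := by
  simp only [ZFSet.mem_range, Subtype.exists, exists_prop, Prod.exists, ZFSet.pair_inj]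
  constructor
  · rintro ⟨y, j, hj, hy, h, h'⟩
    have h1 : y = x := funext fun i => Str.val_injective (congrFun (tuple_ofFn_injective h) i)
    have h' := Ordinal.toZFSet_injective h'
    have h2 : j = i := le_antisymm (toTypeVal_le_iff.1 h'.le) (toTypeVal_le_iff.1 h'.ge)
    subst h1 h2
    exact hy
  · intro h
    exact ⟨x, i.1, i.2, h, rfl, rfl⟩

/-- Indices for the sequences of sets that describe sequences of models of infinitary formulas. -/
abbrev InfIndex (L : FinitaryLogic) (S : FirstOrder.Language.{u, u}) (κ : Cardinal.{u}) : Type u :=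
  BaseIndex S ⊕ κ.ord.ToType ⊕ (Σ n : ULift.{u} ℕ, L.InfFormula S κ n.down) × ULift.{u} Bool

/-- A conjunction refers to infinitely many truth sets, too many for one first-order clause. The
partial truth set gathers them in one set indexed by ordinals, and the constant sequences supply
these ordinals. -/
noncomputable def infSeq (L : FinitaryLogic) (κ : Cardinal.{u}) (A : Ordinal.{u} → Str.{u} S) :
    L.InfIndex S κ → Ordinal.{u} → ZFSet.{u}
  | .inl i, α => baseSeq L A i α
  | .inr (.inl a), _ => (toTypeVal a).toZFSet
  | .inr (.inr (φ, ⟨true⟩)), α => φ.2.truthSet (A α)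
  | .inr (.inr (φ, ⟨false⟩)), α => φ.2.partTruthSet (A α)

def infIndex (L : FinitaryLogic) (S : FirstOrder.Language.{u, u}) (κ : Cardinal.{u}) :
    StrIndex S (L.InfIndex S κ) where
  dom := .inl (baseIndex S).dom
  fn := fun n f => .inl ((baseIndex S).fn n f)
  rel := fun n R => .inl ((baseIndex S).rel n R)
  num := fun n => .inl ((baseIndex S).num n)
  par := .inl (baseIndex S).par

theorem represents_infSeq (L : FinitaryLogic) (κ : Cardinal.{u}) (A : Ordinal.{u} → Str.{u} S)
    (α : Ordinal.{u}) : (L.infIndex S κ).Represents L (fun i => L.infSeq κ A i α) (A α) :=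
  ⟨rfl, fun _ _ => rfl, fun _ _ => rfl, fun _ => rfl, rfl⟩

/-- The index of the truth set of a formula. -/
def truthIndex {n : ℕ} (φ : L.InfFormula S κ n) : L.InfIndex S κ := .inr (.inr (⟨⟨n⟩, φ⟩, ⟨true⟩))

/-- The index of the partial truth set of a formula. -/
def partIndex {n : ℕ} (φ : L.InfFormula S κ n) : L.InfIndex S κ := .inr (.inr (⟨⟨n⟩, φ⟩, ⟨false⟩))

/-- The index of a constant sequence of ordinals. -/
def ordIndex (L : FinitaryLogic) (S : FirstOrder.Language.{u, u}) {κ : Cardinal.{u}} (a : κ.ord.ToType) :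
    L.InfIndex S κ := .inr (.inl a)

section

variable {V N : ZFSet.{u}} {A : Ordinal.{u} → Str.{u} S} {lim : L.InfIndex S κ → ZFSet.{u}} {B : Str.{u} S}

/-- Quantification over tuples from the domain is bounded, so the universal statement is a single
definable property to which the Łoś principle applies. -/
theorem Limits.forall_tuple (h0 : 0 < κ.ord) (hlim : Limits κ V (L.infSeq κ A) N lim)
    (hB : (L.infIndex S κ).Represents L lim B) {n : ℕ}
    {P : ZFSet.{u} → (L.InfIndex S κ → ZFSet.{u}) → (Fin n → ZFSet.{u}) → Prop}
    (hP : Dfn fun X (v : L.InfIndex S κ ⊕ Fin n → ZFSet.{u}) =>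
      P X (fun i => v (Sum.inl i)) fun i => v (Sum.inr i))
    (h : ∀ α < κ.ord, ∀ x : Fin n → (A α).Dom,
      P V (fun i => L.infSeq κ A i α) fun i => Str.val (x i)) (x : Fin n → B.Dom) :
    P N lim fun i => Str.val (x i) := by
  refine hlim.los (fun X v => ∀ w : Fin n → ZFSet.{u}, (∀ i, w i ∈ v (L.infIndex S κ).dom) → P X v w)
    (.all_block_mem (.var _) hP) 0 h0 (fun α _ hα w hw => ?_) _ fun i => ?_
  · obtain ⟨y, rfl⟩ := Str.exists_val_comp_eq (A := A α) (x := w) hw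
    exact h α hα y
  · rw [hB.dom]
    exact Str.val_mem _

/-- Induction on `φ`. Each Tarski clause is a definable relation between finitely many of the
sequences, holds for every `α < κ`, and hence holds in the limit. The base case uses truthfulness of
`V` and `N`. For conjunctions and disjunctions the index set `μ` is its own limit, so exactly the
real members of the family are involved. -/
theorem Limits.mem_truth_iff (h0 : 0 < κ.ord) (hV : PairClosed V) (hVL : L.TruthfulTransitive V)
    (hgV : ∀ i, ∀ α < κ.ord, L.infSeq κ A i α ∈ V)
    (hN : PairClosed N) (hNL : L.TruthfulTransitive N)
    (hlim : Limits κ V (L.infSeq κ A) N lim) (hB : (L.infIndex S κ).Represents L lim B)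
    (hconst : ∀ a, lim (L.ordIndex S a) = (toTypeVal a).toZFSet) {n : ℕ} (φ : L.InfFormula S κ n)
    (x : Fin n → B.Dom) :
    tuple (List.ofFn fun i => Str.val (x i)) ∈ lim (truthIndex φ) ↔ φ.Realize B x := by
  have hA := represents_infSeq L κ A
  -- The section of the limit of the partial truth sets at an actual index `i` is the limit of the
  -- truth sets of the `i`-th formula; this needs that the index is fixed.
  have hpart : ∀ {n : ℕ} (φ : L.InfFormula S κ n) (μ : κ.ord.ToType)
      (ψ : Set.Iio μ → L.InfFormula S κ n) (hφ : ∀ α, φ.partTruthSet (A α) =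
        ZFSet.range fun x : {x : (Fin n → (A α).Dom) × Set.Iio μ // (ψ x.2).Realize (A α) x.1} =>
        (tuple (List.ofFn fun i => Str.val (x.1.1 i))).pair (toTypeVal x.1.2.1).toZFSet)
      (ih : ∀ i (x : Fin n → B.Dom), tuple (List.ofFn fun i => Str.val (x i)) ∈ lim (truthIndex (ψ i)) ↔
        (ψ i).Realize B x) (i : Set.Iio μ) (x : Fin n → B.Dom),
      (tuple (List.ofFn fun i => Str.val (x i))).pair (toTypeVal i.1).toZFSet ∈ lim (partIndex φ) ↔
        (ψ i).Realize B x := by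
    intro n φ μ ψ hφ ih i x
    rw [← ih, ← hconst]
    refine Limits.forall_tuple h0 hlim hB (P := fun X v w =>
      (tuple (List.ofFn w)).pair (v (L.ordIndex S i.1)) ∈ v (partIndex φ) ↔
        tuple (List.ofFn w) ∈ v (truthIndex (ψ i)))
      (.iff (.mem (.kpair (.tuple_ofFn fun i => .var _) (.var _)) (.var _))
        (.mem (.tuple_ofFn fun i => .var _) (.var _))) (fun α hα y => ?_) x
    have h1 : L.infSeq κ A (partIndex φ) α = φ.partTruthSet (A α) := rfl
    have h2 : L.infSeq κ A (truthIndex (ψ i)) α = (ψ i).truthSet (A α) := rfl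
    have h3 : L.infSeq κ A (L.ordIndex S i.1) α = (toTypeVal i.1).toZFSet := rfl
    simp only [h1, h2, h3]
    rw [InfFormula.mem_truthSet, hφ]
    exact pair_mem_partTruth
  have hmem : ∀ {μ : κ.ord.ToType} {z : ZFSet.{u}}, z ∈ (toTypeVal μ).toZFSet ↔
      ∃ i : Set.Iio μ, (toTypeVal i.1).toZFSet = z := by
    intro μ z
    rw [Ordinal.mem_toZFSet_iff]
    constructor
    · rintro ⟨a, ha, rfl⟩
      obtain ⟨i, rfl⟩ := exists_toTypeVal_eq (ha.trans (toTypeVal_lt μ))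
      exact ⟨⟨i, toTypeVal_lt_iff.1 ha⟩, rfl⟩
    · rintro ⟨i, rfl⟩
      exact ⟨_, toTypeVal_lt_iff.2 i.2, rfl⟩
  have hsnoc : ∀ {A : Str.{u} S} {n : ℕ} (x : Fin n → A.Dom) (a : A.Dom),
      (Fin.snoc (α := fun _ => ZFSet.{u}) (fun i => Str.val (x i)) (Str.val a) : Fin (n + 1) → ZFSet.{u}) =
        fun i => Str.val ((Fin.snoc (α := fun _ => A.Dom) x a : Fin (n + 1) → A.Dom) i) := by
    intro A n x a
    funext i
    refine Fin.lastCases ?_ (fun i => ?_) i <;> simp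
  have hterm : ∀ (n : ℕ), DfnTerm fun v : ((L.InfIndex S κ ⊕ Fin n) ⊕ Unit → ZFSet.{u}) =>
      tuple (List.ofFn (Fin.snoc (α := fun _ => ZFSet.{u}) (fun i => v (Sum.inl (Sum.inr i)))
        (v (Sum.inr ())) : Fin (n + 1) → ZFSet.{u})) := by
    intro n
    refine .tuple_ofFn (g := fun i v => (Fin.snoc (α := fun _ => ZFSet.{u})
      (fun i => v (Sum.inl (Sum.inr i))) (v (Sum.inr ())) : Fin (n + 1) → ZFSet.{u}) i) fun i => ?_
    refine Fin.lastCases ?_ (fun i => ?_) i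
    · simpa using DfnTerm.var _
    · simpa using DfnTerm.var _
  induction φ with
  | base φ =>
    rw [InfFormula.Realize, ← hB.holdsAt_iff hN hlim.mem hNL]
    refine Limits.forall_tuple h0 hlim hB (P := fun X v w =>
      tuple (List.ofFn w) ∈ v (truthIndex (.base φ)) ↔ (L.infIndex S κ).HoldsAt φ X v w)
      (.iff (.mem (.tuple_ofFn fun i => .var _) (.var _)) ((L.infIndex S κ).dfn_holdsAt φ))
      (fun α hα y => ?_) x
    rw [(hA α).holdsAt_iff hV (fun i => hgV i α hα) hVL]
    exact InfFormula.mem_truthSet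
  | @neg n φ ih =>
    replace ih : ∀ x : Fin n → B.Dom, (tuple (List.ofFn fun i => Str.val (x i)) ∈ lim (truthIndex φ) ↔
      φ.Realize B x) := ih
    rw [InfFormula.Realize, ← ih]
    refine Limits.forall_tuple h0 hlim hB (P := fun X v w =>
      tuple (List.ofFn w) ∈ v (truthIndex (.neg φ)) ↔ ¬ tuple (List.ofFn w) ∈ v (truthIndex φ))
      (.iff (.mem (.tuple_ofFn fun i => .var _) (.var _))
        (.not (.mem (.tuple_ofFn fun i => .var _) (.var _)))) (fun α hα y => ?_) x
    exact InfFormula.mem_truthSet.trans (not_congr InfFormula.mem_truthSet.symm)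
  | @all n φ ih =>
    replace ih : ∀ x : Fin (n + 1) → B.Dom, (tuple (List.ofFn fun i => Str.val (x i)) ∈
      lim (truthIndex φ) ↔ φ.Realize B x) := ih
    have := Limits.forall_tuple h0 hlim hB (P := fun X v w =>
      tuple (List.ofFn w) ∈ v (truthIndex (.all φ)) ↔ ∀ a ∈ v (L.infIndex S κ).dom,
        tuple (List.ofFn (Fin.snoc (α := fun _ => ZFSet.{u}) w a : Fin (n + 1) → ZFSet.{u})) ∈
          v (truthIndex φ))
      (.iff (.mem (.tuple_ofFn fun i => .var _) (.var _)) (.all_mem (.var _)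
        (.mem (hterm n) (.var _)))) (fun α hα y => by
          refine InfFormula.mem_truthSet.trans ?_
          change (∀ a : (A α).Dom, φ.Realize (A α) (Fin.snoc y a)) ↔
            ∀ a ∈ (A α).carrier, _ ∈ φ.truthSet (A α)
          constructor
          · rintro h _ ha
            obtain ⟨a, rfl⟩ := Str.exists_val_eq ha
            rw [hsnoc]
            exact InfFormula.mem_truthSet.2 (h a)
          · intro h a
            have := h _ (Str.val_mem a)
            rw [hsnoc] at this
            exact InfFormula.mem_truthSet.1 this) x
    rw [this, InfFormula.Realize, hB.dom]
    constructor
    · intro h a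
      rw [← ih, ← hsnoc]
      exact h _ (Str.val_mem a)
    · rintro h _ ha
      obtain ⟨a, rfl⟩ := Str.exists_val_eq ha
      rw [hsnoc, ih]
      exact h a
  | @ex n φ ih =>
    replace ih : ∀ x : Fin (n + 1) → B.Dom, (tuple (List.ofFn fun i => Str.val (x i)) ∈
      lim (truthIndex φ) ↔ φ.Realize B x) := ih
    have := Limits.forall_tuple h0 hlim hB (P := fun X v w =>
      tuple (List.ofFn w) ∈ v (truthIndex (.ex φ)) ↔ ∃ a ∈ v (L.infIndex S κ).dom,
        tuple (List.ofFn (Fin.snoc (α := fun _ => ZFSet.{u}) w a : Fin (n + 1) → ZFSet.{u})) ∈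
          v (truthIndex φ))
      (.iff (.mem (.tuple_ofFn fun i => .var _) (.var _)) (.ex_mem (.var _)
        (.mem (hterm n) (.var _)))) (fun α hα y => by
          refine InfFormula.mem_truthSet.trans ?_
          change (∃ a : (A α).Dom, φ.Realize (A α) (Fin.snoc y a)) ↔
            ∃ a ∈ (A α).carrier, _ ∈ φ.truthSet (A α)
          constructor
          · rintro ⟨a, h⟩
            refine ⟨_, Str.val_mem a, ?_⟩
            rw [hsnoc]
            exact InfFormula.mem_truthSet.2 h
          · rintro ⟨_, ha, h⟩
            obtain ⟨a, rfl⟩ := Str.exists_val_eq ha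
            rw [hsnoc] at h
            exact ⟨a, InfFormula.mem_truthSet.1 h⟩) x
    rw [this, InfFormula.Realize, hB.dom]
    constructor
    · rintro ⟨_, ha, h⟩
      obtain ⟨a, rfl⟩ := Str.exists_val_eq ha
      rw [hsnoc, ih] at h
      exact ⟨a, h⟩
    · rintro ⟨a, h⟩
      refine ⟨_, Str.val_mem a, ?_⟩
      rwa [hsnoc, ih]
  | conj μ φ ih =>
    have := Limits.forall_tuple h0 hlim hB (P := fun X v w =>
      tuple (List.ofFn w) ∈ v (truthIndex (.conj μ φ)) ↔ ∀ i ∈ v (L.ordIndex S μ),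
        (tuple (List.ofFn w)).pair i ∈ v (partIndex (.conj μ φ)))
      (.iff (.mem (.tuple_ofFn fun i => .var _) (.var _)) (.all_mem (.var _)
        (.mem (.kpair (.tuple_ofFn fun i => .var _) (.var _)) (.var _)))) (fun α hα y => by
          refine InfFormula.mem_truthSet.trans ?_
          rw [InfFormula.Realize]
          constructor
          · rintro h z hz
            obtain ⟨i, rfl⟩ := hmem.1 hz
            exact pair_mem_partTruth.2 (h i)
          · intro h i
            exact pair_mem_partTruth.1 (h _ (hmem.2 ⟨i, rfl⟩))) x
    rw [this, InfFormula.Realize, hconst]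
    constructor
    · intro h i
      exact (hpart _ μ φ (fun α => rfl) ih i x).1 (h _ (hmem.2 ⟨i, rfl⟩))
    · rintro h z hz
      obtain ⟨i, rfl⟩ := hmem.1 hz
      exact (hpart _ μ φ (fun α => rfl) ih i x).2 (h i)
  | disj μ φ ih =>
    have := Limits.forall_tuple h0 hlim hB (P := fun X v w =>
      tuple (List.ofFn w) ∈ v (truthIndex (.disj μ φ)) ↔ ∃ i ∈ v (L.ordIndex S μ),
        (tuple (List.ofFn w)).pair i ∈ v (partIndex (.disj μ φ)))
      (.iff (.mem (.tuple_ofFn fun i => .var _) (.var _)) (.ex_mem (.var _)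
        (.mem (.kpair (.tuple_ofFn fun i => .var _) (.var _)) (.var _)))) (fun α hα y => by
          refine InfFormula.mem_truthSet.trans ?_
          rw [InfFormula.Realize]
          constructor
          · rintro ⟨i, h⟩
            exact ⟨_, hmem.2 ⟨i, rfl⟩, pair_mem_partTruth.2 h⟩
          · rintro ⟨z, hz, h⟩
            obtain ⟨i, rfl⟩ := hmem.1 hz
            exact ⟨i, pair_mem_partTruth.1 h⟩) x
    rw [this, InfFormula.Realize, hconst]
    constructor
    · rintro ⟨z, hz, h⟩
      obtain ⟨i, rfl⟩ := hmem.1 hz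
      exact ⟨i, (hpart _ μ φ (fun α => rfl) ih i x).1 h⟩
    · rintro ⟨i, h⟩
      exact ⟨_, hmem.2 ⟨i, rfl⟩, (hpart _ μ φ (fun α => rfl) ih i x).2 h⟩

end

/-- As in the finitary case, with truth sets as additional sequences. Regularity and `2 ^< κ = κ`
are needed to have only `κ` formulas, so that all these sequences fit into a submodel of size `κ`.
-/
theorem mem_WCS_infClosure (hranks : TruthfulRanks.{u} L) (hκ : ℵ₀ ≤ κ) (h2 : 2 ^< κ = κ)
    (hE : L.CriticalEmbeddingProperty κ) : κ ∈ (L.infClosure κ).WCS := by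
  have hκ' := hE.embeddingProperty.aleph0_lt hκ
  have hreg := hE.isRegular hκ
  refine ⟨hκ', fun S hS T hT => ?_⟩
  have hform : ∀ n, #(L.InfFormula S κ n) ≤ κ := mk_infFormula_le hreg hκ' h2 hS
  have hT' : #(T : Type u) ≤ κ := (Cardinal.mk_set_le _).trans (hform 0)
  obtain ⟨r, hrκ, hr⟩ := exists_rank_function hκ hT'
  have hA : ∀ α : Ordinal.{u}, ∃ A : Str.{u} S, α < κ.ord → ∀ φ : T, r φ ≤ α →
      (L.infClosure κ).Sat A φ.1 := by
    intro α
    by_cases hα : α < κ.ord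
    · obtain ⟨A, hA⟩ := hT (Subtype.val '' {φ : T | r φ ≤ α}) (by rintro _ ⟨φ, -, rfl⟩; exact φ.2)
        (Cardinal.mk_image_le.trans_lt (hr α hα))
      exact ⟨A, fun _ φ hφ => hA _ ⟨φ, hφ, rfl⟩⟩
    · obtain ⟨A, -⟩ := hT ∅ (Set.empty_subset _) (by
        rw [Cardinal.mk_eq_zero]
        exact Cardinal.aleph0_pos.trans_le hκ)
      exact ⟨A, fun h => absurd h hα⟩
  choose A hA using hA
  have hcard : #(L.InfIndex S κ) ≤ κ := by
    rw [Cardinal.mk_sum (BaseIndex S), Cardinal.mk_sum κ.ord.ToType, Cardinal.mk_prod, Cardinal.mk_sigma]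
    simp only [Cardinal.lift_id]
    refine Cardinal.add_le_of_le hκ (mk_baseIndex_le hκ hS) (Cardinal.add_le_of_le hκ
      (Cardinal.mk_ord_toType κ).le (Cardinal.mul_le_of_le hκ ?_ (Cardinal.mk_le_aleph0.trans hκ)))
    refine (Cardinal.sum_le_sum _ (fun _ => κ) fun n : ULift.{u} ℕ => hform n.down).trans ?_
    rw [Cardinal.sum_const]
    exact Cardinal.mul_le_of_le hκ (by simpa using hκ) (by simp)
  obtain ⟨θ, hθ, hκθ, hgV, N, lim, hN, hNL, hlim, hconst⟩ := hE.exists_limits hκ hcard (L.infSeq κ A)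
  have hV := pairClosed_vonNeumann_ord (hκ.trans hκθ.le)
  have hVL := truthfulTransitive_vonNeumann hranks hθ (hκ.trans_lt hκθ)
  have h0 : 0 < κ.ord := (Cardinal.isSuccLimit_ord hκ).bot_lt
  obtain ⟨B, hB⟩ := (L.infIndex S κ).exists_limit_structure h0 hV hlim fun α _ => represents_infSeq L κ A α
  have hval : ∀ (A : Str.{u} S) (x : Fin 0 → A.Dom), (fun i => Str.val (x i)) = Fin.elim0 :=
    fun A x => funext fun i => i.elim0
  refine ⟨B, fun φ hφ => ?_⟩
  refine (Limits.mem_truth_iff h0 hV hVL hgV hN hNL hlim hB (fun a => hconst _ _ (toTypeVal_lt a)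
    fun _ _ => rfl) φ ![]).1 ?_
  rw [hval]
  refine hlim.los (fun X v => tuple (List.ofFn (Fin.elim0 : Fin 0 → ZFSet.{u})) ∈ v (truthIndex φ))
    (.mem (.tuple_ofFn fun i => i.elim0) (.var _)) (r ⟨φ, hφ⟩) (hrκ _) fun α hα hακ => ?_
  rw [← hval (A α) (![])]
  exact InfFormula.mem_truthSet.2 (hA α hακ ⟨φ, hφ⟩ hα)

end FinitaryLogic

/-! ### Expressing uniformly definable properties in expansions of the language of set theory -/

/-- The element of a structure denoted by a constant symbol. -/
def Str.const {S : FirstOrder.Language.{v, w}} (A : Str.{u} S) (c : S.Functions 0) : A.Dom :=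
  FirstOrder.Language.Structure.funMap c default

-- Parameters in `J` become constant symbols and those in `β` stay variables. The formula is
-- independent of the structure, provided its `∈`-reduct is isomorphic to a pair-closed transitive
-- set.
open FirstOrder.Language in
theorem exists_formula_of_dfn {S : FirstOrder.Language.{u, u}} (ρ : memLang →ᴸ S) {J : Type u}
    (c : J → S.Functions 0) {β : Type} {P : ZFSet.{u} → (J ⊕ β → ZFSet.{u}) → Prop} (hP : Dfn P) :
    ∃ ψ : S.Formula β, ∀ (A : Str.{u} S) (N : ZFSet.{u}) (π : (A.reduct ρ).Dom ≃[memLang] N),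
      PairClosed N → ∀ v : β → A.Dom,
        (ψ.Realize v ↔ P N (Sum.elim (fun j => π (A.const (c j))) fun b => π (v b))) := by
  obtain ⟨φ, hφ⟩ := hP
  refine ⟨BoundedFormula.subst (ρ.onFormula φ) (Sum.elim (fun j => Constants.term (c j)) Term.var),
    fun A N π hN v => ?_⟩
  let _ : memLang.Structure A.Dom := ρ.reduct A.Dom
  have : ρ.IsExpansionOn A.Dom := LHom.isExpansionOn_reduct ρ A.Dom
  rw [Formula.Realize, BoundedFormula.realize_subst]
  change (ρ.onFormula φ).Realize _ ↔ _
  rw [LHom.realize_onFormula]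
  have h1 : (fun a => Term.realize v (Sum.elim (fun j => Constants.term (c j)) Term.var a)) =
      Sum.elim (fun j => A.const (c j)) v := by
    funext a
    rcases a with j | b
    · exact Term.realize_constants
    · rfl
  rw [h1]
  refine (StrongHomClass.realize_formula (M := (A.reduct ρ).Dom) π φ).symm.trans ((hφ N hN _).trans ?_)
  have h2 : (fun i => ((π ∘ Sum.elim (fun j => A.const (c j)) v) i : ZFSet.{u})) =
      Sum.elim (fun j => (π (A.const (c j)) : ZFSet.{u})) fun b => (π (v b) : ZFSet.{u}) := by
    funext a
    rcases a with j | b <;> rfl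
  exact iff_of_eq (congrArg (P N) h2)

namespace FinitaryLogic

variable {L : FinitaryLogic} {S : FirstOrder.Language.{u, u}} (ρ : memLang →ᴸ S) {J : Type u}
  (c : J → S.Functions 0)

theorem Proper.exists_sentence_of_dfn (hL : Proper.{u} L) {P : ZFSet.{u} → (J → ZFSet.{u}) → Prop}
    (hP : Dfn P) : ∃ ψ : L.Sentence S, ∀ (A : Str.{u} S) (N : ZFSet.{u})
      (π : (A.reduct ρ).Dom ≃[memLang] N), PairClosed N →
        (L.Sat A ψ ↔ P N fun j => π (A.const (c j))) := by
  obtain ⟨χ, hχ⟩ := exists_formula_of_dfn ρ c (hP.comp (Sum.inl (β := Empty)))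
  obtain ⟨ψ, hψ⟩ := hL.firstOrder S χ
  exact ⟨ψ, fun A N π hN => (hψ A).trans (hχ A N π hN _)⟩

/-- A free variable is a new constant symbol, so this is the sentence case for the expanded
signature. -/
theorem Proper.exists_formula_one_of_dfn (hL : Proper.{u} L)
    {P : ZFSet.{u} → (J ⊕ Unit → ZFSet.{u}) → Prop}
    (hP : Dfn P) : ∃ ψ : L.Formula S 1, ∀ (A : Str.{u} S) (N : ZFSet.{u})
      (π : (A.reduct ρ).Dom ≃[memLang] N), PairClosed N → ∀ a : A.Dom,
        (L.Realize A ψ ![a] ↔ P N (Sum.elim (fun j => π (A.const (c j))) fun _ => π a)) := by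
  let c' : J ⊕ PUnit.{u + 1} → (S[[Fin 1]]).Functions 0 :=
    Sum.elim (fun j => Sum.inl (c j)) fun _ => Sum.inr (0 : Fin 1)
  obtain ⟨ψ, hψ⟩ := Proper.exists_sentence_of_dfn ((S.lhomWithConstants (Fin 1)).comp ρ) c' hL
    (hP.comp (Sum.map id fun _ => PUnit.unit))
  refine ⟨ψ, fun A N π hN a => (hψ (A.withConst ![a]) N π hN).trans (iff_of_eq (congrArg (P N) ?_))⟩
  funext i
  rcases i with j | i
  · rfl
  · rfl

end FinitaryLogic

/-! ### Expressing truthfulness -/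

/-- The signature of place-holders, in the universe `u`. -/
def FinSig.ulang (t : FinSig) : FirstOrder.Language.{u, u} :=
  ⟨fun n => ULift (t.lang.Functions n), fun n => ULift (t.lang.Relations n)⟩

def FinSig.up (t : FinSig) : t.lang →ᴸ FinSig.ulang.{u} t := ⟨fun _ f => ⟨f⟩, fun _ R => ⟨R⟩⟩

def FinSig.down (t : FinSig) : FinSig.ulang.{u} t →ᴸ t.lang := ⟨fun _ f => f.down, fun _ R => R.down⟩

/-- The components of a tuple are definable from the tuple, so the structure coded by the element
`c` is interpretable by first-order formulas that depend only on its signature. Transitivity of `N`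
ensures that every element of the coded structure is present in `N`. -/
theorem exists_interpretation_of_code {S : FirstOrder.Language.{u, u}} (ρ : memLang →ᴸ S)
    (c : S.Functions 0) (t : FinSig) : ∃ I : Interpretation S (FinSig.ulang.{u} t),
      ∀ (A : Str.{u} S) (N : ZFSet.{u}) (π : (A.reduct ρ).Dom ≃[memLang] N), PairClosed N →
        ∀ B : Str.{u} t.lang, (π (A.const c) : ZFSet.{u}) = code B →
          ∃ e : (B.reduct t.down).Dom → A.Dom, I.Defines A (B.reduct t.down) e := by
  obtain ⟨dom, hdom⟩ := exists_formula_of_dfn ρ (fun _ : PUnit.{u + 1} => c) (β := Fin 1)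
    (Dfn.ex_codeOf (k := t.funs.length) (l := t.rels.length) (.var (Sum.inl PUnit.unit))
      (P := fun X v D F R => v (Sum.inr 0) ∈ D) (.mem (.var _) (.var _)))
  have hrel : ∀ n (R : (FinSig.ulang.{u} t).Relations n), ∃ ψ : S.Formula (Fin n), _ := fun n R =>
    exists_formula_of_dfn ρ (fun _ : PUnit.{u + 1} => c) (β := Fin n)
      (Dfn.ex_codeOf (k := t.funs.length) (l := t.rels.length) (.var (Sum.inl PUnit.unit))
        (P := fun X v D F G => tuple (List.ofFn fun i => v (Sum.inr i)) ∈ G R.down.1)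
        (.mem (.tuple_ofFn fun i => .var _) (.var _)))
  have hfn : ∀ n (f : (FinSig.ulang.{u} t).Functions n), ∃ ψ : S.Formula (Fin (n + 1)), _ := fun n f =>
    exists_formula_of_dfn ρ (fun _ : PUnit.{u + 1} => c) (β := Fin (n + 1))
      (Dfn.ex_codeOf (k := t.funs.length) (l := t.rels.length) (.var (Sum.inl PUnit.unit))
        (P := fun X v D F G => (tuple (List.ofFn fun i : Fin n => v (Sum.inr i.castSucc))).pair
          (v (Sum.inr (Fin.last n))) ∈ F f.down.1)
        (.mem (.kpair (.tuple_ofFn fun i => .var _) (.var _)) (.var _)))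
  choose rel hrel using hrel
  choose fn hfn using hfn
  refine ⟨⟨dom, rel, fn⟩, fun A N π hN B hB => ?_⟩
  -- Codes decompose uniquely, so quantifying over decompositions amounts to speaking about the
  -- actual components of `B`.
  have hcode : ∀ {Q : ZFSet.{u} → (Fin t.funs.length → ZFSet.{u}) → (Fin t.rels.length → ZFSet.{u}) → Prop},
      (∃ D F R, (π (A.const c) : ZFSet.{u}) = codeOf D F R ∧ Q D F R) ↔
        Q B.carrier (fun i => B.funSet (t.fun' i)) (fun i => B.relSet (t.rel' i)) := by
    intro Q
    rw [hB, code_eq]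
    constructor
    · rintro ⟨D, F, R, h, hQ⟩
      obtain ⟨rfl, rfl, rfl⟩ := codeOf_inj h
      exact hQ
    · intro h
      exact ⟨_, _, _, rfl, h⟩
  have hBN : ∀ b : B.Dom, Str.val b ∈ N := fun b => by
    have h : code B ∈ N := hB ▸ (π (A.const c)).2
    rw [code_eq] at h
    exact hN.trans.mem_trans (Str.val_mem b) (mem_of_tuple_mem hN h _ List.mem_cons_self)
  let e : B.Dom → A.Dom := fun b => π.symm ⟨Str.val b, hBN b⟩
  have he : ∀ b, (π (e b) : ZFSet.{u}) = Str.val b := fun b =>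
    congrArg Subtype.val (π.apply_symm_apply (⟨Str.val b, hBN b⟩ : N))
  have hinj : Function.Injective e := fun b b' h =>
    Str.val_injective (by rw [← he, ← he, h])
  refine ⟨e, ⟨hinj, fun a => ?_, fun n R x => ?_, fun n f x y => ?_⟩⟩
  · refine (hdom A N π hN _).trans (hcode.trans ?_)
    change (π a : ZFSet.{u}) ∈ B.carrier ↔ _
    constructor
    · intro h
      obtain ⟨b, hb⟩ := Str.exists_val_eq h
      exact ⟨b, π.injective (Subtype.ext ((he b).trans hb))⟩
    · rintro ⟨b, rfl⟩
      exact Eq.mpr (congrArg (· ∈ B.carrier) (he b)) (Str.val_mem b)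
  · refine (hrel n R A N π hN _).trans (hcode.trans ?_)
    obtain ⟨⟨i, rfl⟩⟩ := R
    have h : (fun k => (π (e (x k)) : ZFSet.{u})) = fun k => Str.val (A := B) (x k) :=
      funext fun k => he (x k)
    exact (iff_of_eq (congrArg (fun y => tuple (List.ofFn y) ∈ B.relSet (t.rel' i)) h)).trans
      (Str.tuple_mem_relSet (A := B))
  · refine (hfn n f A N π hN _).trans (hcode.trans ?_)
    obtain ⟨⟨i, rfl⟩⟩ := f
    have h1 : ∀ k : Fin (t.funs.get i), (π (Fin.snoc (α := fun _ => A.Dom) (e ∘ x) (e y) k.castSucc) : ZFSet.{u}) =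
        Str.val (A := B) (x k) := fun k => by
      rw [Fin.snoc_castSucc]
      exact he _
    have h2 : (π (Fin.snoc (α := fun _ => A.Dom) (e ∘ x) (e y) (Fin.last _)) : ZFSet.{u}) =
        Str.val (A := B) y := by
      rw [Fin.snoc_last]
      exact he _
    exact (iff_of_eq (congrArg₂ (fun y z => (tuple (List.ofFn y)).pair z ∈ B.funSet (t.fun' i))
      (funext h1) h2)).trans (Str.pair_mem_funSet (A := B))

namespace FinitaryLogic

variable {L : FinitaryLogic} {S : FirstOrder.Language.{u, u}} (ρ : memLang →ᴸ S) {J : Type u}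
  (c : J → S.Functions 0)

/-- The set `N` evaluates sentences of shape `s` correctly. -/
def TruthfulAt (L : FinitaryLogic) (s : ℕ) (N : ZFSet.{u}) : Prop :=
  ∀ B : Str.{u} (L.sig s).lang, code B ∈ N →
    (HoldsIn N L.sat ![code B, natSet s, realSet L.param] ↔
      L.sat.Realize ![code B, natSet s, realSet L.param])

theorem sat_up_iff (s : ℕ) (B : Str.{u} (L.sig s).lang) :
    L.Sat (B.reduct (L.sig s).down) (⟨s, (L.sig s).up⟩ : L.Sentence (FinSig.ulang.{u} (L.sig s))) ↔
      L.sat.Realize ![code B, natSet s, realSet L.param] := Iff.rfl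

/-- Substituting the interpretation of the coded structure into the sentence of shape `s` expresses,
inside the logic, its actual truth in that structure, as opposed to the truth value that `N`
computes. -/
theorem Proper.exists_sat_formula (hL : Proper.{u} L) (s : ℕ) :
    ∃ ψ : L.Formula S 1, ∀ (A : Str.{u} S) (N : ZFSet.{u}) (π : (A.reduct ρ).Dom ≃[memLang] N),
      PairClosed N → ∀ (a : A.Dom) (B : Str.{u} (L.sig s).lang), code B = π a →
        (L.Realize A ψ ![a] ↔ L.sat.Realize ![code B, natSet s, realSet L.param]) := by
  obtain ⟨I, hI⟩ := exists_interpretation_of_code ((S.lhomWithConstants (Fin 1)).comp ρ)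
    (Sum.inr (0 : Fin 1)) (L.sig s)
  obtain ⟨ψ, hψ⟩ := hL.subst _ _ I ⟨s, (L.sig s).up⟩
  refine ⟨ψ, fun A N π hN a B hB => ?_⟩
  have h : ∃ e : (B.reduct (L.sig s).down).Dom → (A.withConst ![a]).Dom,
      I.Defines (A.withConst ![a]) (B.reduct (L.sig s).down) e :=
    hI (A.withConst ![a]) N π hN B hB.symm
  obtain ⟨e, he⟩ := h
  exact (hψ (A.withConst ![a]) (B.reduct (L.sig s).down) e he).trans (sat_up_iff s B)

theorem Proper.exists_not_exists_conj (hL : Proper.{u} L) (φ ψ : L.Formula S 1) :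
    ∃ σ : L.Sentence S, ∀ A : Str.{u} S,
      (L.Sat A σ ↔ ∀ a, L.Realize A φ ![a] → ¬ L.Realize A ψ ![a]) := by
  obtain ⟨η, hη⟩ := hL.conj _ φ ψ
  obtain ⟨ε, hε⟩ := hL.exist _ η
  obtain ⟨σ, hσ⟩ := hL.neg _ ε
  refine ⟨σ, fun A => (hσ A).trans ((not_congr (hε A)).trans ?_)⟩
  rw [not_exists]
  exact forall_congr' fun a => (not_congr (hη _)).trans not_and

/-- Both satisfaction relations are now available as formulas about a code: the one computed in `N`
is first-order, the actual one is an `L`-formula. The sentence says that no code witnesses a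
disagreement in either direction. -/
theorem Proper.exists_truthful_sentence (hL : Proper.{u} L) (s : ℕ) (js jp : J) :
    ∃ σ : L.Sentence S, ∀ (A : Str.{u} S) (N : ZFSet.{u}) (π : (A.reduct ρ).Dom ≃[memLang] N),
      PairClosed N → (π (A.const (c js)) : ZFSet.{u}) = natSet s →
      (π (A.const (c jp)) : ZFSet.{u}) = realSet L.param → (L.Sat A σ ↔ L.TruthfulAt s N) := by
  let x : J ⊕ Unit := Sum.inr ()
  have hcode : Dfn fun _ (v : J ⊕ Unit → ZFSet.{u}) => ∃ B : Str.{u} (L.sig s).lang, code B = v x :=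
    .isCode _ (.var _)
  have hsat : Dfn fun X (v : J ⊕ Unit → ZFSet.{u}) =>
      HoldsIn X L.sat ![v x, v (Sum.inl js), v (Sum.inl jp)] :=
    .holdsIn _ (.var _) (.var _) (.var _)
  obtain ⟨χ₁, hχ₁⟩ := hL.exists_formula_one_of_dfn ρ c (hcode.and hsat)
  obtain ⟨χ₂, hχ₂⟩ := hL.exists_formula_one_of_dfn ρ c (hcode.and hsat.not)
  obtain ⟨ψ, hψ⟩ := hL.exists_sat_formula ρ s
  obtain ⟨ψ', hψ'⟩ := hL.neg _ ψ
  obtain ⟨ν₁, hν₁⟩ := hL.exists_not_exists_conj χ₁ ψ'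
  obtain ⟨ν₂, hν₂⟩ := hL.exists_not_exists_conj χ₂ ψ
  obtain ⟨σ, hσ⟩ := hL.conj _ ν₁ ν₂
  refine ⟨σ, fun A N π hN hs hp => ?_⟩
  have key := hψ A N π hN
  have key' : ∀ a : A.Dom, L.Realize A ψ' ![a] ↔ ¬ L.Realize A ψ ![a] := fun a => hψ' _
  have h₁ : ∀ a : A.Dom, L.Realize A χ₁ ![a] ↔
      (∃ B : Str.{u} (L.sig s).lang, code B = π a) ∧ HoldsIn N L.sat ![π a, natSet s, realSet L.param] := by
    intro a
    have := hχ₁ A N π hN a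
    simp only [x, Sum.elim_inl, Sum.elim_inr, hs, hp] at this
    exact this
  have h₂ : ∀ a : A.Dom, L.Realize A χ₂ ![a] ↔
      (∃ B : Str.{u} (L.sig s).lang, code B = π a) ∧ ¬ HoldsIn N L.sat ![π a, natSet s, realSet L.param] := by
    intro a
    have := hχ₂ A N π hN a
    simp only [x, Sum.elim_inl, Sum.elim_inr, hs, hp] at this
    exact this
  rw [hσ, hν₁, hν₂]
  constructor
  · rintro ⟨n₁, n₂⟩ B hBN
    obtain ⟨a, hB⟩ : ∃ a : A.Dom, code B = π a :=
      ⟨π.symm ⟨code B, hBN⟩, congrArg Subtype.val (π.apply_symm_apply (⟨code B, hBN⟩ : N)).symm⟩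
    have k₁ := n₁ a
    have k₂ := n₂ a
    rw [h₁, key', key a B hB, ← hB] at k₁
    rw [h₂, key a B hB, ← hB] at k₂
    exact ⟨fun h => not_not.1 (k₁ ⟨⟨B, rfl⟩, h⟩), fun h => by_contra fun h' => k₂ ⟨⟨B, rfl⟩, h'⟩ h⟩
  · intro h
    constructor
    · intro a ha
      obtain ⟨⟨B, hB⟩, h1⟩ := (h₁ a).1 ha
      rw [key', key a B hB, ← h B (hB ▸ (π a).2), hB]
      exact not_not.2 h1
    · intro a ha
      obtain ⟨⟨B, hB⟩, h1⟩ := (h₂ a).1 ha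
      rw [key a B hB, ← h B (hB ▸ (π a).2), hB]
      exact h1

end FinitaryLogic

/-! ### Limits of sequences of structures, from weak compactness -/

/-- If `κ` is regular and weakly compact, then every sequence of `κ` structures has a limit, in which
all sentences hold that hold eventually along the sequence. -/
theorem ModelRelation.exists_limit {𝓛 : ModelRelation.{u}} {κ : Cardinal.{u}} (hκ : κ.IsRegular)
    (h : κ ∈ 𝓛.WCS) {S : FirstOrder.Language.{u, u}} (hS : S.card ≤ κ)
    (A : κ.ord.ToType → Str.{u} S) :
    ∃ B, ∀ ψ : 𝓛.Sentence S, (∃ a, ∀ b ≥ a, 𝓛.Sat (A b) ψ) → 𝓛.Sat B ψ := by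
  obtain ⟨B, hB⟩ := h.2 S hS {ψ | ∃ a, ∀ b ≥ a, 𝓛.Sat (A b) ψ} fun T₀ hT₀ hcard => by
    choose a ha using fun ψ : T₀ => hT₀ ψ.2
    -- Fewer than `κ` thresholds have a common bound `b`, by regularity, so the `b`-th structure
    -- satisfies the whole subset.
    obtain ⟨b, hb⟩ := exists_forall_lt_of_isRegular hκ hcard a
    exact ⟨A b, fun φ hφ => ha ⟨φ, hφ⟩ b (hb ⟨φ, hφ⟩).le⟩
  exact ⟨B, fun ψ hψ => hB ψ hψ⟩

/-- The language of set theory with constant symbols for the elements of `J`. -/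
def diagLang (J : Type u) : FirstOrder.Language.{u, u} :=
  ⟨fun n => {_j : J // n = 0}, fun n => ULift (MemRel n)⟩

namespace diagLang

variable (J : Type u)

def ofMem : memLang →ᴸ diagLang J := ⟨fun _ f => f.elim, fun _ R => ⟨R⟩⟩

variable {J}

def const (j : J) : (diagLang J).Functions 0 := ⟨j, rfl⟩

theorem card_le {κ : Cardinal.{u}} (hκ : ℵ₀ ≤ κ) (hJ : #J ≤ κ) : (diagLang J).card ≤ κ := by
  have h1 : #(Σ n, (diagLang J).Functions n) ≤ κ := by
    refine (Cardinal.mk_le_of_injective (f := fun x : Σ n, (diagLang J).Functions n => x.2.1) ?_).trans hJ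
    rintro ⟨_, i, rfl⟩ ⟨_, j, rfl⟩ h
    obtain rfl : i = j := h
    rfl
  have h2 : #(Σ n, (diagLang J).Relations n) ≤ κ := by
    have : Subsingleton (Σ n, (diagLang J).Relations n) := ⟨by
      rintro ⟨_, ⟨⟨⟩⟩⟩ ⟨_, ⟨⟨⟩⟩⟩
      rfl⟩
    exact (Cardinal.le_one_iff_subsingleton.2 this).trans (Cardinal.one_le_aleph0.trans hκ)
  rw [FirstOrder.Language.card, FirstOrder.Language.Symbols, Cardinal.mk_sum, Cardinal.lift_id,
    Cardinal.lift_id]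
  exact Cardinal.add_le_of_le hκ h1 h2

/-- The expansion of `⟨X, ∈⟩` in which the constant symbol `j` denotes `x j`. -/
def toStr {X : ZFSet.{u}} (hX : PairClosed X) (x : J → X) : Str.{u} (diagLang J) where
  carrier := X
  nonempty := ⟨∅, hX.empty_mem⟩
  str :=
    { funMap := fun f _ => x f.1
      RelMap := fun R y => FirstOrder.Language.Structure.RelMap (L := memLang) R.down y }

def equiv {X : ZFSet.{u}} (hX : PairClosed X) (x : J → X) :
    ((toStr hX x).reduct (ofMem J)).Dom ≃[memLang] X where
  toEquiv := Equiv.refl _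
  map_fun' := fun f => f.elim
  map_rel' := fun _ _ => Iff.rfl

end diagLang

/-! ### Transitive truthful limits -/

namespace FinitaryLogic

variable {L : FinitaryLogic} {κ : Cardinal.{u}}

/-- Well-foundedness is expressible by assumption and extensionality is first-order; together they
allow the Mostowski collapse, and pairing makes its image pair-closed. -/
theorem Proper.exists_collapse (hL : Proper.{u} L) (hwf : ExpressesWellFounded.{u} L) {J : Type u} :
    ∃ σ τ : L.Sentence (diagLang J),
      (∀ {X : ZFSet.{u}} (hX : PairClosed X) (x : J → X),
        L.Sat (diagLang.toStr hX x) σ ∧ L.Sat (diagLang.toStr hX x) τ) ∧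
      ∀ B : Str.{u} (diagLang J), L.Sat B σ → L.Sat B τ →
        ∃ N : ZFSet.{u}, PairClosed N ∧ Nonempty ((B.reduct (diagLang.ofMem J)).Dom ≃[memLang] N) := by
  obtain ⟨φ, hφ⟩ := hwf
  obtain ⟨χ, hχ⟩ := exists_pairAxioms_sentence.{u + 1}
  obtain ⟨τ, hτ⟩ := hL.firstOrder _ ((diagLang.ofMem J).onSentence χ)
  have hσ : ∀ B : Str.{u} (diagLang J), L.Sat B (⟨φ.1, (diagLang.ofMem J).comp φ.2⟩ : L.Sentence (diagLang J)) ↔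
      WellFounded (E (X := (B.reduct (diagLang.ofMem J)).Dom)) := fun B =>
    hφ (B.reduct (diagLang.ofMem J))
  have hτ' : ∀ B : Str.{u} (diagLang J), L.Sat B τ ↔ PairAxioms (B.reduct (diagLang.ofMem J)).Dom := by
    intro B
    refine (hτ B).trans (Iff.trans ?_ (hχ (B.reduct (diagLang.ofMem J)).Dom))
    let _ : memLang.Structure B.Dom := (diagLang.ofMem J).reduct B.Dom
    have : (diagLang.ofMem J).IsExpansionOn B.Dom :=
      FirstOrder.Language.LHom.isExpansionOn_reduct (diagLang.ofMem J) B.Dom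
    exact FirstOrder.Language.LHom.realize_onSentence (φ := diagLang.ofMem J) B.Dom χ
  refine ⟨_, τ, fun {X} hX x => ⟨(hσ _).2 (wellFounded_e X), (hτ' _).2 hX.pairAxioms⟩, fun B h1 h2 => ?_⟩
  have h1 := (hσ B).1 h1
  have h2 := (hτ' B).1 h2
  have h3 : PairAxioms (wfRange.{u} h1) := by
    have := (hχ _).2 h2
    exact (hχ _).1 ((FirstOrder.Language.StrongHomClass.realize_sentence (wfEquiv.{u} h1 h2.1) χ).1 this)
  exact ⟨_, h3.pairClosed (isTransitive_wfRange h1), ⟨wfEquiv h1 h2.1⟩⟩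

/-- Weak compactness of a logic that extends `L` yields transitive limits of sequences of expansions
of `⟨V, ∈⟩` by constants. -/
theorem Proper.exists_truthful_limit (hL : Proper.{u} L) (hwf : ExpressesWellFounded.{u} L)
    {𝓛 : ModelRelation.{u}} (incl : ∀ S : FirstOrder.Language.{u, u}, L.Sentence S → 𝓛.Sentence S)
    (hincl : ∀ (S : FirstOrder.Language.{u, u}) (A : Str.{u} S) (φ : L.Sentence S),
      𝓛.Sat A (incl S φ) ↔ L.Sat A φ)
    (hκ : κ.IsRegular) (h : κ ∈ 𝓛.WCS) {V : ZFSet.{u}} (hV : PairClosed V)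
    (hVL : L.TruthfulTransitive V) {J : Type u} (hJ : #J ≤ κ) (x : κ.ord.ToType → J → V)
    (hnat : ∀ s, ∃ j, ∀ b, (x b j : ZFSet.{u}) = natSet s)
    (hpar : ∃ j, ∀ b, (x b j : ZFSet.{u}) = realSet L.param) :
    ∃ (B : Str.{u} (diagLang J)) (N : ZFSet.{u}) (π : (B.reduct (diagLang.ofMem J)).Dom ≃[memLang] N),
      PairClosed N ∧ L.TruthfulTransitive N ∧
      (∀ P : ZFSet.{u} → (J → ZFSet.{u}) → Prop, Dfn P → (∃ a, ∀ b ≥ a, P V fun j => x b j) →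
        P N fun j => π (B.const (diagLang.const j))) ∧
      ∀ ψ : 𝓛.Sentence (diagLang J), (∃ a, ∀ b ≥ a, 𝓛.Sat (diagLang.toStr hV (x b)) ψ) → 𝓛.Sat B ψ := by
  obtain ⟨B, hB⟩ := 𝓛.exists_limit hκ h (diagLang.card_le hκ.aleph0_le hJ) fun b =>
    diagLang.toStr hV (x b)
  obtain ⟨a₀⟩ : Nonempty κ.ord.ToType := by
    rw [← Cardinal.mk_ne_zero_iff, Cardinal.mk_ord_toType]
    exact (Cardinal.aleph0_pos.trans_le hκ.aleph0_le).ne'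
  have hBL : ∀ ψ : L.Sentence (diagLang J), (∃ a, ∀ b ≥ a, L.Sat (diagLang.toStr hV (x b)) ψ) →
      L.Sat B ψ := fun ψ ⟨a, ha⟩ =>
    (hincl _ _ _).1 (hB (incl _ ψ) ⟨a, fun b hb => (hincl _ _ _).2 (ha b hb)⟩)
  obtain ⟨σ, τ, hστ, hcol⟩ := hL.exists_collapse hwf (J := J)
  obtain ⟨N, hN, ⟨π⟩⟩ := hcol B (hBL σ ⟨a₀, fun b _ => (hστ hV (x b)).1⟩)
    (hBL τ ⟨a₀, fun b _ => (hστ hV (x b)).2⟩)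
  have hlos : ∀ P : ZFSet.{u} → (J → ZFSet.{u}) → Prop, Dfn P → (∃ a, ∀ b ≥ a, P V fun j => x b j) →
      P N fun j => π (B.const (diagLang.const j)) := by
    intro P hP ⟨a, ha⟩
    obtain ⟨ψ, hψ⟩ := hL.exists_sentence_of_dfn (diagLang.ofMem J) diagLang.const hP
    exact (hψ B N π hN).1 (hBL ψ ⟨a, fun b hb =>
      (hψ _ V (diagLang.equiv hV (x b)) hV).2 (ha b hb)⟩)
  obtain ⟨jp, hjp⟩ := hpar
  -- Truthfulness of the limit requires the true parameter; its name keeps its denotation because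
  -- all definable properties of the parameter are preserved.
  have hp : (π (B.const (diagLang.const jp)) : ZFSet.{u}) = realSet L.param :=
    Reflects.realSet_eq (V := V) (v := fun _ : Unit => realSet L.param) (N := N)
      (v' := fun _ => π (B.const (diagLang.const jp))) (i := ())
      (fun P hP h => hlos _ (hP.comp fun _ => jp) ⟨a₀, fun b _ => by
        simpa only [Function.comp_def, hjp b] using h⟩) hV rfl
  have hn : ∀ s js, (∀ b, (x b js : ZFSet.{u}) = natSet s) →
      (π (B.const (diagLang.const js)) : ZFSet.{u}) = natSet s := fun s js hjs =>
    hlos _ (.eq_natSet (.var js) s) ⟨a₀, fun b _ => hjs b⟩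
  refine ⟨B, N, π, hN, ⟨hp ▸ (π _).2, fun s => ?_⟩, hlos, hB⟩
  obtain ⟨js, hjs⟩ := hnat s
  obtain ⟨σ, hσ⟩ := hL.exists_truthful_sentence (diagLang.ofMem J) diagLang.const s js jp
  exact (hσ B N π hN (hn s js hjs) hp).1 (hBL σ ⟨a₀, fun b _ =>
    (hσ _ V (diagLang.equiv hV (x b)) hV (hjs b) (hjp b)).2 (hVL.2 s)⟩)

end FinitaryLogic

/-! ### Embeddings from weak compactness -/

theorem exists_dfn_realize {J : Type u} {n : ℕ} (φ : memLang.Formula (Fin n)) (r : Fin n → J) :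
    ∃ P : ZFSet.{u} → (J → ZFSet.{u}) → Prop, Dfn P ∧
      ∀ (N : ZFSet.{u}) (y : J → N), P N (fun j => y j) ↔ φ.Realize fun i => y (r i) := by
  refine ⟨fun X v => ∃ h : ∀ i, v (r i) ∈ X, φ.Realize fun i => (⟨v (r i), h i⟩ : X), ?_, ?_⟩
  · have : Dfn fun (X : ZFSet.{u}) (v : Fin n → ZFSet.{u}) =>
        ∃ h : ∀ i, v i ∈ X, φ.Realize fun i => (⟨v i, h i⟩ : X) :=
      ⟨φ, fun X hX v => ⟨fun h => ⟨fun i => (v i).2, h⟩, fun ⟨_, h⟩ => h⟩⟩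
    exact this.comp r
  · exact fun N y => ⟨fun ⟨_, h⟩ => h, fun h => ⟨fun i => (y _).2, h⟩⟩

/-- A map from an elementary submodel that preserves all uniformly definable properties is an
elementary embedding. -/
theorem exists_elementaryEmbedding {M V N : ZFSet.{u}} (hM : ElemSubmodel M V)
    {J : Type u} {r : M → J} {y : J → N}
    (h : ∀ P : ZFSet.{u} → (J → ZFSet.{u}) → Prop, Dfn P →
      (∀ x : J → V, (∀ a : M, (x (r a) : ZFSet.{u}) = a) → P V fun j => x j) → P N fun j => y j) :
    ∃ j : M ↪ₑ[memLang] N, ∀ a, j a = y (r a) := by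
  obtain ⟨e, he⟩ := hM.exists_embedding
  have key : ∀ (n : ℕ) (φ : memLang.Formula (Fin n)) (x : Fin n → M), φ.Realize x →
      φ.Realize fun i => y (r (x i)) := by
    intro n φ x hx
    obtain ⟨P, hP, hP'⟩ := exists_dfn_realize φ fun i => r (x i)
    refine (hP' N y).1 (h P hP fun z hz => (hP' V z).2 ?_)
    have : (fun i => z (r (x i))) = e ∘ x := funext fun i => Subtype.ext ((hz _).trans (he _).symm)
    rw [this]
    exact (e.map_formula φ x).2 hx
  -- Preservation in one direction suffices: the converse is preservation of the negated formula.
  exact ⟨⟨fun a => y (r a), fun n φ x => ⟨fun h => by_contra fun h' => key n φ.not x h' h,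
    key n φ x⟩⟩, fun a => rfl⟩

/-- The rank version of the fact that an increasing map `f` on ordinals satisfies `α ≤ f α`; the
values need not be known to be ordinals. -/
theorem le_rank_of_forall_lt_mem {o : Ordinal.{u}} {f : Ordinal.{u} → ZFSet.{u}}
    (h : ∀ α < o, ∀ β < α, f β ∈ f α) {α : Ordinal.{u}} (hα : α < o) : α ≤ (f α).rank := by
  induction α using WellFoundedLT.induction with
  | ind α ih =>
    exact le_of_forall_lt fun β hβ =>
      (ih β hβ (hβ.trans hα)).trans_lt (ZFSet.rank_lt_of_mem (h α hα β hβ))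

namespace FinitaryLogic

variable {L : FinitaryLogic} {κ : Cardinal.{u}}

/-- The indices of the constant symbols: a new constant, the parameter of the logic, and the elements
of an elementary submodel of size `κ`. -/
abbrev DiagIndex (κ : Cardinal.{u}) : Type u := Option (Option κ.ord.ToType)

theorem mk_diagIndex_le (hκ : ℵ₀ ≤ κ) : #(DiagIndex κ) ≤ κ := by
  rw [Cardinal.mk_option, Cardinal.mk_option, Cardinal.mk_ord_toType, Cardinal.add_one_eq hκ,
    Cardinal.add_one_eq hκ]

/-- A truthful transitive target for an elementary submodel, from weak compactness of a logic that
extends `L`. -/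
theorem Proper.exists_embedding_of_mem_WCS (hL : Proper.{u} L) (hranks : TruthfulRanks.{u} L)
    (hwf : ExpressesWellFounded.{u} L)
    {𝓛 : ModelRelation.{u}} (incl : ∀ S : FirstOrder.Language.{u, u}, L.Sentence S → 𝓛.Sentence S)
    (hincl : ∀ (S : FirstOrder.Language.{u, u}) (A : Str.{u} S) (φ : L.Sentence S),
      𝓛.Sat A (incl S φ) ↔ L.Sat A φ)
    (hκ : κ.IsRegular) (h : κ ∈ 𝓛.WCS) {θ : Cardinal.{u}} (hθ : θ.IsRegular)
    {M : ZFSet.{u}} (hM : ElemSubmodel M (ZFSet.vonNeumann θ.ord)) (hκM : ContainsSucc M κ)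
    (hcard : #M = Cardinal.lift.{u + 1} κ) :
    ∃ (N : ZFSet.{u}) (j : M ↪ₑ[memLang] N) (r : M → DiagIndex κ) (B : Str.{u} (diagLang (DiagIndex κ)))
      (π : (B.reduct (diagLang.ofMem (DiagIndex κ))).Dom ≃[memLang] N),
      PairClosed N ∧ ContainsSucc N κ ∧ L.Truthful N ∧
      (∃ δ : N, (δ : ZFSet.{u}) ∈ (j ⟨κ.ord.toZFSet, hκM _ le_rfl⟩ : ZFSet.{u}) ∧
        ∀ (α : Ordinal.{u}) (hα : α < κ.ord),
          (j ⟨α.toZFSet, hκM α hα.le⟩ : ZFSet.{u}) ∈ (δ : ZFSet.{u})) ∧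
      κ.ord.toZFSet ∈ (j ⟨κ.ord.toZFSet, hκM _ le_rfl⟩ : ZFSet.{u}) ∧
      (∀ a, j a = π (B.const (diagLang.const (r a)))) ∧
      ∀ ψ : 𝓛.Sentence (diagLang (DiagIndex κ)),
        (∀ (hV : PairClosed (ZFSet.vonNeumann θ.ord)) (x : DiagIndex κ → ZFSet.vonNeumann θ.ord),
          (∀ a, (x (r a) : ZFSet.{u}) = a) → 𝓛.Sat (diagLang.toStr hV x) ψ) → 𝓛.Sat B ψ := by
  have hκ' : ℵ₀ < κ := h.1
  obtain ⟨hMV, -⟩ := id hM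
  have hκθ : κ < θ := Cardinal.ord_lt_ord.1 (toZFSet_mem_vonNeumann.1 (hMV _ (hκM _ le_rfl)))
  have hV := pairClosed_vonNeumann_ord hθ.aleph0_le
  have hVL := truthfulTransitive_vonNeumann hranks hθ (hκ'.trans hκθ)
  obtain ⟨e⟩ : Nonempty (M ≃ κ.ord.ToType) := by
    refine Cardinal.lift_mk_eq'.1 ?_
    rw [hcard, Cardinal.mk_ord_toType, Cardinal.lift_lift]
  let r : M → DiagIndex κ := fun a => some (some (e a))
  -- Only the new constant varies: in the `b`-th structure it denotes the ordinal `b`. All other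
  -- constants have the same denotation throughout.
  let x : κ.ord.ToType → DiagIndex κ → ZFSet.vonNeumann θ.ord := fun b i =>
    i.elim ⟨(toTypeVal b).toZFSet, toZFSet_mem_vonNeumann.2
        ((toTypeVal_lt b).trans (Cardinal.ord_lt_ord.2 hκθ))⟩
      fun i => i.elim ⟨_, hVL.1⟩ fun k => ⟨e.symm k, hMV _ (e.symm k).2⟩
  have hxr : ∀ b a, (x b (r a) : ZFSet.{u}) = a := fun b a =>
    congrArg Subtype.val (e.symm_apply_apply a)
  -- The numerals that code shapes are ordinals below `κ`, hence elements of `M`, and so have names.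
  have hω : ∀ s : ℕ, (s : Ordinal.{u}) < κ.ord := fun s =>
    (Ordinal.natCast_lt_omega0 s).trans_le (by
      rw [← Cardinal.ord_aleph0]
      exact Cardinal.ord_le_ord.2 hκ'.le)
  obtain ⟨B, N, π, hN, hNL, hlos, hB⟩ := hL.exists_truthful_limit hwf incl hincl hκ h hV hVL
    (mk_diagIndex_le hκ'.le) x (fun s => ⟨r ⟨_, hκM _ (hω s).le⟩, fun b => hxr b _⟩)
    ⟨some none, fun b => rfl⟩
  have := Cardinal.noMaxOrder hκ'.le
  obtain ⟨a₀⟩ : Nonempty κ.ord.ToType := by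
    rw [← Cardinal.mk_ne_zero_iff, Cardinal.mk_ord_toType]
    exact (Cardinal.aleph0_pos.trans hκ').ne'
  let y : DiagIndex κ → N := fun i => π (B.const (diagLang.const i))
  have hlos : ∀ P : ZFSet.{u} → (DiagIndex κ → ZFSet.{u}) → Prop, Dfn P →
      (∃ a, ∀ b ≥ a, P (ZFSet.vonNeumann θ.ord) fun j => x b j) → P N fun j => y j := hlos
  obtain ⟨j, hj⟩ := exists_elementaryEmbedding (r := r) (y := y) hM fun P hP hx =>
    hlos P hP ⟨a₀, fun b _ => hx (x b) (hxr b)⟩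
  let kM : M := ⟨κ.ord.toZFSet, hκM _ le_rfl⟩
  have hδ : (y none : ZFSet.{u}) ∈ (j kM : ZFSet.{u}) := by
    rw [hj]
    refine hlos (fun X v => v none ∈ v (r kM)) (.mem (.var _) (.var _)) ⟨a₀, fun b _ => ?_⟩
    simp only [hxr]
    exact Ordinal.toZFSet_mem_toZFSet_iff.2 (toTypeVal_lt b)
  have hjδ : ∀ (α : Ordinal.{u}) (hα : α < κ.ord),
      (j ⟨α.toZFSet, hκM α hα.le⟩ : ZFSet.{u}) ∈ (y none : ZFSet.{u}) := by
    intro α hα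
    obtain ⟨k, rfl⟩ := exists_toTypeVal_eq hα
    -- The new constant exceeds `α` only from an index beyond `α` on, so the property is eventual
    -- and not universal.
    obtain ⟨a, ha⟩ := exists_gt k
    rw [hj]
    refine hlos (fun X v => v (r _) ∈ v none) (.mem (.var _) (.var _)) ⟨a, fun b hb => ?_⟩
    simp only [hxr]
    exact Ordinal.toZFSet_mem_toZFSet_iff.2 (toTypeVal_lt_iff.2 (ha.trans_le hb))
  have hjmem : ∀ a b : M, (a : ZFSet.{u}) ∈ (b : ZFSet.{u}) → (j a : ZFSet.{u}) ∈ (j b : ZFSet.{u}) := by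
    intro a b hab
    rw [hj, hj]
    refine hlos (fun X v => v (r a) ∈ v (r b)) (.mem (.var _) (.var _)) ⟨a₀, fun b _ => ?_⟩
    simpa only [hxr] using hab
  -- The sets `j(α)` form an `∈`-increasing sequence below `δ`, so `δ` has rank at least `κ`. As
  -- `j(κ)` is an ordinal with `δ` as an element, `κ ∈ j(κ)` follows.
  have hrank : κ.ord ≤ (y none : ZFSet.{u}).rank := by
    classical
    let f : Ordinal.{u} → ZFSet.{u} := fun α => if hα : α < κ.ord then j ⟨α.toZFSet, hκM α hα.le⟩ else ∅
    refine le_of_forall_lt fun α hα => ?_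
    have h1 : α ≤ (f α).rank := le_rank_of_forall_lt_mem (fun α hα β hβ => by
      simp only [f, dif_pos hα, dif_pos (hβ.trans hα)]
      exact hjmem _ _ (Ordinal.toZFSet_mem_toZFSet_iff.2 hβ)) hα
    simp only [f, dif_pos hα] at h1
    exact h1.trans_lt (ZFSet.rank_lt_of_mem (hjδ α hα))
  have hord : (j kM : ZFSet.{u}).IsOrdinal := by
    rw [hj]
    refine hlos (fun X v => (v (r kM)).IsOrdinal) (.isOrdinal (.var _)) ⟨a₀, fun b _ => ?_⟩
    simp only [hxr]
    exact ZFSet.isOrdinal_toZFSet _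
  have hκj : κ.ord.toZFSet ∈ (j kM : ZFSet.{u}) := by
    rw [← hord.toZFSet_rank_eq, Ordinal.toZFSet_mem_toZFSet_iff]
    exact hrank.trans_lt (ZFSet.rank_lt_of_mem hδ)
  refine ⟨N, j, r, B, π, hN, fun α hα => ?_, ?_, ⟨y none, hδ, hjδ⟩, hκj, hj, fun ψ hψ =>
    hB ψ ⟨a₀, fun b _ => hψ hV (x b) (hxr b)⟩⟩
  · rcases hα.eq_or_lt with rfl | hα
    · exact hN.trans.mem_trans hκj (j kM).2
    · exact hN.trans.mem_trans (Ordinal.toZFSet_mem_toZFSet_iff.2 hα) (hN.trans.mem_trans hκj (j kM).2)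
  · rwa [Truthful, mostowski_of_isTransitive hN.trans]

theorem Proper.embeddingProperty_of_mem_WCS (hL : Proper.{u} L) (hranks : TruthfulRanks.{u} L)
    (hwf : ExpressesWellFounded.{u} L) (hκ : κ.IsRegular) (h : κ ∈ L.toModelRelation.WCS) :
    L.EmbeddingProperty κ := by
  intro θ hθ _ M hM hκM hcard
  obtain ⟨N, j, r, B, π, -, h1, h2, ⟨δ, h3, h4⟩, -⟩ := hL.exists_embedding_of_mem_WCS hranks hwf
    (𝓛 := L.toModelRelation) (fun S φ => φ) (fun S A φ => Iff.rfl) hκ h hθ hM hκM hcard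
  exact ⟨N, j, h1, ⟨δ, h3, fun α hα => .inl (h4 α hα)⟩, h2⟩

theorem sat_base_toFormula {S : FirstOrder.Language.{u, u}} (A : Str.{u} S) (φ : L.Sentence S) :
    (L.infClosure κ).Sat A (InfFormula.base (φ.toFormula 0)) ↔ L.Sat A φ := Iff.rfl

/-- For each `k < κ` an infinitary sentence says that every member of the constant for `k` is the
denotation of one of fewer than `κ` names of ordinals. It passes to the limit, so all members of
`j(k)` have the form `j(l)`, and induction on `k` gives `j(k) = k`. -/
theorem Proper.criticalEmbeddingProperty_of_mem_WCS (hL : Proper.{u} L) (hranks : TruthfulRanks.{u} L)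
    (hwf : ExpressesWellFounded.{u} L) (hκ : κ.IsRegular) (h : κ ∈ (L.infClosure κ).WCS) :
    L.CriticalEmbeddingProperty κ := by
  intro θ hθ _ M hM hκM hcard
  obtain ⟨N, j, r, B, π, hN, h1, h2, -, h3, hj, hB⟩ := hL.exists_embedding_of_mem_WCS hranks hwf
    (𝓛 := L.infClosure κ) (fun S φ => .base (φ.toFormula 0)) (fun S A φ => sat_base_toFormula A φ)
    hκ h hθ hM hκM hcard
  refine ⟨N, j, h1, fun α hα => ?_, h3, h2⟩
  have := Cardinal.noMaxOrder h.1.le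
  let o : κ.ord.ToType → M := fun k => ⟨(toTypeVal k).toZFSet, hκM _ (toTypeVal_lt k).le⟩
  have hmem : ∀ k (z : ZFSet.{u}), z ∈ (j (o k) : ZFSet.{u}) → ∃ l, z = j (o l) := by
    intro k z hz
    obtain ⟨μ, hμ⟩ := exists_gt k
    have hχ : ∀ l : Set.Iio μ, ∃ χ : L.Formula (diagLang (DiagIndex κ)) 1, _ := fun l =>
      hL.exists_formula_one_of_dfn (diagLang.ofMem _) diagLang.const
        (P := fun X v => v (.inr ()) ∈ v (.inl (r (o k))) ∧ v (.inr ()) ≠ v (.inl (r (o l))))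
        (.and (.mem (.var _) (.var _)) (.not (.eq (.var _) (.var _))))
    choose χ hχ using hχ
    -- The condition of being a member of `k` is repeated in every conjunct. Taking `μ > k` keeps
    -- the conjunction nonempty, also for `k = 0`, so that this condition is not lost.
    let ψ : L.InfFormula (diagLang (DiagIndex κ)) κ 0 := .neg (.ex (.conj μ fun l => .base (χ l)))
    have hsnoc : ∀ (A : Str.{u} (diagLang (DiagIndex κ))) (a : A.Dom),
        Fin.snoc (α := fun _ : Fin 1 => A.Dom) (![]) a = ![a] := fun A a => by
      funext i
      fin_cases i
      rfl
    have hψ : ∀ (A : Str.{u} (diagLang (DiagIndex κ))) (N : ZFSet.{u})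
        (π : (A.reduct (diagLang.ofMem (DiagIndex κ))).Dom ≃[memLang] N), PairClosed N →
        ((L.infClosure κ).Sat A ψ ↔ ¬ ∃ a : A.Dom, ∀ l : Set.Iio μ,
          (π a : ZFSet.{u}) ∈ (π (A.const (diagLang.const (r (o k)))) : ZFSet.{u}) ∧
            (π a : ZFSet.{u}) ≠ π (A.const (diagLang.const (r (o l))))) := by
      intro A N π hN
      refine not_congr (exists_congr fun a => forall_congr' fun l => ?_)
      change L.Realize A (χ l) (Fin.snoc (α := fun _ : Fin 1 => A.Dom) (![]) a) ↔ _
      rw [hsnoc]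
      exact hχ l A N π hN a
    have hBψ := (hψ B N π hN).1 (hB ψ fun hV x hx => (hψ _ _ (diagLang.equiv hV x) hV).2 ?_)
    · by_contra! hz'
      obtain ⟨a, ha⟩ := π.surjective ⟨z, hN.trans.mem_trans hz (j _).2⟩
      refine hBψ ⟨a, fun l => ?_⟩
      have ha' : (π a : ZFSet.{u}) = z := congrArg Subtype.val ha
      rw [← hj, ← hj]
      exact ⟨Eq.mpr (congrArg (· ∈ _) ha') hz, fun h => hz' l (ha'.symm.trans h)⟩
    · rintro ⟨a, ha⟩
      have ha1 : (diagLang.equiv hV x a : ZFSet.{u}) ∈ (x (r (o k)) : ZFSet.{u}) := (ha ⟨k, hμ⟩).1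
      rw [hx] at ha1
      obtain ⟨β, hβ, hβa⟩ := Ordinal.mem_toZFSet_iff.1 ha1
      obtain ⟨l, rfl⟩ := exists_toTypeVal_eq (hβ.trans (toTypeVal_lt k))
      refine (ha ⟨l, (toTypeVal_lt_iff.1 hβ).trans hμ⟩).2 ?_
      change (diagLang.equiv hV x a : ZFSet.{u}) = x (r (o l))
      rw [hx]
      exact hβa.symm
  obtain ⟨k, rfl⟩ := exists_toTypeVal_eq hα
  change (j (o k) : ZFSet.{u}) = _
  induction k using WellFoundedLT.induction with
  | ind k ih =>
    have hlt : ∀ l, (j (o l) : ZFSet.{u}) ∈ (j (o k) : ZFSet.{u}) ↔ l < k := by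
      intro l
      have := j.map_rel memRel ![o l, o k]
      refine this.trans ?_
      exact Ordinal.toZFSet_mem_toZFSet_iff.trans toTypeVal_lt_iff
    ext z
    rw [Ordinal.mem_toZFSet_iff]
    constructor
    · intro hz
      obtain ⟨l, rfl⟩ := hmem k z hz
      have hlk := (hlt l).1 hz
      exact ⟨_, toTypeVal_lt_iff.2 hlk, (ih l hlk (toTypeVal_lt l)).symm⟩
    · rintro ⟨β, hβ, rfl⟩
      obtain ⟨l, rfl⟩ := exists_toTypeVal_eq (hβ.trans hα)
      have hlk := toTypeVal_lt_iff.1 hβ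
      rw [← ih l hlk (toTypeVal_lt l)]
      exact (hlt l).2 hlk

end FinitaryLogic

/-! ### Weak compactness of infinitary logics: cardinal arithmetic -/

/-- Infinitary conjunctions and disjunctions are indexed by proper initial segments of `κ`; this
brings smaller index sets into that form. -/
theorem exists_equiv_Iio {κ : Cardinal.{u}} {γ : Ordinal.{u}} (h : γ < κ.ord) :
    ∃ μ : κ.ord.ToType, Nonempty (γ.ToType ≃ Set.Iio μ) := by
  obtain ⟨μ, rfl⟩ := exists_toTypeVal_eq h
  choose f hf using fun i : (toTypeVal μ).ToType => exists_toTypeVal_eq ((toTypeVal_lt i).trans h)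
  refine ⟨μ, ⟨.ofBijective (fun i => ⟨f i, toTypeVal_lt_iff.1 (hf i ▸ toTypeVal_lt i)⟩) ⟨?_, ?_⟩⟩⟩
  · intro i i' hi
    have h1 : f i = f i' := congrArg Subtype.val hi
    have h2 : toTypeVal i = toTypeVal i' := by rw [← hf, h1, hf]
    exact le_antisymm (toTypeVal_le_iff.1 h2.le) (toTypeVal_le_iff.1 h2.ge)
  · rintro ⟨l, hl⟩
    obtain ⟨i, hi⟩ := exists_toTypeVal_eq (toTypeVal_lt_iff.2 hl)
    have h2 : toTypeVal (f i) = toTypeVal l := (hf i).trans hi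
    exact ⟨i, Subtype.ext (le_antisymm (toTypeVal_le_iff.1 h2.le) (toTypeVal_le_iff.1 h2.ge))⟩

/-- The language with nullary predicates indexed by `J`. -/
def propLang (J : Type u) : FirstOrder.Language.{u, u} :=
  ⟨fun _ => PEmpty, fun n => {_j : J // n = 0}⟩

namespace propLang

variable {J : Type u}

def pred (j : J) : (propLang J).Relations 0 := ⟨j, rfl⟩

/-- The predicates that are true in a structure. -/
def truth (A : Str.{u} (propLang J)) : Set J :=
  {j | FirstOrder.Language.Structure.RelMap (M := A.Dom) (pred j) default}

def toStr (s : Set J) : Str.{u} (propLang J) where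
  carrier := {∅}
  nonempty := ⟨∅, ZFSet.mem_singleton.2 rfl⟩
  str :=
    { funMap := fun f _ => f.elim
      RelMap := fun R _ => R.1 ∈ s }

theorem truth_toStr (s : Set J) : truth (toStr s) = s := rfl

theorem card_le {κ : Cardinal.{u}} (hJ : #J ≤ κ) : (propLang J).card ≤ κ := by
  have h1 : IsEmpty (Σ n, (propLang J).Functions n) := ⟨fun x => x.2.elim⟩
  have h2 : #(Σ n, (propLang J).Relations n) ≤ κ := by
    refine (Cardinal.mk_le_of_injective (f := fun x : Σ n, (propLang J).Relations n => x.2.1) ?_).trans hJ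
    rintro ⟨_, i, rfl⟩ ⟨_, j, rfl⟩ h
    obtain rfl : i = j := h
    rfl
  rw [FirstOrder.Language.card, FirstOrder.Language.Symbols, Cardinal.mk_sum, Cardinal.lift_id,
    Cardinal.lift_id, Cardinal.mk_eq_zero, zero_add]
  exact h2

end propLang

namespace FinitaryLogic

variable {L : FinitaryLogic} {κ : Cardinal.{u}}

theorem Proper.exists_atom (hL : Proper.{u} L) (κ : Cardinal.{u}) {J : Type u} (j : J) :
    ∃ φ : L.InfFormula (propLang J) κ 0, ∀ A : Str.{u} (propLang J),
      φ.Realize A (![]) ↔ j ∈ propLang.truth A := by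
  obtain ⟨ψ, hψ⟩ := hL.firstOrder (propLang J)
    (FirstOrder.Language.Relations.formula (propLang.pred j) fun i : Fin 0 => i.elim0)
  refine ⟨.base (ψ.toFormula 0), fun A => ?_⟩
  change L.Sat A ψ ↔ _
  rw [hψ, FirstOrder.Language.Sentence.Realize, FirstOrder.Language.Formula.realize_rel]
  exact iff_of_eq (congrArg _ (Subsingleton.elim _ _))

/-- For each `Y ⊆ μ` let `σ Y` say that the truth pattern on the first `μ` predicates is not `Y`.
All these sentences together are contradictory. If `2 ^ c ≥ κ`, then any fewer than `κ` of them
leave out some `σ Z`, and the pattern `Z` is a model. -/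
theorem Proper.two_power_lt_of_mem_WCS (hL : Proper.{u} L) (h : κ ∈ (L.infClosure κ).WCS)
    {c : Cardinal.{u}} (hc : c < κ) : 2 ^ c < κ := by
  classical
  obtain ⟨μ, ⟨e⟩⟩ := exists_equiv_Iio (Cardinal.ord_lt_ord.2 hc)
  have hμ : #(Set.Iio μ) = c := by rw [← Cardinal.mk_congr e, Cardinal.mk_ord_toType]
  choose φ hφ using hL.exists_atom κ (J := κ.ord.ToType)
  let σ : Set (Set.Iio μ) → L.InfFormula (propLang κ.ord.ToType) κ 0 := fun Y =>
    .disj μ fun i => if i ∈ Y then .neg (φ i) else φ i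
  have hσ : ∀ Y A, (L.infClosure κ).Sat A (σ Y) ↔ Y ≠ {i | i.1 ∈ propLang.truth A} := by
    intro Y A
    rw [Ne, Set.ext_iff, not_forall]
    refine exists_congr fun i => ?_
    by_cases hi : i ∈ Y
    · simp only [hi, if_true, InfFormula.Realize, Set.mem_ofPred_eq, hφ, true_iff]
    · simp only [hi, if_false, Set.mem_ofPred_eq, hφ, false_iff, not_not]
  have hσ' : ∀ Y Z : Set (Set.Iio μ),
      (L.infClosure κ).Sat (propLang.toStr (Subtype.val '' Z)) (σ Y) ↔ Y ≠ Z := by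
    intro Y Z
    have h : {i : Set.Iio μ | i.1 ∈ Subtype.val '' Z} = Z :=
      Set.preimage_image_eq Z Subtype.val_injective
    rw [hσ, propLang.truth_toStr, h]
  have hinj : Function.Injective σ := fun Y Z hYZ => by
    by_contra hne
    exact (hσ' Z Z).1 (hYZ ▸ (hσ' Y Z).2 hne) rfl
  by_contra! hle
  obtain ⟨A, hA⟩ := h.2 (propLang κ.ord.ToType) (propLang.card_le (Cardinal.mk_ord_toType κ).le)
    (Set.range σ) fun T₀ hT₀ hcard => by
      obtain ⟨Z, hZ⟩ : ∃ Z, σ Z ∉ T₀ := by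
        by_contra! hall
        refine (hle.trans ?_).not_gt hcard
        rw [← hμ, ← Cardinal.mk_set]
        exact Cardinal.mk_le_of_injective (f := fun Z => (⟨σ Z, hall Z⟩ : T₀)) fun Y Z hYZ =>
          hinj (congrArg Subtype.val hYZ)
      refine ⟨propLang.toStr (Subtype.val '' Z), fun ψ hψ => ?_⟩
      obtain ⟨Y, rfl⟩ := hT₀ hψ
      exact (hσ' Y Z).2 fun hYZ => hZ (hYZ ▸ hψ)
  exact (hσ _ A).1 (hA _ ⟨_, rfl⟩) rfl

theorem Proper.powerlt_eq_of_mem_WCS (hL : Proper.{u} L) (h : κ ∈ (L.infClosure κ).WCS) :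
    2 ^< κ = κ := by
  refine le_antisymm (Cardinal.powerlt_le.2 fun c hc => (hL.two_power_lt_of_mem_WCS h hc).le) ?_
  by_contra! hlt
  -- If `λ = 2 ^< κ` were below `κ`, then `2 ^ λ ≤ λ`.
  exact ((Cardinal.cantor _).trans_le (Cardinal.le_powerlt 2 hlt)).false

/-- For singular `κ` the disjunction of `κ` atoms is expressible as a short disjunction of short
disjunctions along a cofinal map. Together with the negations of all atoms it is contradictory, but
any fewer than `κ` of these sentences omit the negation of some atom, which can be made true. -/
theorem Proper.isRegular_of_mem_WCS (hL : Proper.{u} L) (h : κ ∈ (L.infClosure κ).WCS) :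
    κ.IsRegular := by
  have hκ : ℵ₀ ≤ κ := h.1.le
  by_contra hreg
  obtain ⟨γ, f, hγ, hf⟩ := exists_cofinal_of_not_isRegular hκ hreg
  obtain ⟨μ, ⟨e⟩⟩ := exists_equiv_Iio hγ
  choose φ hφ using hL.exists_atom κ (J := κ.ord.ToType)
  let τ : L.InfFormula (propLang κ.ord.ToType) κ 0 :=
    .disj μ fun i => .disj (f (e.symm i)) fun l => φ l
  have hτ : ∀ A, (L.infClosure κ).Sat A τ ↔ ∃ l, l ∈ propLang.truth A := by
    intro A
    constructor
    · rintro ⟨i, l, hl⟩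
      exact ⟨l, (hφ _ _).1 hl⟩
    · rintro ⟨l, hl⟩
      have := Cardinal.noMaxOrder hκ
      -- The inner disjunctions range over strict initial segments, whereas cofinality is stated
      -- with `≤`, so a larger `l'` is used.
      obtain ⟨l', hl'⟩ := exists_gt l
      obtain ⟨i, hi⟩ := hf l'
      exact ⟨e i, ⟨l, by simpa using hl'.trans_le hi⟩, (hφ _ _).2 hl⟩
  let ν : κ.ord.ToType → L.InfFormula (propLang κ.ord.ToType) κ 0 := fun k => .neg (φ k)
  have hν : ∀ A k, (L.infClosure κ).Sat A (ν k) ↔ k ∉ propLang.truth A := fun A k =>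
    not_congr (hφ k A)
  have hinj : Function.Injective ν := fun k l hkl => by
    by_contra hne
    have h1 := (hν (propLang.toStr {l}) k).2 hne
    rw [hkl, hν] at h1
    exact h1 rfl
  obtain ⟨A, hA⟩ := h.2 (propLang κ.ord.ToType) (propLang.card_le (Cardinal.mk_ord_toType κ).le)
    (insert τ (Set.range ν)) fun T₀ hT₀ hcard => by
      obtain ⟨k, hk⟩ : ∃ k, ν k ∉ T₀ := by
        by_contra! hall
        refine hcard.not_ge ((Cardinal.mk_ord_toType κ).ge.trans ?_)
        exact Cardinal.mk_le_of_injective (f := fun k => (⟨ν k, hall k⟩ : T₀)) fun k l hkl =>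
          hinj (congrArg Subtype.val hkl)
      refine ⟨propLang.toStr {k}, fun ψ hψ => ?_⟩
      obtain rfl | ⟨l, rfl⟩ := hT₀ hψ
      · exact (hτ _).2 ⟨k, rfl⟩
      · exact (hν _ l).2 fun hl => hk (Set.mem_singleton_iff.1 hl ▸ hψ)
  obtain ⟨l, hl⟩ := (hτ A).1 (hA τ (Set.mem_insert _ _))
  exact (hν A l).1 (hA _ (Set.mem_insert_of_mem _ ⟨l, rfl⟩)) hl

end FinitaryLogic

end AbstractLogic

theorem theorem3p1 (L : AbstractLogic.FinitaryLogic)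
    (hproper : AbstractLogic.FinitaryLogic.Proper.{u} L)
    (hranks : AbstractLogic.FinitaryLogic.TruthfulRanks.{u} L)
    (hwf : AbstractLogic.FinitaryLogic.ExpressesWellFounded.{u} L)
    (κ : Cardinal.{u}) (hκ : ℵ₀ ≤ κ) :
    (L.EmbeddingProperty κ → κ ∈ L.toModelRelation.WCS) ∧
    (κ.IsRegular → (κ ∈ L.toModelRelation.WCS ↔ L.EmbeddingProperty κ)) ∧
    (κ ∈ (L.infClosure κ).WCS ↔ 2 ^< κ = κ ∧ L.CriticalEmbeddingProperty κ) := by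
  refine ⟨fun h => AbstractLogic.FinitaryLogic.mem_WCS_of_embeddingProperty hranks hκ h,
    fun hreg => ⟨fun h => hproper.embeddingProperty_of_mem_WCS hranks hwf hreg h,
      fun h => AbstractLogic.FinitaryLogic.mem_WCS_of_embeddingProperty hranks hκ h⟩,
    fun h => ⟨hproper.powerlt_eq_of_mem_WCS h, ?_⟩,
    fun h => AbstractLogic.FinitaryLogic.mem_WCS_infClosure hranks hκ h.1 h.2⟩
  -- Regularity is not assumed in the infinitary case; compactness of the closure supplies it.
  exact hproper.criticalEmbeddingProperty_of_mem_WCS hranks hwf (hproper.isRegular_of_mem_WCS h) h
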